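/- Let $n\in\mathbb N$. An $n$-vertex graph stream is a sequence $\sigma=\langle e_1,\dots,e_m\rangle$ of distinct edges of a simple graph $G=(V,E)$, $V=\{1,\dots,n\}$, $E=\{e_1,\dots,e_m\}$, in arbitrary order. Let $f:2^E\to\mathbb R$ be non-negative, monotone ($f(Y)\le f(X)$ for $Y\subseteq X\subseteq E$), proper ($f(\emptyset)=0$) and submodular ($f(X\cup Y)+f(X\cap Y)\le f(X)+f(Y)$ for $X,Y\subseteq E$), given by a value oracle: an algorithm may send a set $Q$ of edges held in its memory to the oracle, which returns $f(Q)$ in one step; the algorithm fails if ever $Q\not\subseteq E$. **Theorem.** There are a deterministic one-pass streaming algorithm (one finite program, the same for all $n$ and $f$, with access to $f$ only through the oracle) and a constant $C$ such that for all $n$, $\sigma$, $f$ as above: 1. the algorithm never fails; 2. it stores $O(n)$ edges at all times, and if $n\ge 2$ and a weight (real number) takes $b$ bits, its whole memory takes at most $C\,n(\lceil\log_2 n\rceil+b)$ bits at all times, which is $O(n\log n)$ when $b=O(1)$; 3. every edge of the stream is processed in at most $C$ elementary steps, oracle calls included; 4. the output $M$ is a $7.75$-approximate maximum submodular matching: $M\subseteq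 E$ is a matching, and $f(M)\ge f(N)/7.75$ for every matching $N\subseteq E$ of $G$; 5. the algorithm is the $f$-extension of Zelke's maximum weight matching algorithm with $\gamma=1$, that is, after every edge its current solution is the matching $M$ of one run (for some choice among the maximizers below) of the following procedure. *The procedure.* Start with $M=\emptyset$. Each edge $uv\in M$ carries at most one shadow edge $\mathrm{sh}(uv,u)$ and at most one shadow edge $\mathrm{sh}(uv,v)$; $S$ is the set of all shadow edges of edges of $M$. When $e=y_1y_2$ arrives, set $w(e)=f(M\cup S\cup\{e\})-f(M\cup S)$. Let $T$ consist of $e$ and, for $i=1,2$, those of the following edges that exist: the edge $g_iy_i\in M$ at $y_i$, the edge $a_ig_i=\mathrm{sh}(g_iy_i,g_i)$, and the edge of $M$ at $a_i$. For a set $A$ of edges let $J(A)$ be the set of edges of $M$ that share a vertex with an edge of $A$. Choose a matching $A\subseteq T$ that maximizes $w(A)-(1+\gamma)\,w(J(A))$. If this value is positive, replace $M$ by $(M\setminus J(A))\cup A$, and for every $g\in A$ and every endpoint $u$ of $g$ let $\mathrm{sh}(g,u)$ be the edge of $J(A)$ at $u$ (none if there is no such edge). Otherwise change nothing. -/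

import Mathlib

/-! ### Graph streams, matchings, submodular functions -/

namespace MSM

/-- A stream listing the edges of a simple graph on the vertex set `Fin n`: each edge is an unordered
pair of two distinct vertices and appears exactly once. The order is arbitrary. -/
def IsGraphStream {n : ℕ} (σ : List (Sym2 (Fin n))) : Prop :=
  σ.Nodup ∧ ∀ e ∈ σ, ¬ e.IsDiag

/-- A set of edges is a matching if two edges of it that share a vertex are equal. -/
def IsMatching {V : Type*} (M : Finset (Sym2 V)) : Prop :=
  ∀ e ∈ M, ∀ e' ∈ M, ∀ v : V, v ∈ e → v ∈ e' → e = e'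

/-- `f` is a non-negative monotone proper submodular function with ground set `E`. Only the values
of `f` on subsets of `E` matter. -/
structure IsMonotoneSubmodular {α : Type*} [DecidableEq α] (E : Finset α) (f : Finset α → ℝ) :
    Prop where
  nonneg : ∀ X, X ⊆ E → 0 ≤ f X
  proper : f ∅ = 0
  mono : ∀ X Y, Y ⊆ X → X ⊆ E → f Y ≤ f X
  submodular : ∀ X Y, X ⊆ E → Y ⊆ E → f (X ∪ Y) + f (X ∩ Y) ≤ f X + f Y

/-- `M` is an `α`-approximate maximum submodular matching of the graph with edge set `E`. -/
def IsApproxMSM {V : Type*} (E : Finset (Sym2 V)) (f : Finset (Sym2 V) → ℝ) (α : ℝ)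
    (M : Finset (Sym2 V)) : Prop :=
  M ⊆ E ∧ IsMatching M ∧ ∀ N : Finset (Sym2 V), N ⊆ E → IsMatching N → α⁻¹ * f N ≤ f M

/-! ### A streaming machine with a value oracle

The memory consists of `k` registers and `k` arrays of length `n` for vertices, `k` registers and `k`
arrays of length `n` for weights, and `k` edge sets, where `k` does not depend on `n`. -/

/-- Memory contents for an `n`-vertex input. -/
structure Mem (k n : ℕ) where
  /-- vertex registers -/
  vreg : Fin k → Option (Fin n)
  /-- vertex arrays, indexed by vertices -/
  varr : Fin k → Fin n → Option (Fin n)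
  /-- weight registers -/
  wreg : Fin k → ℝ
  /-- weight arrays, indexed by vertices -/
  warr : Fin k → Fin n → ℝ
  /-- edge sets -/
  eset : Fin k → Finset (Sym2 (Fin n))

/-- Number of edges in the edge sets. -/
def Mem.edges {k n : ℕ} (m : Mem k n) : ℕ := ∑ q, (m.eset q).card

/-- The initial memory: everything is empty. -/
noncomputable def Mem.init (k n : ℕ) : Mem k n where
  vreg _ := none
  varr _ _ := none
  wreg _ := 0
  warr _ _ := 0
  eset _ := ∅

/-- Loop-free programs. They do not mention `n`. Weights can only be copied, added, subtracted,
compared, and obtained from the oracle. -/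
inductive Cmd (k : ℕ) : Type
  | skip : Cmd k
  | seq (c d : Cmd k) : Cmd k
  /-- `vreg r := none` -/
  | vclear (r : Fin k) : Cmd k
  /-- `vreg r := vreg s` -/
  | vmove (r s : Fin k) : Cmd k
  /-- `vreg r := varr a [vreg i]` -/
  | vload (r a i : Fin k) : Cmd k
  /-- `varr a [vreg i] := vreg s` -/
  | vstore (a i s : Fin k) : Cmd k
  /-- `if vreg r = vreg s then c else d` -/
  | ifEq (r s : Fin k) (c d : Cmd k) : Cmd k
  /-- `wreg x := 0` -/
  | wclear (x : Fin k) : Cmd k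
  /-- `wreg x := wreg y` -/
  | wmove (x y : Fin k) : Cmd k
  /-- `wreg x := warr a [vreg i]` -/
  | wload (x a i : Fin k) : Cmd k
  /-- `warr a [vreg i] := wreg x` -/
  | wstore (a i x : Fin k) : Cmd k
  /-- `wreg x := wreg y + wreg z` -/
  | wadd (x y z : Fin k) : Cmd k
  /-- `wreg x := wreg y - wreg z` -/
  | wsub (x y z : Fin k) : Cmd k
  /-- `if wreg x ≤ wreg y then c else d` -/
  | ifLe (x y : Fin k) (c d : Cmd k) : Cmd k
  /-- put the edge `{vreg r, vreg s}` into the edge set `q` -/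
  | insert (q r s : Fin k) : Cmd k
  /-- remove the edge `{vreg r, vreg s}` from the edge set `q` -/
  | erase (q r s : Fin k) : Cmd k
  /-- oracle call on the edge set `q`: `wreg x := f (eset q)` -/
  | query (x q : Fin k) : Cmd k

/-- The edge named by two vertex registers, as a set with at most one element (it is empty if one
of the registers is empty). -/
def Mem.edgeOf {k n : ℕ} (m : Mem k n) (r s : Fin k) : Finset (Sym2 (Fin n)) :=
  match m.vreg r, m.vreg s with
  | some u, some v => {s(u, v)}
  | _, _ => ∅

/-- A machine state: the memory, together with a record of the number of elementary steps made, of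
all sets sent to the oracle, and of the largest number of edges held at any time. -/
structure Machine (k n : ℕ) where
  mem : Mem k n
  time : ℕ
  queries : List (Finset (Sym2 (Fin n)))
  peakEdges : ℕ

/-- One elementary step, which changes the memory to `m`. -/
def Machine.tick {k n : ℕ} (R : Machine k n) (m : Mem k n) : Machine k n where
  mem := m
  time := R.time + 1
  queries := R.queries
  peakEdges := max R.peakEdges m.edges

/-- Execution of a program with value oracle `f`. Reading an array at an empty index gives the
empty value, and writing to it has no effect. -/
noncomputable def Cmd.exec {k n : ℕ} (f : Finset (Sym2 (Fin n)) → ℝ) :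
    Cmd k → Machine k n → Machine k n
  | .skip, R => R
  | .seq c d, R => d.exec f (c.exec f R)
  | .vclear r, R => R.tick { R.mem with vreg := Function.update R.mem.vreg r none }
  | .vmove r s, R => R.tick { R.mem with vreg := Function.update R.mem.vreg r (R.mem.vreg s) }
  | .vload r a i, R =>
    R.tick { R.mem with vreg := Function.update R.mem.vreg r ((R.mem.vreg i).bind (R.mem.varr a)) }
  | .vstore a i s, R =>
    R.tick { R.mem with
      varr := match R.mem.vreg i with
        | some u => Function.update R.mem.varr a
            (Function.update (R.mem.varr a) u (R.mem.vreg s))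
        | none => R.mem.varr }
  | .ifEq r s c d, R =>
    if R.mem.vreg r = R.mem.vreg s then c.exec f (R.tick R.mem) else d.exec f (R.tick R.mem)
  | .wclear x, R => R.tick { R.mem with wreg := Function.update R.mem.wreg x 0 }
  | .wmove x y, R => R.tick { R.mem with wreg := Function.update R.mem.wreg x (R.mem.wreg y) }
  | .wload x a i, R =>
    R.tick { R.mem with
      wreg := Function.update R.mem.wreg x
        (match R.mem.vreg i with
          | some u => R.mem.warr a u
          | none => 0) }
  | .wstore a i x, R =>
    R.tick { R.mem with
      warr := match R.mem.vreg i with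
        | some u => Function.update R.mem.warr a
            (Function.update (R.mem.warr a) u (R.mem.wreg x))
        | none => R.mem.warr }
  | .wadd x y z, R =>
    R.tick { R.mem with
      wreg := Function.update R.mem.wreg x (R.mem.wreg y + R.mem.wreg z) }
  | .wsub x y z, R =>
    R.tick { R.mem with
      wreg := Function.update R.mem.wreg x (R.mem.wreg y - R.mem.wreg z) }
  | .ifLe x y c d, R =>
    if R.mem.wreg x ≤ R.mem.wreg y then c.exec f (R.tick R.mem) else d.exec f (R.tick R.mem)
  | .insert q r s, R =>
    R.tick { R.mem with
      eset := Function.update R.mem.eset q (R.mem.eset q ∪ R.mem.edgeOf r s) }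
  | .erase q r s, R =>
    R.tick { R.mem with
      eset := Function.update R.mem.eset q (R.mem.eset q \ R.mem.edgeOf r s) }
  | .query x q, R =>
    { R.tick { R.mem with wreg := Function.update R.mem.wreg x (f (R.mem.eset q)) } with
      queries := R.mem.eset q :: R.queries }

/-- A one-pass streaming program: the program run on every arriving edge, the two vertex registers
in which the machine places the endpoints of the arriving edge, and the edge set that is the
output. -/
structure StreamProgram where
  k : ℕ
  in₁ : Fin k
  in₂ : Fin k
  out : Fin k
  body : Cmd k

/-- Processing of an arriving edge. -/
noncomputable def StreamProgram.feed (P : StreamProgram) {n : ℕ} (f : Finset (Sym2 (Fin n)) → ℝ)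
    (R : Machine P.k n) (e : Sym2 (Fin n)) : Machine P.k n :=
  P.body.exec f (R.tick { R.mem with
    vreg := Function.update (Function.update R.mem.vreg P.in₁ (some e.inf)) P.in₂ (some e.sup) })

/-- The single pass over the stream, starting from the empty memory. -/
noncomputable def StreamProgram.run (P : StreamProgram) {n : ℕ} (f : Finset (Sym2 (Fin n)) → ℝ)
    (σ : List (Sym2 (Fin n))) : Machine P.k n :=
  σ.foldl (P.feed f) { mem := Mem.init P.k n, time := 0, queries := [], peakEdges := 0 }

/-- The edge set that the program outputs at the end of the stream `σ`. -/
noncomputable def StreamProgram.output (P : StreamProgram) {n : ℕ}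
    (f : Finset (Sym2 (Fin n)) → ℝ) (σ : List (Sym2 (Fin n))) : Finset (Sym2 (Fin n)) :=
  (P.run f σ).mem.eset P.out

/-- Size in bits of the whole memory on `n`-vertex inputs when the edge sets hold `s` edges and a
weight takes `b` bits: there are `k * (n + 1)` vertex cells with `n + 1` possible values each,
equally many weight cells, and an edge in an edge set is a pair of vertices. -/
def StreamProgram.bits (P : StreamProgram) (n b s : ℕ) : ℕ :=
  P.k * (n + 1) * Nat.clog 2 (n + 1) + P.k * (n + 1) * b + s * (2 * Nat.clog 2 (n + 1))

/-! ### Zelke's algorithm and its extension to submodular functions -/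

/-- The current matching `M`, and for every edge `g = uv` of `M` its shadow edges `shadow g u` and
`shadow g v`, if any. (Values of `shadow` elsewhere are never used.) -/
structure Config (n : ℕ) where
  M : Finset (Sym2 (Fin n))
  shadow : Sym2 (Fin n) → Fin n → Option (Sym2 (Fin n))

open Classical in
/-- The set of all current shadow edges. -/
noncomputable def Config.S {n : ℕ} (c : Config n) : Finset (Sym2 (Fin n)) :=
  Finset.univ.filter fun s => ∃ g ∈ c.M, ∃ u ∈ g, c.shadow g u = some s

open Classical in
/-- The edges of `M` that share a vertex with some edge of `A`. -/
noncomputable def hit {n : ℕ} (M A : Finset (Sym2 (Fin n))) : Finset (Sym2 (Fin n)) :=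
  M.filter fun g => ∃ a ∈ A, ∃ v, v ∈ a ∧ v ∈ g

open Classical in
/-- The edges in the vicinity of an arriving edge `e`: the edge `e` itself, the edges `g = zy` of `M`
at the endpoints `y` of `e`, the shadow edges `s = az` of these `g` at their other endpoint `z`,
and the edges of `M` at `a`. -/
noncomputable def Config.vicinity {n : ℕ} (c : Config n) (e : Sym2 (Fin n)) :
    Finset (Sym2 (Fin n)) :=
  Finset.univ.filter fun x => x = e ∨ ∃ y ∈ e, ∃ g ∈ c.M, y ∈ g ∧
    (x = g ∨ ∃ z ∈ g, z ≠ y ∧ ∃ s, c.shadow g z = some s ∧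
      (x = s ∨ (x ∈ c.M ∧ ∃ a ∈ s, a ≠ z ∧ a ∈ x)))

/-- The difference `w(A) - (1 + γ) w(J)`, where `J` is the part of `M` hit by `A`. -/
noncomputable def gain {n : ℕ} (γ : ℝ) (w : Sym2 (Fin n) → ℝ) (M A : Finset (Sym2 (Fin n))) : ℝ :=
  ∑ a ∈ A, w a - (1 + γ) * ∑ g ∈ hit M A, w g

open Classical in
/-- The edge of `J` at the vertex `u`, if there is one. -/
noncomputable def edgeAt {n : ℕ} (J : Finset (Sym2 (Fin n))) (u : Fin n) :
    Option (Sym2 (Fin n)) :=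
  if h : ∃ j ∈ J, u ∈ j then some h.choose else none

open Classical in
/-- Replace the part of `M` hit by `A` by `A`; the removed edges become the shadow edges of the new
edges at the vertices that they share with them. -/
noncomputable def Config.augment {n : ℕ} (c : Config n) (A : Finset (Sym2 (Fin n))) :
    Config n where
  M := (c.M \ hit c.M A) ∪ A
  shadow g u := if g ∈ A ∧ u ∈ g then edgeAt (hit c.M A) u else c.shadow g u

/-- A step of Zelke's algorithm with parameter `γ` on the arriving edge `e`, with weights `w`: some
matching `A` in the vicinity of `e` that maximizes the gain is used for an augmentation if its gain
is positive, and nothing happens otherwise. -/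
def ZelkeStep {n : ℕ} (γ : ℝ) (w : Sym2 (Fin n) → ℝ) (e : Sym2 (Fin n)) (c c' : Config n) : Prop :=
  ∃ A, A ⊆ c.vicinity e ∧ IsMatching A ∧
    (∀ B, B ⊆ c.vicinity e → IsMatching B → gain γ w c.M B ≤ gain γ w c.M A) ∧
    ((0 < gain γ w c.M A ∧ c' = c.augment A) ∨ (gain γ w c.M A ≤ 0 ∧ c' = c))

/-- `c i` and `w i` (for `i ≤ σ.length`) are the successive configurations and weights in a run over
the stream `σ` of the `f`-extension of Zelke's algorithm with parameter `γ`: every arriving edge is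
given as weight its marginal `f`-value with respect to the current matching and shadow edges, and
then Zelke's algorithm makes a step with these weights. -/
def IsZelkeExtensionRun {n : ℕ} (γ : ℝ) (f : Finset (Sym2 (Fin n)) → ℝ) (σ : List (Sym2 (Fin n)))
    (c : ℕ → Config n) (w : ℕ → Sym2 (Fin n) → ℝ) : Prop :=
  c 0 = { M := ∅, shadow := fun _ _ => none } ∧ w 0 = 0 ∧
  ∀ (i : ℕ) (hi : i < σ.length),
    w (i + 1) = Function.update (w i) σ[i]
      (f (insert σ[i] ((c i).M ∪ (c i).S)) - f ((c i).M ∪ (c i).S)) ∧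
    ZelkeStep γ (w (i + 1)) σ[i] (c i) (c (i + 1))

end MSM

/-! Give every edge the marginal value `w` that it receives on arrival. Since marginals decrease,
`w(X) ≤ f(X)` for every `X` inside the current `M ∪ S` (`IsStrictRun.sum_le`), and `f(X) ≤ w(X)` for
every set `X` of arrived edges that contains the set `P` of all edges ever matched
(`IsStrictRun.le_sum`). Hence, for any matching `N` and the final `M`, `f(N) ≤ f(P ∪ N) ≤ w(P) + w(N
\ P)`, while `w(M) ≤ f(M)`. An augmentation has `w(A) ≥ 2 w(J)`, so it raises `w(M)` by at least
`w(A)/2`; this gives `w(P) ≤ 2 w(M)` (`IsStrictRun.sum_everMatched_le`). It remains to show `w(N \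
P) ≤ 23/4 w(M)`, since `2 + 23/4 = 7.75`.

This is a charging argument, kept as the invariant `Charged`. Let `W v` be the weight of the
matching edge at `v`, so that `∑ W v = 2 w(M)`. When an edge of `N \ P` arrives and is not taken,
maximality of `A` bounds its weight by a sum over its two ends, `W` at an end covered by `A` and `2
W` at any other end (`Charged.close`). These amounts go to accounts at the ends, which are then
closed; as `N` is a matching, this happens to a vertex at most once. When a matching edge of weight
`W` is removed, the growth of `∑ W v` absorbs up to `2 W` of the charges on it. The rest, again at
most `2 W`, moves to the new edges at its ends in proportion to their weights, so the account there
is at most the weight of the new edge (`Charged.augment`). The accounts on one edge therefore never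
exceed `4 W`, which already yields `w(N \ P) ≤ 6 w(M)`.

The missing quarter comes from reserves. An account can exceed `W` only at a vertex that is not
`old`. If neither end of an edge is old, both ends were open when the edge was added. Let `s` be the
total weight of its two shadow edges. If `s` is small, the augmentation had a surplus of gain,
recorded as `d ≥ W - 2 s` at each end. If `s` is large, the edges it replaced had an uncharged end
and did not use up what absorbs their charges, which saves half of the weight of each shadow edge,
recorded in `r`. Altogether `2 max(0, W - 2 s) + s/2 ≥ W/4`. The saving fails when the far end `a`
of the shadow edge at `z` carried more than `3/2` of its weight. That reserve stays pending (`z ∈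
U`) until the partner of `z` is charged. If that partner is not covered by `A`, the shadow edge `za`
can join the arriving edge in a competitor of `A`, and the account of `a`, empty by then, pays for
the reserve; otherwise the partner becomes old and no reserve is needed.

For the implementation, edges of `M` never help in an augmentation (`gain_le_gain_sdiff`), so only
the arriving edge and at most two shadow edges matter, and seven candidates are compared. A vertex
lies on at most one matching edge, so all shadow edges fit in one array giving the other end. A
loop-free program thus performs a step, and the number of commands in it bounds both its running
time and the number of edges it adds to memory. -/

namespace MSM

/-! ### Charging schemes -/

section Charging

variable {V : Type*} [Fintype V] [DecidableEq V]

/-- A vertex-based picture of a matching with weighted shadow edges: `μ` sends a vertex to its partner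
(uncovered vertices are fixed), `W v` is the weight of the matching edge at `v`, and `sw v`
the weight of its shadow edge at `v`. -/
structure MateData (μ : V → V) (W sw : V → ℝ) : Prop where
  inv : ∀ v, μ (μ v) = v
  W_mate : ∀ v, W (μ v) = W v
  W_nonneg : ∀ v, 0 ≤ W v
  W_free : ∀ v, μ v = v → W v = 0
  sw_nonneg : ∀ v, 0 ≤ sw v

/-- A scheme that distributes the amount `T` over the endpoints of the matching edges. The vertices in
`cl` have been charged, `acct` holds the charges, `r` and `d` hold reserves, `old` consists of
vertices that were charged before they got their current matching edge, and for `z ∈ U` the reserve of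
the shadow edge from `z` to `pa z` is still pending. -/
structure Charged (μ : V → V) (W sw : V → ℝ) (pa : V → Option V) (cl : Finset V) (T : ℝ)
    (acct r d : V → ℝ) (old U : Finset V) : Prop where
  acct_nonneg : ∀ v, 0 ≤ acct v
  acct_le : ∀ v, acct v ≤ 2 * W v
  acct_open : ∀ v, v ∉ cl → acct v = 0
  old_closed : ∀ v, v ∈ old → v ∈ cl
  old_le : ∀ v, v ∈ old → acct v ≤ W v
  r_nonneg : ∀ v, 0 ≤ r v
  d_nonneg : ∀ v, 0 ≤ d v
  reserve : ∀ v, μ v ≠ v → v ∈ old ∨ μ v ∈ old ∨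
    (W v - 2 * sw v - 2 * sw (μ v) ≤ d v ∧ (v ∈ U ∨ sw v / 2 ≤ r v))
  pend : ∀ z, z ∈ U → μ z ≠ z ∧ z ∉ old ∧ μ z ∉ cl ∧
    ∃ a, pa z = some a ∧ a ∈ cl ∧ (μ a ≠ a → a ∈ old) ∧ acct a = 0
  pend_inj : ∀ z z', z ∈ U → z' ∈ U → pa z = pa z' → z = z'
  total : T + ∑ v, (d v + r v) ≤ ∑ v, (W v + acct v)

-- Summing the hypothesis over all vertices counts both sides twice. It turns an estimate for one
-- matching edge, with both ends taken together, into a global one.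
omit [DecidableEq V] in
theorem sum_le_sum_of_involution {μ : V → V} (hμ : ∀ v, μ (μ v) = v) {F G : V → ℝ}
    (h : ∀ v, F v + F (μ v) ≤ G v + G (μ v)) : ∑ v, F v ≤ ∑ v, G v := by
  have key : ∀ H : V → ℝ, ∑ v, H (μ v) = ∑ v, H v := fun H =>
    Equiv.sum_comp (Function.Involutive.toPerm μ hμ) H
  have h2 : ∑ v, (F v + F (μ v)) ≤ ∑ v, (G v + G (μ v)) := Finset.sum_le_sum fun v _ => h v
  rw [Finset.sum_add_distrib, Finset.sum_add_distrib, key, key] at h2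
  linarith

/-- For one edge the accounts minus the reserves are at most `15/4 W`. If an end is old, they are at
most `W + 2 W`. If a reserve is pending, the other end is open and only `2 W` remains. Otherwise,
with `s` the weight of the two shadow edges, the reserves are at least `s/2 + (2 W - 4 s)/8 = W/4`,
against accounts of at most `4 W`. Adding `2 W` and dividing by the two ends gives `23/8`. -/
theorem Charged.total_le {μ : V → V} {W sw : V → ℝ} {pa : V → Option V} {cl : Finset V} {T : ℝ}
    {acct r d : V → ℝ} {old U : Finset V} (hm : MateData μ W sw)
    (h : Charged μ W sw pa cl T acct r d old U) : T ≤ 23 / 8 * ∑ v, W v := by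
  have := sum_le_sum_of_involution hm.inv (F := fun v => W v + acct v - d v - r v)
    (G := fun v => 23 / 8 * W v) (by
      intro v
      simp only [hm.W_mate]
      have e1 := h.acct_le v
      have e2 := h.acct_le (μ v)
      have e3 := h.d_nonneg v
      have e4 := h.d_nonneg (μ v)
      have e5 := h.r_nonneg v
      have e6 := h.r_nonneg (μ v)
      have e7 := hm.W_nonneg v
      rw [hm.W_mate] at e2
      by_cases hv : μ v = v
      · have := hm.W_free v hv
        rw [hv] at *
        linarith
      have hv' : μ (μ v) ≠ μ v := by rw [hm.inv]; exact fun h => hv h.symm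
      have o1 := fun hh => h.old_le v hh
      have o2 := fun hh => h.old_le (μ v) hh
      rw [hm.W_mate] at o2
      rcases h.reserve v hv with a | a | ⟨a, a'⟩
      · linarith [o1 a]
      · linarith [o2 a]
      rcases h.reserve _ hv' with b | b | ⟨b, b'⟩
      · linarith [o2 b]
      · rw [hm.inv] at b
        linarith [o1 b]
      rw [hm.inv, hm.W_mate] at b
      rcases a' with a' | a'
      · have := h.acct_open _ (h.pend v a').2.2.1
        linarith
      rcases b' with b' | b'
      · have h3 := (h.pend _ b').2.2.1
        rw [hm.inv] at h3
        have := h.acct_open _ h3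
        linarith
      linarith)
  have h2 := h.total
  simp only [Finset.sum_add_distrib, Finset.sum_sub_distrib, ← Finset.mul_sum] at this h2
  linarith

end Charging

/-! ### Charging schemes under an augmentation -/

section Charging

variable {V : Type*} [Fintype V] [DecidableEq V]

/-- `μ'`, `W'`, `sw'`, `pa'` arise by an augmentation whose new edges cover `X`. -/
structure MateAugment (μ μ' : V → V) (W W' sw sw' : V → ℝ) (pa pa' : V → Option V) (X : Finset V) :
    Prop where
  mem : ∀ v, v ∈ X → μ' v ∈ X
  ne : ∀ v, v ∈ X → μ' v ≠ v
  sw_new : ∀ v, v ∈ X → sw' v = W v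
  pa_new : ∀ v, v ∈ X → μ v ≠ v → pa' v = some (μ v)
  free : ∀ v, v ∉ X → μ v ∈ X → μ' v = v
  mate_keep : ∀ v, v ∉ X → μ v ∉ X → μ' v = μ v
  W_keep : ∀ v, v ∉ X → μ v ∉ X → W' v = W v
  sw_keep : ∀ v, v ∉ X → μ v ∉ X → sw' v = sw v
  pa_keep : ∀ v, v ∉ X → μ v ∉ X → pa' v = pa v
  two_mul_le : ∀ v, v ∈ X ∨ μ v ∈ X →
    2 * W v ≤ (if v ∈ X then W' v else 0) + (if μ v ∈ X then W' (μ v) else 0)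
  sum_le : ∑ v, W v + ∑ v, (if v ∈ X ∨ μ v ∈ X then W v else 0) +
    ∑ v, (if v ∈ X then max 0 (W' v - 2 * W v - 2 * W (μ' v)) else 0) ≤ ∑ v, W' v

/-- The field `sum_le` of `MateAugment` supplies `W` for each end of a removed edge, hence `2 W` per
removed edge, and the surplus at each end of a new edge. The former absorbs old charges and funds
`r`, the latter funds `d`. -/
theorem Charged.augment {μ μ' : V → V} {W W' sw sw' : V → ℝ} {pa pa' : V → Option V}
    {X cl : Finset V} {T : ℝ} {acct r d : V → ℝ} {old U : Finset V}
    (hm : MateData μ W sw) (hm' : MateData μ' W' sw')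
    (ha : MateAugment μ μ' W W' sw sw' pa pa' X)
    (h : Charged μ W sw pa cl T acct r d old U) :
    ∃ acct' r' d' old' U', Charged μ' W' sw' pa' cl T acct' r' d' old' U' := by
  -- `wa` is the weight of the new edge at a vertex, and `Lo` the charge on a removed edge that its
  -- `2 W` does not absorb.
  set wa : V → ℝ := fun v => if v ∈ X then W' v else 0 with hwa
  set Lo : V → ℝ := fun v => max 0 (acct v + acct (μ v) - 2 * W v) with hLo
  have wa0 : ∀ v, 0 ≤ wa v := fun v => by
    simp only [hwa]; split_ifs; exacts [hm'.W_nonneg v, le_rfl]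
  have Lo0 : ∀ v, 0 ≤ Lo v := fun v => le_max_left _ _
  have Lo_mate : ∀ v, Lo (μ v) = Lo v := fun v => by
    simp only [hLo, hm.inv, hm.W_mate, add_comm]
  have acct_mate_le : ∀ v, acct (μ v) ≤ 2 * W v := fun v => by
    have := h.acct_le (μ v); rwa [hm.W_mate] at this
  have Lo_le : ∀ v, v ∈ X ∨ μ v ∈ X → Lo v ≤ wa v + wa (μ v) := fun v hv => by
    have h1 := ha.two_mul_le v hv
    have h2 := h.acct_le v
    have h3 := acct_mate_le v
    have h4 := hm.W_nonneg v
    apply max_le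
    · exact add_nonneg (wa0 v) (wa0 _)
    · simp only [hwa]; linarith
  have Lo_zero : ∀ v, acct v = 0 → Lo v = 0 := fun v hv => by
    apply max_eq_left
    have := acct_mate_le v
    linarith
  have Lo_zero' : ∀ v, acct (μ v) = 0 → Lo v = 0 := fun v hv => by
    rw [← Lo_mate]; exact Lo_zero _ hv
  set ac : V → ℝ := fun v => if v ∈ X ∨ μ v ∈ X then Lo v * (wa v / (wa v + wa (μ v))) else acct v
    with hac
  have ac_le : ∀ v, v ∈ X ∨ μ v ∈ X → ac v ≤ wa v := fun v hv => by
    simp only [hac, if_pos hv]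
    -- If no new weight is present at either end, the quotient is `0` by convention, and `Lo_le`
    -- forces `Lo v = 0`, so nothing is lost.
    rcases eq_or_lt_of_le (add_nonneg (wa0 v) (wa0 (μ v))) with h0 | h0
    · rw [← h0]; simpa using wa0 v
    · calc Lo v * (wa v / (wa v + wa (μ v)))
          ≤ (wa v + wa (μ v)) * (wa v / (wa v + wa (μ v))) :=
            mul_le_mul_of_nonneg_right (Lo_le v hv) (div_nonneg (wa0 v) h0.le)
        _ = wa v := by field_simp
  have ac_sum : ∀ v, v ∈ X ∨ μ v ∈ X → ac v + ac (μ v) = Lo v := fun v hv => by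
    have hv' : μ v ∈ X ∨ μ (μ v) ∈ X := by rw [hm.inv]; exact hv.symm
    simp only [hac, if_pos hv, if_pos hv', hm.inv, Lo_mate]
    rcases eq_or_lt_of_le (add_nonneg (wa0 v) (wa0 (μ v))) with h0 | h0
    · have : Lo v = 0 := le_antisymm (h0 ▸ Lo_le v hv) (Lo0 v)
      simp [this]
    · rw [add_comm (wa (μ v)) (wa v)]
      field_simp
  have ac_nonneg : ∀ v, 0 ≤ ac v := fun v => by
    simp only [hac]
    split_ifs
    · exact mul_nonneg (Lo0 v) (div_nonneg (wa0 v) (add_nonneg (wa0 v) (wa0 _)))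
    · exact h.acct_nonneg v
  have ac_zero : ∀ v, acct v = 0 → ac v = 0 := fun v hv => by
    simp only [hac, Lo_zero v hv, hv]; simp
  have mate_touch : ∀ v, (μ v ∈ X ∨ μ (μ v) ∈ X) ↔ (v ∈ X ∨ μ v ∈ X) := fun v => by
    rw [hm.inv, or_comm]
  have W_touch : ∀ v, v ∉ X → μ v ∈ X → W' v = 0 := fun v h1 h2 => hm'.W_free v (ha.free v h1 h2)
  -- An open `v` has an empty account, so the removed edge has absorbed only `acct (μ v)`. If that
  -- is at most `3/2 W`, at least `W/2` is left over, half of the weight of the new shadow edge at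
  -- `v`.
  set r' : V → ℝ := fun v => if v ∈ X ∨ μ v ∈ X then
    (if v ∈ X ∧ v ∉ cl ∧ acct (μ v) ≤ 3 / 2 * W v then W v / 2 else 0) else r v with hr'
  set d' : V → ℝ := fun v => if v ∈ X ∨ μ v ∈ X then
    (if v ∈ X then max 0 (W' v - 2 * W v - 2 * W (μ' v)) else 0) else d v with hd'
  -- A closed vertex becomes old when it receives a new edge. The reserve of a new shadow edge
  -- becomes pending exactly when both ends of the new edge are open and the removed edge carries
  -- too much charge to leave `W/2`.
  refine ⟨ac, r', d', Finset.univ.filter fun v => (v ∈ X ∧ v ∈ cl) ∨ (v ∉ X ∧ μ v ∉ X ∧ v ∈ old),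
    Finset.univ.filter fun v => (v ∈ X ∧ v ∉ cl ∧ μ' v ∉ cl ∧ 3 / 2 * W v < acct (μ v)) ∨
      (v ∉ X ∧ μ v ∉ X ∧ v ∈ U), ?_⟩
  constructor
  · exact ac_nonneg
  · intro v
    by_cases hv : v ∈ X ∨ μ v ∈ X
    · have h1 := ac_le v hv
      have h2 := hm'.W_nonneg v
      have : wa v ≤ W' v := by simp only [hwa]; split_ifs <;> linarith
      linarith
    · have hv1 := not_or.1 hv
      simp only [hac, if_neg hv, ha.W_keep v hv1.1 hv1.2]
      exact h.acct_le v
  · intro v hv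
    exact ac_zero v (h.acct_open v hv)
  · intro v hv
    rcases (Finset.mem_filter.1 hv).2 with h1 | h1
    · exact h1.2
    · exact h.old_closed v h1.2.2
  · intro v hv
    rcases (Finset.mem_filter.1 hv).2 with h1 | h1
    · have := ac_le v (Or.inl h1.1)
      simpa only [hwa, if_pos h1.1] using this
    · have : ¬ (v ∈ X ∨ μ v ∈ X) := not_or.2 ⟨h1.1, h1.2.1⟩
      simp only [hac, if_neg this, ha.W_keep v h1.1 h1.2.1]
      exact h.old_le v h1.2.2
  · intro v
    simp only [hr']
    split_ifs
    · have := hm.W_nonneg v; linarith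
    · exact le_rfl
    · exact h.r_nonneg v
  · intro v
    simp only [hd']
    split_ifs
    · exact le_max_left _ _
    · exact le_rfl
    · exact h.d_nonneg v
  · intro v hv
    simp only [Finset.mem_filter, Finset.mem_univ, true_and]
    by_cases hX : v ∈ X
    · have hX' := ha.mem v hX
      by_cases c1 : v ∈ cl
      · exact Or.inl (Or.inl ⟨hX, c1⟩)
      by_cases c2 : μ' v ∈ cl
      · exact Or.inr (Or.inl (Or.inl ⟨hX', c2⟩))
      refine Or.inr (Or.inr ⟨?_, ?_⟩)
      · simp only [hd', if_pos hX, if_pos (Or.inl hX : v ∈ X ∨ μ v ∈ X), ha.sw_new v hX,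
          ha.sw_new _ hX']
        exact le_max_right _ _
      · by_cases c3 : acct (μ v) ≤ 3 / 2 * W v
        · right
          have : v ∈ X ∧ v ∉ cl ∧ acct (μ v) ≤ 3 / 2 * W v := ⟨hX, c1, c3⟩
          simp only [hr', if_pos this, if_pos (Or.inl hX : v ∈ X ∨ μ v ∈ X), ha.sw_new v hX]
          exact le_rfl
        · exact Or.inl (Or.inl ⟨hX, c1, c2, not_le.1 c3⟩)
    · by_cases hX' : μ v ∈ X
      · exact absurd (ha.free v hX hX') hv
      · have e1 := ha.mate_keep v hX hX'
        have hn : ¬ (v ∈ X ∨ μ v ∈ X) := not_or.2 ⟨hX, hX'⟩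
        have hX2 : μ (μ v) ∉ X := by rwa [hm.inv]
        rw [e1] at hv ⊢
        rw [ha.W_keep v hX hX', ha.sw_keep v hX hX', ha.sw_keep _ hX' hX2]
        simp only [hd', hr', if_neg hn, hX, hX', hX2, false_and, false_or, not_false_eq_true,
          true_and]
        exact h.reserve v hv
  · intro z hz
    simp only [Finset.mem_filter, Finset.mem_univ, true_and] at hz ⊢
    rcases hz with ⟨h1, h2, h3, h4⟩ | ⟨h1, h2, h3⟩
    · have hne : μ z ≠ z := by
        intro e
        rw [e, h.acct_open z h2] at h4
        have := hm.W_nonneg z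
        linarith
      refine ⟨ha.ne z h1, by tauto, h3, μ z, ha.pa_new z h1 hne, ?_, ?_, ?_⟩
      · by_contra hc
        rw [h.acct_open _ hc] at h4
        have := hm.W_nonneg z
        linarith
      · intro hc
        left
        constructor
        · by_contra hX
          exact hc (ha.free (μ z) hX (by rwa [hm.inv]))
        · by_contra hc
          rw [h.acct_open _ hc] at h4
          have := hm.W_nonneg z
          linarith
      -- Only one end of the removed edge was charged, with at most `2 W`; everything is absorbed
      -- and the far end is left with an empty account.
      · have : Lo (μ z) = 0 := by rw [Lo_mate]; exact Lo_zero z (h.acct_open z h2)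
        have hX : μ z ∈ X ∨ μ (μ z) ∈ X := by rw [hm.inv]; exact Or.inr h1
        simp only [hac, if_pos hX, this, zero_mul]
    · obtain ⟨p1, p2, p3, a, p4, p5, p6, p7⟩ := h.pend z h3
      rw [ha.mate_keep z h1 h2]
      refine ⟨p1, by tauto, p3, a, by rw [ha.pa_keep z h1 h2, p4], p5, ?_, ac_zero a p7⟩
      intro hc
      by_cases hX : a ∈ X
      · exact Or.inl ⟨hX, p5⟩
      · by_cases hX' : μ a ∈ X
        · exact absurd (ha.free a hX hX') hc
        · rw [ha.mate_keep a hX hX'] at hc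
          exact Or.inr ⟨hX, hX', p6 hc⟩
  -- A new pending reserve has a parent whose account was positive before the step, whereas the
  -- parent of an earlier one has an empty account.
  · have key : ∀ z z', z ∈ X → z ∉ cl → 3 / 2 * W z < acct (μ z) → z' ∉ X → μ z' ∉ X → z' ∈ U →
        pa' z = pa' z' → False := by
      intro z z' h1 h2 h4 g1 g2 g3 e
      have hne : μ z ≠ z := by
        intro e
        rw [e, h.acct_open z h2] at h4
        have := hm.W_nonneg z
        linarith
      obtain ⟨p1, p2, p3, a, p4, p5, p6, p7⟩ := h.pend z' g3
      rw [ha.pa_new z h1 hne, ha.pa_keep z' g1 g2, p4, Option.some_inj] at e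
      rw [e, p7] at h4
      have := hm.W_nonneg z
      linarith
    intro z z' hz hz' e
    simp only [Finset.mem_filter, Finset.mem_univ, true_and] at hz hz'
    rcases hz with ⟨h1, h2, h3, h4⟩ | ⟨h1, h2, h3⟩ <;>
    rcases hz' with ⟨g1, g2, g3, g4⟩ | ⟨g1, g2, g3⟩
    · have hne : ∀ z, z ∉ cl → 3 / 2 * W z < acct (μ z) → μ z ≠ z := by
        intro z h2 h4 e
        rw [e, h.acct_open z h2] at h4
        have := hm.W_nonneg z
        linarith
      rw [ha.pa_new z h1 (hne z h2 h4), ha.pa_new z' g1 (hne z' g2 g4), Option.some_inj] at e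
      rw [← hm.inv z, e, hm.inv]
    · exact (key z z' h1 h2 h4 g1 g2 g3 e).elim
    · exact (key z' z g1 g2 g4 h1 h2 h3 e.symm).elim
    · rw [ha.pa_keep z h1 h2, ha.pa_keep z' g1 g2] at e
      exact h.pend_inj z z' h3 g3 e
  · have main := sum_le_sum_of_involution hm.inv
      (F := fun v => d' v + r' v - ac v)
      (G := fun v => d v + r v - acct v + (if v ∈ X ∨ μ v ∈ X then W v else 0) +
        (if v ∈ X then max 0 (W' v - 2 * W v - 2 * W (μ' v)) else 0)) (by
        intro v
        by_cases hv : v ∈ X ∨ μ v ∈ X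
        · have hv' : μ v ∈ X ∨ μ (μ v) ∈ X := by rw [hm.inv]; exact hv.symm
          have hs := ac_sum v hv
          have b1 := h.d_nonneg v
          have b2 := h.d_nonneg (μ v)
          have b3 := h.r_nonneg v
          have b4 := h.r_nonneg (μ v)
          have b5 := hm.W_nonneg v
          have b6 := acct_mate_le v
          have b7 := h.acct_le v
          have b8 := h.acct_nonneg v
          have b9 := h.acct_nonneg (μ v)
          -- The budget of one removed edge. Two reserves of `W/2` arise only if both accounts are
          -- empty; a single one meets an account of at most `3/2 W`.
          have R : r' v + r' (μ v) + acct v + acct (μ v) ≤ Lo v + 2 * W v := by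
            have l0 := Lo0 v
            have l1 : acct v + acct (μ v) - 2 * W v ≤ Lo v := le_max_right _ _
            simp only [hr', if_pos hv, if_pos hv', hm.inv, hm.W_mate]
            split_ifs with c1 c2 c2
            · have := h.acct_open _ c1.2.1
              have := h.acct_open _ c2.2.1
              linarith
            · have := h.acct_open _ c1.2.1
              linarith [c1.2.2]
            · have := h.acct_open _ c2.2.1
              linarith [c2.2.2]
            · linarith
          simp only [hd', if_pos hv, if_pos hv', hm.W_mate]
          linarith
        · have hv' : ¬ (μ v ∈ X ∨ μ (μ v) ∈ X) := by rwa [mate_touch]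
          have c1 := not_or.1 hv
          simp only [hd', hr', hac, if_neg hv, if_neg hv', if_neg c1.1, if_neg c1.2]
          linarith)
    have h2 := h.total
    have h3 := ha.sum_le
    simp only [Finset.sum_add_distrib, Finset.sum_sub_distrib] at main h2 h3 ⊢
    linarith

end Charging

/-! ### Charging an edge that is not taken -/

section Charging

variable {V : Type*} [Fintype V] [DecidableEq V]

/-- `hL` is what maximality gives when the arriving edge competes together with the shadow edges at
the partners of the vertices in `I`. Half of the inequality for such a shadow edge suffices: the
pending `sw/2` is bought by charging `W` to its far end. An end in `X` is charged only `W` and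
becomes old, so no reserve is needed there. -/
theorem Charged.close {μ : V → V} {W sw : V → ℝ} {pa : V → Option V}
    {X cl : Finset V} {T ω : ℝ} {acct r d : V → ℝ} {old U : Finset V}
    (hm : MateData μ W sw) (h : Charged μ W sw pa cl T acct r d old U)
    {y₁ y₂ : V} (hy₁ : y₁ ∉ cl) (hy₂ : y₂ ∉ cl)
    (hL : ∀ I : Finset V, I ⊆ {y₁, y₂} →
      (∀ y ∈ I, y ∉ X ∧ μ y ≠ y ∧ ∃ a ∈ cl, pa (μ y) = some a) →
      (∀ y ∈ I, ∀ y' ∈ I, ∀ a, pa (μ y) = some a → a ≠ μ y') →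
      (∀ y ∈ I, ∀ y' ∈ I, pa (μ y) = pa (μ y') → y = y') →
      ω + ∑ y ∈ I, sw (μ y) ≤ ∑ y ∈ {y₁, y₂}, (if y ∈ X then W y else 2 * W y) +
        ∑ y ∈ I, 2 * (pa (μ y)).elim 0 W) :
    ∃ acct' r' d' old' U',
      Charged μ W sw pa (insert y₁ (insert y₂ cl)) (T + ω) acct' r' d' old' U' := by
  classical
  set Y : Finset V := {y₁, y₂} with hY
  have hYcl : ∀ y ∈ Y, y ∉ cl := by
    intro y hyY
    rcases Finset.mem_insert.1 hyY with rfl | hyY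
    · exact hy₁
    · rw [Finset.mem_singleton.1 hyY]; exact hy₂
  -- The ends whose charging makes a pending reserve due. `A` below consists of the far ends that
  -- pay for it; their accounts are empty, so `W` can be added without exceeding the bound for old
  -- vertices.
  set I₀ : Finset V := Y.filter fun y => y ∉ X ∧ μ y ∈ U with hI₀
  have hI₀Y : ∀ y ∈ I₀, y ∈ Y := fun y hy => (Finset.mem_filter.1 hy).1
  have hI₀X : ∀ y ∈ I₀, y ∉ X := fun y hy => (Finset.mem_filter.1 hy).2.1
  have hI₀U : ∀ y ∈ I₀, μ y ∈ U := fun y hy => (Finset.mem_filter.1 hy).2.2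
  have hI₀a : ∀ y ∈ I₀, ∃ a, pa (μ y) = some a ∧ a ∈ cl ∧ (μ a ≠ a → a ∈ old) ∧ acct a = 0 :=
    fun y hy => (h.pend _ (hI₀U y hy)).2.2.2
  have hI₀μ : ∀ y ∈ I₀, μ y ≠ y := fun y hy e => (h.pend _ (hI₀U y hy)).1 (by rw [hm.inv, e])
  have hI₀inj : ∀ y ∈ I₀, ∀ y' ∈ I₀, pa (μ y) = pa (μ y') → y = y' := by
    intro y hy y' hy' e
    have := h.pend_inj _ _ (hI₀U y hy) (hI₀U y' hy') e
    rw [← hm.inv y, this, hm.inv]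
  set A : Finset V := Finset.univ.filter fun v => ∃ y ∈ I₀, pa (μ y) = some v with hA
  have hAcl : ∀ v ∈ A, v ∈ cl ∧ (μ v ≠ v → v ∈ old) ∧ acct v = 0 := by
    intro v hv
    obtain ⟨y, hy, e⟩ := (Finset.mem_filter.1 hv).2
    obtain ⟨a, e', hh⟩ := hI₀a y hy
    rw [e, Option.some_inj] at e'
    rw [e']; exact hh
  have hAY : ∀ v ∈ A, v ∉ Y := fun v hv hv' => hYcl v hv' (hAcl v hv).1
  set κ : V → ℝ := fun y => if y ∈ X then W y else 2 * W y with hκ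
  have κ0 : ∀ y, 0 ≤ κ y := fun y => by
    have := hm.W_nonneg y
    simp only [hκ]; split_ifs <;> linarith
  have κ2 : ∀ y, κ y ≤ 2 * W y := fun y => by
    have := hm.W_nonneg y
    simp only [hκ]; split_ifs <;> linarith
  set ac : V → ℝ := fun v => acct v + ((if v ∈ Y then κ v else 0) + (if v ∈ A then W v else 0))
    with hac
  have acY : ∀ v ∈ Y, ac v = κ v := fun v hv => by
    have hvA : v ∉ A := fun hv' => hAY v hv' hv
    simp only [hac, if_pos hv, if_neg hvA, h.acct_open v (hYcl v hv)]; ring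
  have acA : ∀ v ∈ A, ac v = W v := fun v hv => by
    simp only [hac, if_pos hv, if_neg (hAY v hv), (hAcl v hv).2.2]; ring
  have acN : ∀ v, v ∉ Y → v ∉ A → ac v = acct v := fun v h1 h2 => by
    simp only [hac, if_neg h1, if_neg h2]; ring
  set J : Finset V := Finset.univ.filter fun z => μ z ∈ I₀ with hJ
  have hcl : ∀ v, v ∈ insert y₁ (insert y₂ cl) ↔ v ∈ Y ∨ v ∈ cl := by
    intro v; simp only [hY, Finset.mem_insert, Finset.mem_singleton, or_assoc]
  refine ⟨ac, fun z => r z + (if z ∈ J then sw z / 2 else 0), d,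
    Finset.univ.filter fun v => v ∈ old ∨ (v ∈ Y ∧ v ∈ X),
    Finset.univ.filter fun z => z ∈ U ∧ μ z ∉ Y ∧ ¬ (z ∈ Y ∧ z ∈ X), ?_⟩
  constructor
  · intro v
    simp only [hac]
    have := h.acct_nonneg v
    have := κ0 v
    have := hm.W_nonneg v
    split_ifs <;> linarith
  · intro v
    have := hm.W_nonneg v
    by_cases h1 : v ∈ Y
    · rw [acY v h1]; exact κ2 v
    by_cases h2 : v ∈ A
    · rw [acA v h2]; linarith
    rw [acN v h1 h2]; exact h.acct_le v
  · intro v hv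
    rw [hcl, not_or] at hv
    rw [acN v hv.1 (fun h2 => hv.2 (hAcl v h2).1)]
    exact h.acct_open v hv.2
  · intro v hv
    rw [hcl]
    rcases (Finset.mem_filter.1 hv).2 with h1 | h1
    · exact Or.inr (h.old_closed v h1)
    · exact Or.inl h1.1
  · intro v hv
    by_cases h1 : v ∈ Y
    · rw [acY v h1]
      rcases (Finset.mem_filter.1 hv).2 with h2 | h2
      · exact absurd (h.old_closed v h2) (hYcl v h1)
      · simp only [hκ, if_pos h2.2]; exact le_rfl
    by_cases h2 : v ∈ A
    · rw [acA v h2]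
    rw [acN v h1 h2]
    rcases (Finset.mem_filter.1 hv).2 with h3 | h3
    · exact h.old_le v h3
    · exact absurd h3.1 h1
  · intro v
    have := h.r_nonneg v
    have := hm.sw_nonneg v
    split_ifs <;> linarith
  · exact h.d_nonneg
  · intro v hv
    simp only [Finset.mem_filter, Finset.mem_univ, true_and]
    rcases h.reserve v hv with h1 | h1 | ⟨h1, h2⟩
    · exact Or.inl (Or.inl h1)
    · exact Or.inr (Or.inl (Or.inl h1))
    by_cases c1 : v ∈ Y ∧ v ∈ X
    · exact Or.inl (Or.inr c1)
    by_cases c2 : μ v ∈ Y ∧ μ v ∈ X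
    · exact Or.inr (Or.inl (Or.inr c2))
    refine Or.inr (Or.inr ⟨h1, ?_⟩)
    have hsw := hm.sw_nonneg v
    have hr := h.r_nonneg v
    rcases h2 with h2 | h2
    · by_cases c3 : μ v ∈ Y
      · right
        have : v ∈ J := by
          simp only [hJ, hI₀, Finset.mem_filter, Finset.mem_univ, true_and, hm.inv]
          exact ⟨c3, fun hX => c2 ⟨c3, hX⟩, h2⟩
        rw [if_pos this]; linarith
      · exact Or.inl ⟨h2, c3, c1⟩
    · right
      split_ifs <;> linarith
  · intro z hz
    simp only [Finset.mem_filter, Finset.mem_univ, true_and] at hz ⊢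
    obtain ⟨z1, z2, z3⟩ := hz
    obtain ⟨p1, p2, p3, a, p4, p5, p6, p7⟩ := h.pend z z1
    refine ⟨p1, by tauto, ?_, a, p4, ?_, fun hh => Or.inl (p6 hh), ?_⟩
    · rw [hcl]; tauto
    · rw [hcl]; exact Or.inr p5
    · rw [acN a (fun hh => hYcl a hh p5) ?_]
      · exact p7
      · intro hh
        obtain ⟨y, hy, e⟩ := (Finset.mem_filter.1 hh).2
        have := h.pend_inj _ _ z1 (hI₀U y hy) (by rw [p4, e])
        apply z2
        rw [this, hm.inv]
        exact hI₀Y y hy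
  · intro z z' hz hz' e
    exact h.pend_inj z z' (Finset.mem_filter.1 hz).2.1 (Finset.mem_filter.1 hz').2.1 e
  · have s1 : ∑ v, (if v ∈ J then sw v / 2 else 0) = ∑ y ∈ I₀, sw (μ y) / 2 := by
      rw [Finset.sum_ite_mem, Finset.univ_inter]
      refine Finset.sum_bij' (fun z _ => μ z) (fun y _ => μ y) ?_ ?_ ?_ ?_ ?_
      · intro z hz; exact (Finset.mem_filter.1 hz).2
      · intro y hy; simp only [hJ, Finset.mem_filter, Finset.mem_univ, true_and, hm.inv]; exact hy
      · intro z _; exact hm.inv z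
      · intro z _; exact hm.inv z
      · intro z _; simp only [hm.inv]
    have s2 : ∑ v, (if v ∈ A then W v else 0) = ∑ y ∈ I₀, (pa (μ y)).elim 0 W := by
      rw [Finset.sum_ite_mem, Finset.univ_inter]
      symm
      refine Finset.sum_bij (fun y _ => (pa (μ y)).getD y) ?_ ?_ ?_ ?_
      · intro y hy
        obtain ⟨a, e, _⟩ := hI₀a y hy
        simp only [hA, Finset.mem_filter, Finset.mem_univ, true_and]
        exact ⟨y, hy, by simp [e]⟩
      · intro y hy y' hy' e
        obtain ⟨a, ea, _⟩ := hI₀a y hy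
        obtain ⟨a', ea', _⟩ := hI₀a y' hy'
        apply hI₀inj y hy y' hy'
        rw [ea, ea'] at e ⊢
        simpa using e
      · intro v hv
        obtain ⟨y, hy, e⟩ := (Finset.mem_filter.1 hv).2
        exact ⟨y, hy, by simp [e]⟩
      · intro y hy
        obtain ⟨a, ea, _⟩ := hI₀a y hy
        simp [ea]
    have s3 : ∑ v, (if v ∈ Y then κ v else 0) = ∑ y ∈ Y, κ y := by
      rw [Finset.sum_ite_mem, Finset.univ_inter]
    have key : ω + ∑ y ∈ I₀, sw (μ y) / 2 ≤ ∑ y ∈ Y, κ y + ∑ y ∈ I₀, (pa (μ y)).elim 0 W := by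
      -- A competitor uses only those shadow edges that are worth more than twice the weight at
      -- their far end. For these `sw - 2 W` dominates its half `sw/2 - W`; for the others that half
      -- is at most `0`.
      have := hL (I₀.filter fun y => 2 * (pa (μ y)).elim 0 W < sw (μ y))
        (fun y hy => hI₀Y y (Finset.mem_filter.1 hy).1) (fun y hy => by
          have hy := (Finset.mem_filter.1 hy).1
          obtain ⟨a, e, hh, _⟩ := hI₀a y hy
          exact ⟨hI₀X y hy, hI₀μ y hy, a, hh, e⟩) (fun y hy y' hy' a e ea => by
          have hy := (Finset.mem_filter.1 hy).1
          have hy' := (Finset.mem_filter.1 hy').1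
          -- A far end that is matched is old, whereas `μ y'` is matched and, being pending, not
          -- old. So they differ.
          obtain ⟨b, e', _, hh, _⟩ := hI₀a y hy
          rw [e, Option.some_inj] at e'
          obtain ⟨q1, q2, _⟩ := h.pend _ (hI₀U y' hy')
          rw [← ea, e'] at q1 q2
          exact q2 (hh q1)) (fun y hy y' hy' =>
          hI₀inj y (Finset.mem_filter.1 hy).1 y' (Finset.mem_filter.1 hy').1)
      rw [Finset.sum_filter (s := I₀), Finset.sum_filter (s := I₀)] at this
      have pw : ∑ y ∈ I₀, (sw (μ y) / 2 - (pa (μ y)).elim 0 W) ≤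
          ∑ y ∈ I₀, ((if 2 * (pa (μ y)).elim 0 W < sw (μ y) then sw (μ y) else 0) -
            if 2 * (pa (μ y)).elim 0 W < sw (μ y) then 2 * (pa (μ y)).elim 0 W else 0) := by
        apply Finset.sum_le_sum
        intro y _
        split_ifs <;> linarith
      rw [Finset.sum_sub_distrib, Finset.sum_sub_distrib] at pw
      linarith
    have ht := h.total
    simp only [hac, Finset.sum_add_distrib, s1, s2, s3] at ht ⊢
    linarith

end Charging

/-! ### Partners in a matching -/

section Mate

variable {V : Type*}

/-- The edges of `M` are not loops. -/
def Loopless (M : Finset (Sym2 V)) : Prop := ∀ g ∈ M, ¬ g.IsDiag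

theorem IsMatching.mono {M N : Finset (Sym2 V)} (hM : IsMatching M) (h : N ⊆ M) : IsMatching N :=
  fun e he e' he' v hv hv' => hM e (h he) e' (h he') v hv hv'

theorem Loopless.mono {M N : Finset (Sym2 V)} (hM : Loopless M) (h : N ⊆ M) : Loopless N :=
  fun e he => hM e (h he)

open Classical in
/-- The partner of `v` in `M`, or `v` if there is none. -/
noncomputable def mate (M : Finset (Sym2 V)) (v : V) : V :=
  if h : ∃ u, s(v, u) ∈ M then h.choose else v

open Classical in
/-- The weight of the edge of `M` at `v`, or `0` if there is none. -/
noncomputable def wAt (w : Sym2 V → ℝ) (M : Finset (Sym2 V)) (v : V) : ℝ :=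
  if mate M v = v then 0 else w s(v, mate M v)

theorem mate_mem {M : Finset (Sym2 V)} {v : V} (h : mate M v ≠ v) : s(v, mate M v) ∈ M := by
  unfold mate at h ⊢
  split_ifs at h ⊢ with hh
  · exact hh.choose_spec
  · exact absurd rfl h

theorem IsMatching.right_unique {M : Finset (Sym2 V)} (hM : IsMatching M) {v u u' : V}
    (h : s(v, u) ∈ M) (h' : s(v, u') ∈ M) : u = u' := by
  have := hM _ h _ h' v (Sym2.mem_mk_left _ _) (Sym2.mem_mk_left _ _)
  exact Sym2.congr_right.1 this

theorem mate_eq {M : Finset (Sym2 V)} (hM : IsMatching M) {v u : V} (h : s(v, u) ∈ M) :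
    mate M v = u := by
  have hh : ∃ u, s(v, u) ∈ M := ⟨u, h⟩
  unfold mate
  rw [dif_pos hh]
  exact hM.right_unique hh.choose_spec h

theorem mate_eq_self {M : Finset (Sym2 V)} {v : V} (h : ∀ g ∈ M, v ∉ g) : mate M v = v := by
  by_contra hc
  exact h _ (mate_mem hc) (Sym2.mem_mk_left _ _)

theorem Loopless.ne {M : Finset (Sym2 V)} (hl : Loopless M) {u v : V} (h : s(u, v) ∈ M) : u ≠ v :=
  fun e => hl _ h (Sym2.mk_isDiag_iff.2 e)

theorem mate_ne {M : Finset (Sym2 V)} (hM : IsMatching M) (hl : Loopless M) {v : V} {g : Sym2 V}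
    (hg : g ∈ M) (hv : v ∈ g) : mate M v ≠ v ∧ g = s(v, mate M v) := by
  obtain ⟨u, rfl⟩ := Sym2.mem_iff_exists.1 hv
  rw [mate_eq hM hg]
  exact ⟨(hl.ne hg).symm, rfl⟩

theorem mate_mate {M : Finset (Sym2 V)} (hM : IsMatching M) (v : V) : mate M (mate M v) = v := by
  by_cases h : mate M v = v
  · rw [h, h]
  · have := mate_mem h
    rw [Sym2.eq_swap] at this
    exact mate_eq hM this

theorem wAt_nonneg {w : Sym2 V → ℝ} {M : Finset (Sym2 V)} (hw : ∀ g ∈ M, 0 ≤ w g) (v : V) :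
    0 ≤ wAt w M v := by
  unfold wAt
  split_ifs with h
  · exact le_rfl
  · exact hw _ (mate_mem h)

theorem wAt_mate (w : Sym2 V → ℝ) {M : Finset (Sym2 V)} (hM : IsMatching M) (v : V) :
    wAt w M (mate M v) = wAt w M v := by
  unfold wAt
  rw [mate_mate hM, Sym2.eq_swap]
  by_cases h : mate M v = v
  · rw [if_pos h, if_pos h.symm]
  · rw [if_neg h, if_neg (Ne.symm h)]

theorem wAt_of_mem (w : Sym2 V → ℝ) {M : Finset (Sym2 V)} (hM : IsMatching M) (hl : Loopless M)
    {v : V} {g : Sym2 V} (hg : g ∈ M) (hv : v ∈ g) : wAt w M v = w g := by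
  obtain ⟨h1, h2⟩ := mate_ne hM hl hg hv
  rw [wAt, if_neg h1, ← h2]

theorem wAt_eq_zero (w : Sym2 V → ℝ) {M : Finset (Sym2 V)} {v : V} (h : ∀ g ∈ M, v ∉ g) :
    wAt w M v = 0 := by
  rw [wAt, if_pos (mate_eq_self h)]

variable [DecidableEq V]

/-- The vertices covered by `A`. -/
def verts (A : Finset (Sym2 V)) : Finset V := A.biUnion Sym2.toFinset

theorem mem_verts {A : Finset (Sym2 V)} {v : V} : v ∈ verts A ↔ ∃ a ∈ A, v ∈ a := by
  simp [verts]

theorem mate_ne_iff {M : Finset (Sym2 V)} (hM : IsMatching M) (hl : Loopless M) {v : V} :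
    mate M v ≠ v ↔ v ∈ verts M := by
  rw [mem_verts]
  constructor
  · intro h
    exact ⟨_, mate_mem h, Sym2.mem_mk_left _ _⟩
  · rintro ⟨g, hg, hv⟩
    exact (mate_ne hM hl hg hv).1

theorem wAt_mono_mem (w : Sym2 V → ℝ) {M N : Finset (Sym2 V)} (hM : IsMatching M) (hl : Loopless M)
    (h : N ⊆ M) {v : V} (hv : v ∈ verts N) : wAt w N v = wAt w M v := by
  obtain ⟨g, hg, hv⟩ := mem_verts.1 hv
  rw [wAt_of_mem w hM hl (h hg) hv, wAt_of_mem w (hM.mono h) (hl.mono h) hg hv]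

theorem wAt_not_mem (w : Sym2 V → ℝ) {M : Finset (Sym2 V)} {v : V} (hv : v ∉ verts M) :
    wAt w M v = 0 :=
  wAt_eq_zero w fun g hg hh => hv (mem_verts.2 ⟨g, hg, hh⟩)

theorem mate_mono_mem {M N : Finset (Sym2 V)} (hM : IsMatching M) (hl : Loopless M)
    (h : N ⊆ M) {v : V} (hv : v ∈ verts N) : mate N v = mate M v := by
  have := (mate_ne_iff (hM.mono h) (hl.mono h)).2 hv
  exact (mate_eq hM (h (mate_mem this))).symm

theorem sum_verts {A : Finset (Sym2 V)} (hA : IsMatching A) (F : V → ℝ) :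
    ∑ v ∈ verts A, F v = ∑ g ∈ A, ∑ v ∈ g.toFinset, F v := by
  apply Finset.sum_biUnion
  intro g hg g' hg' hne
  rw [Function.onFun, Finset.disjoint_left]
  intro v hv hv'
  exact hne (hA g hg g' hg' v (Sym2.mem_toFinset.1 hv) (Sym2.mem_toFinset.1 hv'))

theorem sum_verts_mul {A : Finset (Sym2 V)} (hA : IsMatching A) (hl : Loopless A) (F : V → ℝ)
    (G : Sym2 V → ℝ) (h : ∀ g ∈ A, ∀ v ∈ g, F v = G g) :
    ∑ v ∈ verts A, F v = 2 * ∑ g ∈ A, G g := by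
  rw [sum_verts hA, Finset.mul_sum]
  apply Finset.sum_congr rfl
  intro g hg
  have : ∀ v ∈ g.toFinset, F v = G g := fun v hv => h g hg v (Sym2.mem_toFinset.1 hv)
  rw [Finset.sum_congr rfl this, Finset.sum_const, Sym2.card_toFinset_of_not_isDiag g (hl g hg)]
  simp

theorem sum_wAt [Fintype V] (w : Sym2 V → ℝ) {M : Finset (Sym2 V)} (hM : IsMatching M)
    (hl : Loopless M) : ∑ v, wAt w M v = 2 * ∑ g ∈ M, w g := by
  rw [← sum_verts_mul hM hl (wAt w M) w fun g hg v hv => wAt_of_mem w hM hl hg hv]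
  symm
  apply Finset.sum_subset (Finset.subset_univ _)
  intro v _ hv
  exact wAt_not_mem w hv

/-- Choose for every edge of `N` a vertex of `Y` on it; distinct edges of a matching get distinct
vertices. -/
theorem sum_touching_le {w : Sym2 V → ℝ} {M N : Finset (Sym2 V)} (hM : IsMatching M)
    (hl : Loopless M) (hw : ∀ g ∈ M, 0 ≤ w g) {Y : Finset V} (hN : N ⊆ M)
    (hY : ∀ g ∈ N, ∃ v ∈ Y, v ∈ g) : ∑ g ∈ N, w g ≤ ∑ v ∈ Y, wAt w M v := by
  rcases N.eq_empty_or_nonempty with rfl | ⟨g₀, hg₀⟩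
  · rw [Finset.sum_empty]
    exact Finset.sum_nonneg fun v _ => wAt_nonneg hw v
  have : Nonempty V := ⟨(hY g₀ hg₀).choose⟩
  choose! p hp hp' using hY
  calc ∑ g ∈ N, w g = ∑ g ∈ N, wAt w M (p g) :=
        Finset.sum_congr rfl fun g hg => (wAt_of_mem w hM hl (hN hg) (hp' g hg)).symm
    _ = ∑ v ∈ N.image p, wAt w M v := by
        rw [Finset.sum_image]
        intro g hg g' hg' e
        exact hM g (hN hg) g' (hN hg') (p g) (hp' g hg) (by rw [e]; exact hp' g' hg')
    _ ≤ ∑ v ∈ Y, wAt w M v := by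
        apply Finset.sum_le_sum_of_subset_of_nonneg
        · intro v hv
          obtain ⟨g, hg, rfl⟩ := Finset.mem_image.1 hv
          exact hp g hg
        · intro v _ _
          exact wAt_nonneg hw v

end Mate

/-! ### Consequences of the maximality of an augmentation -/

section Gain

variable {n : ℕ} {M A : Finset (Sym2 (Fin n))}

theorem mem_hit {g : Sym2 (Fin n)} : g ∈ hit M A ↔ g ∈ M ∧ ∃ a ∈ A, ∃ v, v ∈ a ∧ v ∈ g := by
  unfold hit; simp

theorem hit_subset : hit M A ⊆ M := Finset.filter_subset _ _

theorem mem_hit_iff_verts {g : Sym2 (Fin n)} : g ∈ hit M A ↔ g ∈ M ∧ ∃ v ∈ verts A, v ∈ g := by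
  rw [mem_hit]
  simp only [mem_verts]
  constructor
  · rintro ⟨h, a, ha, v, h1, h2⟩; exact ⟨h, v, ⟨a, ha, h1⟩, h2⟩
  · rintro ⟨h, v, ⟨a, ha, h1⟩, h2⟩; exact ⟨h, a, ha, v, h1, h2⟩

theorem gain_empty (γ : ℝ) (w : Sym2 (Fin n) → ℝ) : gain γ w M ∅ = 0 := by
  simp [gain, hit]

/-- The matching after an augmentation. -/
theorem IsMatching.exchange (hM : IsMatching M) (hA : IsMatching A) :
    IsMatching (M \ hit M A ∪ A) := by
  have key : ∀ e ∈ M \ hit M A, ∀ e' ∈ A, ∀ v, v ∈ e → v ∈ e' → False := by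
    intro e he e' he' v hv hv'
    rw [Finset.mem_sdiff] at he
    exact he.2 (mem_hit.2 ⟨he.1, e', he', v, hv', hv⟩)
  intro e he e' he' v hv hv'
  rcases Finset.mem_union.1 he with h | h <;> rcases Finset.mem_union.1 he' with h' | h'
  · exact hM e (Finset.sdiff_subset h) e' (Finset.sdiff_subset h') v hv hv'
  · exact (key e h e' h' v hv hv').elim
  · exact (key e' h' e h v hv' hv).elim
  · exact hA e h e' h' v hv hv'

theorem Loopless.exchange (hM : Loopless M) (hA : Loopless A) : Loopless (M \ hit M A ∪ A) := by
  intro g hg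
  rcases Finset.mem_union.1 hg with h | h
  · exact hM g (Finset.sdiff_subset h)
  · exact hA g h

/-- The matching `A` has the largest gain among the matchings in `T`. -/
def IsMaxGain (w : Sym2 (Fin n) → ℝ) (M T A : Finset (Sym2 (Fin n))) : Prop :=
  A ⊆ T ∧ IsMatching A ∧ ∀ B, B ⊆ T → IsMatching B → gain 1 w M B ≤ gain 1 w M A

variable {T : Finset (Sym2 (Fin n))} {w : Sym2 (Fin n) → ℝ}

theorem IsMaxGain.nonneg (h : IsMaxGain w M T A) : 0 ≤ gain 1 w M A := by
  rw [← gain_empty (M := M) 1 w]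
  exact h.2.2 _ (Finset.empty_subset _) (fun e he => absurd he (Finset.notMem_empty e))

/-- Otherwise it would pay to drop from `A` the edges at `v` and at its partner: the edge of `M`
between these two vertices would then survive and save twice its weight. -/
theorem IsMaxGain.two_mul_le (h : IsMaxGain w M T A)
    (hlA : Loopless A) (hw : ∀ g ∈ M ∪ A, 0 ≤ w g) (v : Fin n) (hv : v ∈ verts A ∨ mate M v ∈ verts A) :
    2 * wAt w M v ≤ wAt w A v + wAt w A (mate M v) := by
  have hwA : ∀ g ∈ A, 0 ≤ w g := fun g hg => hw g (Finset.mem_union_right _ hg)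
  have hwM : ∀ g ∈ M, 0 ≤ w g := fun g hg => hw g (Finset.mem_union_left _ hg)
  by_cases hc : mate M v = v
  · rw [wAt, if_pos hc]
    have := wAt_nonneg hwA v
    have := wAt_nonneg hwA (mate M v)
    linarith
  have hmem := mate_mem hc
  classical
  set S := A.filter fun a => ∃ u ∈ ({v, mate M v} : Finset (Fin n)), u ∈ a with hS
  have h1 := h.2.2 (A \ S) (Finset.sdiff_subset.trans h.1) (h.2.1.mono Finset.sdiff_subset)
  have hSA : S ⊆ A := Finset.filter_subset _ _
  have h2 : ∑ g ∈ hit M (A \ S), w g + w s(v, mate M v) ≤ ∑ g ∈ hit M A, w g := by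
    rw [add_comm, ← Finset.sum_insert (f := w)]
    · apply Finset.sum_le_sum_of_subset_of_nonneg
      · intro g hg
        rcases Finset.mem_insert.1 hg with rfl | hg
        · rw [mem_hit_iff_verts]
          refine ⟨hmem, ?_⟩
          rcases hv with hv | hv
          · exact ⟨_, hv, Sym2.mem_mk_left _ _⟩
          · exact ⟨_, hv, Sym2.mem_mk_right _ _⟩
        · obtain ⟨hg, a, ha, hh⟩ := mem_hit.1 hg
          exact mem_hit.2 ⟨hg, a, Finset.sdiff_subset ha, hh⟩
      · intro g hg _
        exact hwM g (hit_subset hg)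
    · intro hg
      obtain ⟨_, a, ha, u, hu, hu'⟩ := mem_hit.1 hg
      rw [Finset.mem_sdiff] at ha
      apply ha.2
      rw [hS, Finset.mem_filter]
      refine ⟨ha.1, u, ?_, hu⟩
      rw [Sym2.mem_iff] at hu'
      simpa using hu'
  have h3 : ∑ g ∈ S, w g ≤ ∑ u ∈ ({v, mate M v} : Finset (Fin n)), wAt w A u :=
    sum_touching_le h.2.1 hlA hwA hSA fun g hg => (Finset.mem_filter.1 hg).2
  rw [Finset.sum_pair (fun e => hc e.symm)] at h3
  have h4 : ∑ g ∈ A \ S, w g + ∑ g ∈ S, w g = ∑ g ∈ A, w g := Finset.sum_sdiff hSA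
  unfold gain at h1
  rw [wAt, if_neg hc]
  linarith

theorem sum_hit_le (hM : IsMatching M) (hlM : Loopless M) (hw : ∀ g ∈ M, 0 ≤ w g)
    (hA : IsMatching A) :
    ∑ g ∈ hit M A, w g ≤ ∑ a ∈ A, ∑ v ∈ a.toFinset, wAt w M v := by
  rw [← sum_verts hA]
  exact sum_touching_le hM hlM hw hit_subset fun g hg => (mem_hit_iff_verts.1 hg).2

/-- Compare `A` with its subset of edges whose excess is positive. The gain of that subset is at
least the sum of the excesses, as each hit edge is counted at some covered vertex. -/
theorem IsMaxGain.sum_excess_le (h : IsMaxGain w M T A) (hM : IsMatching M) (hlM : Loopless M)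
    (hw : ∀ g ∈ M, 0 ≤ w g) :
    ∑ a ∈ A, max 0 (w a - 2 * ∑ v ∈ a.toFinset, wAt w M v) ≤ gain 1 w M A := by
  classical
  set S := A.filter fun a => 0 < w a - 2 * ∑ v ∈ a.toFinset, wAt w M v with hS
  have hSA : S ⊆ A := Finset.filter_subset _ _
  have h1 := h.2.2 S (hSA.trans h.1) (h.2.1.mono hSA)
  refine le_trans ?_ h1
  have h2 := sum_hit_le hM hlM hw (h.2.1.mono hSA)
  have h3 : ∑ a ∈ A, max 0 (w a - 2 * ∑ v ∈ a.toFinset, wAt w M v) =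
      ∑ a ∈ S, (w a - 2 * ∑ v ∈ a.toFinset, wAt w M v) := by
    rw [hS, Finset.sum_filter]
    apply Finset.sum_congr rfl
    intro a _
    split_ifs with hc
    · exact max_eq_right hc.le
    · exact max_eq_left (not_lt.1 hc)
  rw [h3, Finset.sum_sub_distrib, ← Finset.mul_sum]
  unfold gain
  linarith

/-- The competitor is `B` together with the edges of `A` disjoint from it. Compared with `A` it
loses the edges of `A` that meet `B`, counted once, and removes at most the additional kept edges of
`M` that meet `B`, counted twice. These are edges of the new matching, and `Y` has a vertex on each
of them. -/
theorem IsMaxGain.sum_le (h : IsMaxGain w M T A) (hM : IsMatching M) (hlM : Loopless M)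
    (hlA : Loopless A) (hw : ∀ g ∈ M ∪ A, 0 ≤ w g) {B : Finset (Sym2 (Fin n))} (hBT : B ⊆ T)
    (hB : IsMatching B) {Y : Finset (Fin n)}
    (hY : ∀ g ∈ M \ hit M A ∪ A, (∃ b ∈ B, ∃ v, v ∈ b ∧ v ∈ g) → ∃ v ∈ Y, v ∈ g) :
    ∑ b ∈ B, w b ≤ ∑ y ∈ Y, (if y ∈ verts A then wAt w (M \ hit M A ∪ A) y
      else 2 * wAt w (M \ hit M A ∪ A) y) := by
  classical
  have hwA : ∀ g ∈ A, 0 ≤ w g := fun g hg => hw g (Finset.mem_union_right _ hg)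
  have hwM : ∀ g ∈ M, 0 ≤ w g := fun g hg => hw g (Finset.mem_union_left _ hg)
  have hAT := h.1
  have hA := h.2.1
  set P : Sym2 (Fin n) → Prop := fun g => ∃ b ∈ B, ∃ v, v ∈ b ∧ v ∈ g with hP
  have hdisj : Disjoint B (A.filter fun a => ¬ P a) := by
    rw [Finset.disjoint_left]
    intro b hb hb'
    apply (Finset.mem_filter.1 hb').2
    exact ⟨b, hb, (Quot.out b).1, Sym2.out_fst_mem b, Sym2.out_fst_mem b⟩
  have hC : IsMatching (B ∪ A.filter fun a => ¬ P a) := by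
    have key : ∀ e ∈ B, ∀ e' ∈ A.filter fun a => ¬ P a, ∀ v, v ∈ e → v ∈ e' → False := by
      intro e he e' he' v hv hv'
      exact (Finset.mem_filter.1 he').2 ⟨e, he, v, hv, hv'⟩
    intro e he e' he' v hv hv'
    rcases Finset.mem_union.1 he with c | c <;> rcases Finset.mem_union.1 he' with c' | c'
    · exact hB e c e' c' v hv hv'
    · exact (key e c e' c' v hv hv').elim
    · exact (key e' c' e c v hv' hv).elim
    · exact hA e (Finset.filter_subset _ _ c) e' (Finset.filter_subset _ _ c') v hv hv'
  have h1 := h.2.2 _ (Finset.union_subset hBT ((Finset.filter_subset _ _).trans hAT)) hC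
  have h2 : ∑ g ∈ hit M (B ∪ A.filter fun a => ¬ P a), w g ≤
      ∑ g ∈ hit M A, w g + ∑ g ∈ (M \ hit M A).filter P, w g := by
    rw [← Finset.sum_union]
    · apply Finset.sum_le_sum_of_subset_of_nonneg
      · intro g hg
        obtain ⟨hgM, a, ha, hh⟩ := mem_hit.1 hg
        by_cases hgA : g ∈ hit M A
        · exact Finset.mem_union_left _ hgA
        apply Finset.mem_union_right
        rw [Finset.mem_filter, Finset.mem_sdiff]
        refine ⟨⟨hgM, hgA⟩, ?_⟩
        rcases Finset.mem_union.1 ha with ha | ha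
        · exact ⟨a, ha, hh⟩
        · exact absurd (mem_hit.2 ⟨hgM, a, Finset.filter_subset _ _ ha, hh⟩) hgA
      · intro g hg _
        rcases Finset.mem_union.1 hg with hg | hg
        · exact hwM g (hit_subset hg)
        · exact hwM g (Finset.sdiff_subset (Finset.filter_subset _ _ hg))
    · exact Finset.disjoint_of_subset_right (Finset.filter_subset _ _) Finset.disjoint_sdiff
  have h3 : ∑ g ∈ A.filter P, w g ≤ ∑ y ∈ Y, wAt w A y :=
    sum_touching_le hA hlA hwA (Finset.filter_subset _ _) fun g hg =>
      hY g (Finset.mem_union_right _ (Finset.filter_subset _ _ hg)) (Finset.mem_filter.1 hg).2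
  have h4 : ∑ g ∈ (M \ hit M A).filter P, w g ≤ ∑ y ∈ Y, wAt w (M \ hit M A) y :=
    sum_touching_le (hM.mono Finset.sdiff_subset) (hlM.mono Finset.sdiff_subset)
      (fun g hg => hwM g (Finset.sdiff_subset hg)) (Finset.filter_subset _ _) fun g hg =>
      hY g (Finset.mem_union_left _ (Finset.filter_subset _ _ hg)) (Finset.mem_filter.1 hg).2
  have h5 : ∑ y ∈ Y, (if y ∈ verts A then wAt w (M \ hit M A ∪ A) y
      else 2 * wAt w (M \ hit M A ∪ A) y) = ∑ y ∈ Y, (wAt w A y + 2 * wAt w (M \ hit M A) y) := by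
    apply Finset.sum_congr rfl
    intro y _
    have hM' := hM.exchange hA
    have hl' := hlM.exchange hlA
    split_ifs with hy
    · rw [wAt_mono_mem w hM' hl' Finset.subset_union_right hy, wAt_not_mem (M := M \ hit M A) w]
      · ring
      · intro hc
        obtain ⟨g, hg, hgy⟩ := mem_verts.1 hc
        rw [Finset.mem_sdiff] at hg
        exact hg.2 (mem_hit_iff_verts.2 ⟨hg.1, y, hy, hgy⟩)
    · rw [wAt_not_mem (M := A) w hy]
      by_cases hy' : y ∈ verts (M \ hit M A)
      · rw [wAt_mono_mem w hM' hl' Finset.subset_union_left hy']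
        ring
      · rw [wAt_not_mem w hy', wAt_not_mem]
        · ring
        · intro hc
          obtain ⟨g, hg, hgy⟩ := mem_verts.1 hc
          rcases Finset.mem_union.1 hg with hg | hg
          · exact hy' (mem_verts.2 ⟨g, hg, hgy⟩)
          · exact hy (mem_verts.2 ⟨g, hg, hgy⟩)
  have h6 : ∑ g ∈ A.filter P, w g + ∑ g ∈ A.filter (fun a => ¬ P a), w g = ∑ g ∈ A, w g :=
    Finset.sum_filter_add_sum_filter_not _ _ _
  unfold gain at h1
  rw [Finset.sum_union hdisj] at h1
  rw [h5, Finset.sum_add_distrib, ← Finset.mul_sum]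
  linarith

end Gain

/-! ### Steps of the algorithm and charging schemes -/

section Step

variable {n : ℕ}

/-- The configuration `c` arises from edges of `E`. -/
structure Config.Valid (c : Config n) (E : Finset (Sym2 (Fin n))) : Prop where
  matching : IsMatching c.M
  loopless : Loopless c.M
  subset : c.M ⊆ E
  shadow : ∀ g ∈ c.M, ∀ u ∈ g, ∀ s, c.shadow g u = some s → u ∈ s ∧ ¬ s.IsDiag ∧ s ≠ g ∧ s ∈ E

/-- A step of Zelke's algorithm with `γ = 1` that never uses an edge of the current matching for an
augmentation. -/
def StrictStep (w : Sym2 (Fin n) → ℝ) (e : Sym2 (Fin n)) (c c' : Config n) : Prop :=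
  ∃ A, IsMaxGain w c.M (c.vicinity e) A ∧ Disjoint A c.M ∧ (A = ∅ ∨ 0 < gain 1 w c.M A) ∧
    c' = c.augment A

theorem Config.augment_empty (c : Config n) : c.augment ∅ = c := by
  cases c
  simp [Config.augment, hit]

theorem StrictStep.zelkeStep {w : Sym2 (Fin n) → ℝ} {e : Sym2 (Fin n)} {c c' : Config n}
    (h : StrictStep w e c c') : ZelkeStep 1 w e c c' := by
  obtain ⟨A, ⟨h1, h2, h3⟩, _, h4, rfl⟩ := h
  refine ⟨A, h1, h2, h3, ?_⟩
  rcases h4 with rfl | h4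
  · exact Or.inr ⟨(gain_empty 1 w).le, c.augment_empty⟩
  · exact Or.inl ⟨h4, rfl⟩

theorem edgeAt_eq_some {J : Finset (Sym2 (Fin n))} (hJ : IsMatching J) {j : Sym2 (Fin n)} (hj : j ∈ J)
    {u : Fin n} (hu : u ∈ j) : edgeAt J u = some j := by
  have h : ∃ j ∈ J, u ∈ j := ⟨j, hj, hu⟩
  rw [edgeAt, dif_pos h, Option.some_inj]
  exact hJ _ h.choose_spec.1 _ hj u h.choose_spec.2 hu

theorem edgeAt_eq_none {J : Finset (Sym2 (Fin n))} {u : Fin n} (h : ∀ j ∈ J, u ∉ j) :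
    edgeAt J u = none := by
  rw [edgeAt, dif_neg]
  rintro ⟨j, hj, hu⟩
  exact h j hj hu

theorem edgeAt_mem {J : Finset (Sym2 (Fin n))} {u : Fin n} {s : Sym2 (Fin n)}
    (h : edgeAt J u = some s) : s ∈ J ∧ u ∈ s := by
  unfold edgeAt at h
  split_ifs at h with hh
  rw [Option.some_inj] at h
  rw [← h]
  exact hh.choose_spec

theorem Config.vicinity_subset {c : Config n} {E : Finset (Sym2 (Fin n))} (hc : c.Valid E)
    (e : Sym2 (Fin n)) : c.vicinity e ⊆ insert e E := by
  intro x hx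
  simp only [Config.vicinity, Finset.mem_filter, Finset.mem_univ, true_and] at hx
  rw [Finset.mem_insert]
  rcases hx with h | ⟨y, -, g, hg, -, rfl | ⟨z, hz, -, s, hs, rfl | ⟨h, -⟩⟩⟩
  · exact Or.inl h
  · exact Or.inr (hc.subset hg)
  · exact Or.inr (hc.shadow g hg z hz _ hs).2.2.2
  · exact Or.inr (hc.subset h)

theorem Config.vicinity_loopless {c : Config n} {E : Finset (Sym2 (Fin n))} (hc : c.Valid E)
    {e : Sym2 (Fin n)} (he : ¬ e.IsDiag) : Loopless (c.vicinity e) := by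
  intro x hx
  simp only [Config.vicinity, Finset.mem_filter, Finset.mem_univ, true_and] at hx
  rcases hx with h | ⟨y, -, g, hg, -, rfl | ⟨z, hz, -, s, hs, rfl | ⟨h, -⟩⟩⟩
  · rwa [h]
  · exact hc.loopless _ hg
  · exact (hc.shadow g hg z hz _ hs).2.1
  · exact hc.loopless _ h

theorem Config.Valid.augment {c : Config n} {E : Finset (Sym2 (Fin n))} (hc : c.Valid E)
    {e : Sym2 (Fin n)} (he : ¬ e.IsDiag) {A : Finset (Sym2 (Fin n))} (hAT : A ⊆ c.vicinity e)
    (hA : IsMatching A) (hAM : Disjoint A c.M) : (c.augment A).Valid (insert e E) := by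
  have hAl : Loopless A := (c.vicinity_loopless hc he).mono hAT
  refine ⟨hc.matching.exchange hA, hc.loopless.exchange hAl, ?_, ?_⟩
  · apply Finset.union_subset
    · exact Finset.sdiff_subset.trans (hc.subset.trans (Finset.subset_insert _ _))
    · exact hAT.trans (c.vicinity_subset hc e)
  · intro g hg u hu s hs
    simp only [Config.augment] at hg hs
    split_ifs at hs with h
    · obtain ⟨h1, h2⟩ := edgeAt_mem hs
      have h3 := hit_subset h1
      refine ⟨h2, hc.loopless s h3, ?_, Finset.mem_insert_of_mem (hc.subset h3)⟩
      rintro rfl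
      exact Finset.disjoint_left.1 hAM h.1 h3
    · have hgA : g ∉ A := fun hh => h ⟨hh, hu⟩
      have hgM : g ∈ c.M := by
        rcases Finset.mem_union.1 hg with hh | hh
        · exact Finset.sdiff_subset hh
        · exact absurd hh hgA
      obtain ⟨h1, h2, h3, h4⟩ := hc.shadow g hgM u hu s hs
      exact ⟨h1, h2, h3, Finset.mem_insert_of_mem h4⟩

/-- The shadow edge at `v` of the matching edge at `v`. -/
noncomputable def Config.shadowAt (c : Config n) (v : Fin n) : Option (Sym2 (Fin n)) :=
  if mate c.M v = v then none else c.shadow s(v, mate c.M v) v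

open Classical in
/-- The other end of the edge `s` at `v`. -/
noncomputable def otherEnd (v : Fin n) (s : Sym2 (Fin n)) : Option (Fin n) :=
  if h : v ∈ s then some (Sym2.Mem.other h) else none

theorem otherEnd_eq_some {v a : Fin n} {s : Sym2 (Fin n)} (h : otherEnd v s = some a) :
    s = s(v, a) := by
  unfold otherEnd at h
  split_ifs at h with hv
  rw [Option.some_inj] at h
  rw [← h, Sym2.other_spec]

theorem otherEnd_mk (v a : Fin n) : otherEnd v s(v, a) = some a := by
  have hv : v ∈ s(v, a) := Sym2.mem_mk_left _ _
  rw [otherEnd, dif_pos hv, Option.some_inj]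
  exact Sym2.congr_right.1 (Sym2.other_spec hv)

/-- The other end of the shadow edge at `v`. -/
noncomputable def Config.shadowEnd (c : Config n) (v : Fin n) : Option (Fin n) :=
  (c.shadowAt v).bind (otherEnd v)

/-- The weight of the shadow edge at `v`. -/
noncomputable def Config.shadowWeight (w : Sym2 (Fin n) → ℝ) (c : Config n) (v : Fin n) : ℝ :=
  (c.shadowAt v).elim 0 w

theorem Config.shadowAt_of_shadowEnd {c : Config n} {v a : Fin n} (h : c.shadowEnd v = some a) :
    c.shadowAt v = some s(v, a) := by
  obtain ⟨s, h1, h2⟩ := Option.bind_eq_some_iff.1 h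
  rw [h1, otherEnd_eq_some h2]

theorem Config.shadow_of_shadowAt {c : Config n} {v : Fin n} {s : Sym2 (Fin n)}
    (h : c.shadowAt v = some s) : mate c.M v ≠ v ∧ c.shadow s(v, mate c.M v) v = some s := by
  unfold Config.shadowAt at h
  split_ifs at h with hh
  exact ⟨hh, h⟩

theorem Config.Valid.mateData {c : Config n} {E : Finset (Sym2 (Fin n))} (hc : c.Valid E)
    {w : Sym2 (Fin n) → ℝ} (hw : ∀ e ∈ E, 0 ≤ w e) :
    MateData (mate c.M) (wAt w c.M) (c.shadowWeight w) where
  inv := mate_mate hc.matching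
  W_mate := wAt_mate w hc.matching
  W_nonneg := wAt_nonneg fun g hg => hw g (hc.subset hg)
  W_free v hv := by rw [wAt, if_pos hv]
  sw_nonneg v := by
    unfold Config.shadowWeight
    cases h : c.shadowAt v with
    | none => exact le_rfl
    | some s =>
      obtain ⟨h1, h2⟩ := c.shadow_of_shadowAt h
      exact hw s (hc.shadow _ (mate_mem h1) v (Sym2.mem_mk_left _ _) s h2).2.2.2

/-! ### Charging schemes on configurations -/

section Augment

variable {c : Config n} {E A : Finset (Sym2 (Fin n))} {e : Sym2 (Fin n)}

theorem mate_exchange_of_mem (hc : c.Valid E) (hA : IsMatching A) (hl : Loopless A) {v : Fin n}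
    (hv : v ∈ verts A) : mate (c.augment A).M v = mate A v :=
  (mate_mono_mem (hc.matching.exchange hA) (hc.loopless.exchange hl) Finset.subset_union_right
    hv).symm

theorem mate_exchange_of_hit (hc : c.Valid E) {v : Fin n}
    (hv : v ∉ verts A) (hv' : mate c.M v ∈ verts A) : mate (c.augment A).M v = v := by
  apply mate_eq_self
  intro g hg hgv
  rcases Finset.mem_union.1 hg with h | h
  · rw [Finset.mem_sdiff] at h
    apply h.2
    rw [mem_hit_iff_verts]
    refine ⟨h.1, _, hv', ?_⟩
    rw [(mate_ne hc.matching hc.loopless h.1 hgv).2]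
    exact Sym2.mem_mk_right _ _
  · exact hv (mem_verts.2 ⟨g, h, hgv⟩)

theorem mem_keep {v : Fin n} (hv : v ∉ verts A) (hv' : mate c.M v ∉ verts A)
    (h : mate c.M v ≠ v) : s(v, mate c.M v) ∈ c.M \ hit c.M A := by
  rw [Finset.mem_sdiff, mem_hit_iff_verts]
  refine ⟨mate_mem h, ?_⟩
  rintro ⟨-, u, hu, hu'⟩
  rcases Sym2.mem_iff.1 hu' with rfl | rfl
  · exact hv hu
  · exact hv' hu

theorem mate_exchange_of_keep (hc : c.Valid E) (hA : IsMatching A) {v : Fin n}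
    (hv : v ∉ verts A) (hv' : mate c.M v ∉ verts A) : mate (c.augment A).M v = mate c.M v := by
  by_cases h : mate c.M v = v
  · rw [h]
    apply mate_eq_self
    intro g hg hgv
    rcases Finset.mem_union.1 hg with hh | hh
    · exact (mate_ne hc.matching hc.loopless (Finset.sdiff_subset hh) hgv).1 h
    · exact hv (mem_verts.2 ⟨g, hh, hgv⟩)
  · exact mate_eq (hc.matching.exchange hA) (Finset.mem_union_left _ (mem_keep hv hv' h))

theorem shadowAt_keep (hc : c.Valid E) (hA : IsMatching A) {v : Fin n}
    (hv : v ∉ verts A) (hv' : mate c.M v ∉ verts A) :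
    (c.augment A).shadowAt v = c.shadowAt v := by
  unfold Config.shadowAt
  rw [mate_exchange_of_keep hc hA hv hv']
  split_ifs with h
  · rfl
  · simp only [Config.augment]
    rw [if_neg]
    rintro ⟨h1, h2⟩
    exact hv (mem_verts.2 ⟨_, h1, h2⟩)

theorem shadowAt_new (hc : c.Valid E) (hA : IsMatching A) (hl : Loopless A) {v : Fin n}
    (hv : v ∈ verts A) : (c.augment A).shadowAt v =
      if mate c.M v = v then none else some s(v, mate c.M v) := by
  have h1 := (mate_ne_iff hA hl).2 hv
  unfold Config.shadowAt
  rw [mate_exchange_of_mem hc hA hl hv, if_neg h1]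
  have h2 := mate_mem h1
  have h3 : v ∈ s(v, mate A v) := Sym2.mem_mk_left _ _
  simp only [Config.augment, h2, h3, and_self, if_true]
  split_ifs with h
  · apply edgeAt_eq_none
    intro j hj hv'
    exact (mate_ne hc.matching hc.loopless (hit_subset hj) hv').1 h
  · apply edgeAt_eq_some (hc.matching.mono hit_subset)
    · exact mem_hit_iff_verts.2 ⟨mate_mem h, v, hv, Sym2.mem_mk_left _ _⟩
    · exact Sym2.mem_mk_left _ _

/-- The old matching edge at a newly covered vertex becomes the shadow edge there, hence `sw_new`
and `pa_new`. For `sum_le`, the weight of the matching grows by `w(A) - w(J)`, the gain plus `w(J)`,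
and the gain dominates the excesses; all sums over vertices count an edge twice. -/
theorem IsMaxGain.mateAugment (hc : c.Valid E) (he : ¬ e.IsDiag) {w : Sym2 (Fin n) → ℝ}
    (hw : ∀ x ∈ insert e E, 0 ≤ w x) (hA : IsMaxGain w c.M (c.vicinity e) A)
    (hAM : Disjoint A c.M) :
    MateAugment (mate c.M) (mate (c.augment A).M) (wAt w c.M) (wAt w (c.augment A).M)
      (c.shadowWeight w) ((c.augment A).shadowWeight w) c.shadowEnd (c.augment A).shadowEnd
      (verts A) := by
  have hl : Loopless A := (c.vicinity_loopless hc he).mono hA.1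
  have hM' : IsMatching (c.augment A).M := hc.matching.exchange hA.2.1
  have hl' : Loopless (c.augment A).M := hc.loopless.exchange hl
  have hwM : ∀ g ∈ c.M, 0 ≤ w g := fun g hg => hw g (Finset.mem_insert_of_mem (hc.subset hg))
  have hwA : ∀ g ∈ A, 0 ≤ w g := fun g hg => hw g (c.vicinity_subset hc e (hA.1 hg))
  have hwMA : ∀ g ∈ c.M ∪ A, 0 ≤ w g := fun g hg =>
    (Finset.mem_union.1 hg).elim (hwM g) (hwA g)
  have wA : ∀ v, (if v ∈ verts A then wAt w (c.augment A).M v else 0) = wAt w A v := by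
    intro v
    split_ifs with hv
    · exact (wAt_mono_mem w hM' hl' Finset.subset_union_right hv).symm
    · exact (wAt_not_mem w hv).symm
  constructor
  · intro v hv
    have := (mate_ne_iff hA.2.1 hl).2 hv
    rw [mate_exchange_of_mem hc hA.2.1 hl hv]
    exact mem_verts.2 ⟨_, mate_mem this, Sym2.mem_mk_right _ _⟩
  · intro v hv
    rw [mate_exchange_of_mem hc hA.2.1 hl hv]
    exact (mate_ne_iff hA.2.1 hl).2 hv
  · intro v hv
    rw [Config.shadowWeight, shadowAt_new hc hA.2.1 hl hv, wAt]
    split_ifs <;> rfl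
  · intro v hv h
    rw [Config.shadowEnd, shadowAt_new hc hA.2.1 hl hv, if_neg h, Option.bind_some, otherEnd_mk]
  · intro v hv hv'
    exact mate_exchange_of_hit hc hv hv'
  · intro v hv hv'
    exact mate_exchange_of_keep hc hA.2.1 hv hv'
  · intro v hv hv'
    rw [wAt, wAt, mate_exchange_of_keep hc hA.2.1 hv hv']
  · intro v hv hv'
    rw [Config.shadowWeight, shadowAt_keep hc hA.2.1 hv hv', Config.shadowWeight]
  · intro v hv hv'
    rw [Config.shadowEnd, shadowAt_keep hc hA.2.1 hv hv', Config.shadowEnd]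
  · intro v hv
    rw [wA, wA]
    exact hA.two_mul_le hl hwMA v hv
  · have e1 : ∀ v, (if v ∈ verts A ∨ mate c.M v ∈ verts A then wAt w c.M v else 0) =
        wAt w (hit c.M A) v := by
      intro v
      by_cases hc' : mate c.M v = v
      · have hz : wAt w c.M v = 0 := by rw [wAt, if_pos hc']
        rw [hz, ite_self, wAt_eq_zero]
        intro g hg hv
        exact (mate_ne hc.matching hc.loopless (hit_subset hg) hv).1 hc'
      · split_ifs with h
        · refine (wAt_mono_mem w hc.matching hc.loopless hit_subset ?_).symm
          refine mem_verts.2 ⟨_, mem_hit_iff_verts.2 ⟨mate_mem hc', ?_⟩, Sym2.mem_mk_left _ _⟩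
          rcases h with h | h
          · exact ⟨_, h, Sym2.mem_mk_left _ _⟩
          · exact ⟨_, h, Sym2.mem_mk_right _ _⟩
        · refine (wAt_eq_zero w ?_).symm
          intro g hg hv
          obtain ⟨hgM, u, hu, hu'⟩ := mem_hit_iff_verts.1 hg
          rw [(mate_ne hc.matching hc.loopless hgM hv).2] at hu'
          rcases Sym2.mem_iff.1 hu' with rfl | rfl
          · exact h (Or.inl hu)
          · exact h (Or.inr hu)
    have e2 : ∑ v, (if v ∈ verts A then max 0 (wAt w (c.augment A).M v - 2 * wAt w c.M v -
        2 * wAt w c.M (mate (c.augment A).M v)) else 0) =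
        2 * ∑ a ∈ A, max 0 (w a - 2 * ∑ v ∈ a.toFinset, wAt w c.M v) := by
      rw [Finset.sum_ite_mem, Finset.univ_inter]
      apply sum_verts_mul hA.2.1 hl
      intro g hg v hv
      have hvA : v ∈ verts A := mem_verts.2 ⟨g, hg, hv⟩
      obtain ⟨h1, h2⟩ := mate_ne hA.2.1 hl hg hv
      rw [mate_exchange_of_mem hc hA.2.1 hl hvA,
        wAt_of_mem w hM' hl' (Finset.mem_union_right _ hg) hv, h2, Sym2.toFinset_mk_eq,
        Finset.sum_pair (Ne.symm h1)]
      ring_nf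
    simp only [e1, e2]
    rw [sum_wAt w hc.matching hc.loopless, sum_wAt w (hc.matching.mono hit_subset)
      (hc.loopless.mono hit_subset), sum_wAt w hM' hl', Config.augment]
    have h3 := hA.sum_excess_le hc.matching hc.loopless hwM
    have h4 : ∑ g ∈ c.M \ hit c.M A ∪ A, w g =
        ∑ g ∈ c.M, w g - ∑ g ∈ hit c.M A, w g + ∑ g ∈ A, w g := by
      rw [Finset.sum_union, Finset.sum_sdiff_eq_sub hit_subset]
      exact Finset.disjoint_of_subset_left Finset.sdiff_subset hAM.symm
    rw [h4]
    unfold gain at h3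
    linarith

/-- There is a scheme that distributes the amount `T` over the configuration `c`. -/
def Config.IsCharged (c : Config n) (w : Sym2 (Fin n) → ℝ) (cl : Finset (Fin n)) (T : ℝ) : Prop :=
  ∃ acct r d old U, Charged (mate c.M) (wAt w c.M) (c.shadowWeight w) c.shadowEnd cl T acct r d old U

/-- The inequality required by `Charged.close` is `IsMaxGain.sum_le` for the arriving edge together
with the chosen shadow edges. Although charging takes place after the augmentation, these shadow
edges sit on kept edges and so were available before it. -/
theorem Config.IsCharged.close (hc : c.Valid E) {y₁ y₂ : Fin n} (hy : y₁ ≠ y₂)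
    {w : Sym2 (Fin n) → ℝ} (hw : ∀ x ∈ insert s(y₁, y₂) E, 0 ≤ w x)
    (hA : IsMaxGain w c.M (c.vicinity s(y₁, y₂)) A) (hAM : Disjoint A c.M)
    (heA : s(y₁, y₂) ∉ (c.augment A).M) {cl : Finset (Fin n)} {T : ℝ} (hy₁ : y₁ ∉ cl) (hy₂ : y₂ ∉ cl)
    (h : (c.augment A).IsCharged w cl T) :
    (c.augment A).IsCharged w (insert y₁ (insert y₂ cl)) (T + w s(y₁, y₂)) := by
  have hd : ¬ s(y₁, y₂).IsDiag := by rwa [Sym2.mk_isDiag_iff]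
  have hl : Loopless A := (c.vicinity_loopless hc hd).mono hA.1
  have hc' := hc.augment hd hA.1 hA.2.1 hAM
  have hm' := hc'.mateData hw
  obtain ⟨acct, r, d, old, U, h⟩ := h
  refine h.close hm' hy₁ hy₂ (X := verts A) ?_
  intro I hI hIa hIz hIinj
  set μ := mate (c.augment A).M with hμ
  set p : Fin n → Fin n := fun y => ((c.augment A).shadowEnd (μ y)).getD y with hp
  have hpa : ∀ y ∈ I, (c.augment A).shadowEnd (μ y) = some (p y) ∧ p y ∈ cl := by
    intro y hy
    obtain ⟨-, -, a, ha, e⟩ := hIa y hy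
    have : p y = a := by simp [hp, e]
    rw [this]
    exact ⟨e, ha⟩
  have hIe : ∀ y ∈ I, y ∈ s(y₁, y₂) := fun y hy => by simpa using hI hy
  have hcl : ∀ y ∈ s(y₁, y₂), y ∉ cl := by
    intro y hy
    rcases Sym2.mem_iff.1 hy with rfl | rfl
    · exact hy₁
    · exact hy₂
  have hμX : ∀ y ∈ I, y ∉ verts A ∧ mate c.M y ∉ verts A ∧ μ y = mate c.M y ∧ μ y ≠ y := by
    intro y hy
    obtain ⟨h1, h2, -⟩ := hIa y hy
    have h3 : mate c.M y ∉ verts A := fun hh => h2 (mate_exchange_of_hit hc h1 hh)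
    exact ⟨h1, h3, mate_exchange_of_keep hc hA.2.1 h1 h3, h2⟩
  -- If the partner of `y` were the other end of the arriving edge, that edge would be in the new
  -- matching, against `heA`.
  have hμe : ∀ y ∈ I, μ y ∉ s(y₁, y₂) := by
    intro y hy hh
    have h1 := (hμX y hy).2.2.2
    apply heA
    have h2 := (Sym2.mem_and_mem_iff h1.symm).1 ⟨hIe y hy, hh⟩
    rw [h2]
    exact mate_mem h1
  have hsh : ∀ y ∈ I, (c.augment A).shadowAt (μ y) = some s(μ y, p y) := fun y hy =>
    Config.shadowAt_of_shadowEnd (hpa y hy).1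
  -- Far ends avoid the arriving edge because they are closed and its ends are open; the other
  -- incidences are excluded by `hIz` and `hIinj`.
  have hB : IsMatching (insert s(y₁, y₂) (I.image fun y => s(μ y, p y))) := by
    have k1 : ∀ y ∈ I, ∀ v ∈ s(y₁, y₂), v ∈ s(μ y, p y) → False := by
      intro y hy v hv hv'
      rcases Sym2.mem_iff.1 hv' with rfl | rfl
      · exact hμe y hy hv
      · exact hcl _ hv (hpa y hy).2
    have k2 : ∀ y ∈ I, ∀ y' ∈ I, ∀ v, v ∈ s(μ y, p y) → v ∈ s(μ y', p y') → y = y' := by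
      intro y hy y' hy' v hv hv'
      rcases Sym2.mem_iff.1 hv with rfl | rfl <;> rcases Sym2.mem_iff.1 hv' with e | e
      · rw [← hm'.inv y, ← hm'.inv y', e]
      · exact absurd e.symm (hIz y' hy' y hy _ (hpa y' hy').1)
      · exact absurd e (hIz y hy y' hy' _ (hpa y hy).1)
      · exact hIinj y hy y' hy' (by rw [(hpa y hy).1, (hpa y' hy').1, e])
    intro b hb b' hb' v hv hv'
    rcases Finset.mem_insert.1 hb with rfl | hb <;> rcases Finset.mem_insert.1 hb' with rfl | hb'
    · rfl
    · obtain ⟨y, hy, rfl⟩ := Finset.mem_image.1 hb'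
      exact (k1 y hy v hv hv').elim
    · obtain ⟨y, hy, rfl⟩ := Finset.mem_image.1 hb
      exact (k1 y hy v hv' hv).elim
    · obtain ⟨y, hy, rfl⟩ := Finset.mem_image.1 hb
      obtain ⟨y', hy', rfl⟩ := Finset.mem_image.1 hb'
      rw [k2 y hy y' hy' v hv hv']
  have hBT : insert s(y₁, y₂) (I.image fun y => s(μ y, p y)) ⊆ c.vicinity s(y₁, y₂) := by
    intro b hb
    simp only [Config.vicinity, Finset.mem_filter, Finset.mem_univ, true_and]
    rcases Finset.mem_insert.1 hb with rfl | hb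
    · exact Or.inl rfl
    obtain ⟨y, hy, rfl⟩ := Finset.mem_image.1 hb
    right
    obtain ⟨h1, h2, h3, h4⟩ := hμX y hy
    rw [h3] at h4
    have h5 := hsh y hy
    rw [h3, shadowAt_keep hc hA.2.1 h2 (by rwa [mate_mate hc.matching])] at h5
    have h6 := (c.shadow_of_shadowAt h5).2
    rw [mate_mate hc.matching, Sym2.eq_swap] at h6
    refine ⟨y, hIe y hy, _, mate_mem h4, Sym2.mem_mk_left _ _, Or.inr
      ⟨_, Sym2.mem_mk_right _ _, h4, _, h6, Or.inl ?_⟩⟩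
    rw [h3]
  have hwMA : ∀ g ∈ c.M ∪ A, 0 ≤ w g := by
    intro g hg
    rcases Finset.mem_union.1 hg with hg | hg
    · exact hw g (Finset.mem_insert_of_mem (hc.subset hg))
    · exact hw g (c.vicinity_subset hc _ (hA.1 hg))
  -- The vertices `μ y` need not be listed: the matching edge at `μ y` is the one at `y`, which is
  -- counted already.
  have main := hA.sum_le hc.matching hc.loopless hl hwMA hBT hB
    (Y := {y₁, y₂} ∪ I.image p) (by
      intro g hg hgt
      obtain ⟨b, hb, v, hvb, hvg⟩ := hgt
      rcases Finset.mem_insert.1 hb with rfl | hb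
      · exact ⟨v, Finset.mem_union_left _ (by simpa using hvb), hvg⟩
      obtain ⟨y, hy, rfl⟩ := Finset.mem_image.1 hb
      rcases Sym2.mem_iff.1 hvb with rfl | rfl
      · refine ⟨y, Finset.mem_union_left _ (hI hy), ?_⟩
        have := (mate_ne hc'.matching hc'.loopless hg hvg).2
        rw [this, ← hμ, hm'.inv]
        exact Sym2.mem_mk_right _ _
      · exact ⟨_, Finset.mem_union_right _ (Finset.mem_image_of_mem p hy), hvg⟩)
  have hinj : Set.InjOn (fun y => s(μ y, p y)) I := by
    intro y hy y' hy' e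
    have : μ y ∈ s(μ y', p y') := by
      have e : s(μ y, p y) = s(μ y', p y') := e
      rw [← e]; exact Sym2.mem_mk_left _ _
    rcases Sym2.mem_iff.1 this with h1 | h1
    · rw [← hm'.inv y, ← hm'.inv y', h1]
    · exact absurd h1.symm (hIz y' hy' y hy _ (hpa y' hy').1)
  have hpinj : Set.InjOn p I := by
    intro y hy y' hy' e
    exact hIinj y hy y' hy' (by rw [(hpa y hy).1, (hpa y' hy').1, e])
  rw [Finset.sum_insert, Finset.sum_image hinj] at main
  · have s1 : ∑ y ∈ I, (c.augment A).shadowWeight w (μ y) = ∑ y ∈ I, w s(μ y, p y) := by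
      apply Finset.sum_congr rfl
      intro y hy
      rw [Config.shadowWeight, hsh y hy]
      rfl
    rw [s1]
    refine main.trans ?_
    rw [Finset.sum_union]
    · apply add_le_add le_rfl
      rw [Finset.sum_image hpinj]
      apply Finset.sum_le_sum
      intro y hy
      rw [(hpa y hy).1]
      have := hm'.W_nonneg (p y)
      simp only [Config.augment] at this ⊢
      -- A far end covered by `A` costs only `W`; the bound `2 W` is used for it as well.
      split_ifs
      · simp only [Option.elim]; linarith
      · exact le_rfl
    · rw [Finset.disjoint_left]
      intro y hy hy'
      obtain ⟨y', hyI, rfl⟩ := Finset.mem_image.1 hy'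
      exact hcl _ (by simpa using hy) (hpa y' hyI).2
  · intro hh
    obtain ⟨y, hy, e⟩ := Finset.mem_image.1 hh
    apply hμe y hy
    rw [← e]
    exact Sym2.mem_mk_left _ _

theorem Config.IsCharged.augment (hc : c.Valid E) (he : ¬ e.IsDiag) {w : Sym2 (Fin n) → ℝ}
    (hw : ∀ x ∈ insert e E, 0 ≤ w x) (hA : IsMaxGain w c.M (c.vicinity e) A)
    (hAM : Disjoint A c.M) {cl : Finset (Fin n)} {T : ℝ} (h : c.IsCharged w cl T) :
    (c.augment A).IsCharged w cl T := by
  obtain ⟨acct, r, d, old, U, h⟩ := h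
  exact h.augment (hc.mateData fun x hx => hw x (Finset.mem_insert_of_mem hx))
    ((hc.augment he hA.1 hA.2.1 hAM).mateData hw) (hA.mateAugment hc he hw hAM)

theorem Config.IsCharged.le (hc : c.Valid E) {w : Sym2 (Fin n) → ℝ} (hw : ∀ x ∈ E, 0 ≤ w x)
    {cl : Finset (Fin n)} {T : ℝ} (h : c.IsCharged w cl T) : T ≤ 23 / 4 * ∑ g ∈ c.M, w g := by
  obtain ⟨acct, r, d, old, U, h⟩ := h
  have := h.total_le (hc.mateData hw)
  rw [sum_wAt w hc.matching hc.loopless] at this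
  linarith

end Augment
end Step

/-! ### The approximation guarantee -/

section Run

variable {n : ℕ}

/-- The configuration at the beginning. -/
def Config.start (n : ℕ) : Config n := { M := ∅, shadow := fun _ _ => none }

/-- A run of the `f`-extension of Zelke's algorithm with strict steps, with respect to fixed
weights. -/
structure IsStrictRun (f : Finset (Sym2 (Fin n)) → ℝ) (σ : List (Sym2 (Fin n))) (c : ℕ → Config n)
    (w : Sym2 (Fin n) → ℝ) : Prop where
  start : c 0 = Config.start n
  weight : ∀ (i : ℕ) (hi : i < σ.length),
    w σ[i] = f (insert σ[i] ((c i).M ∪ (c i).S)) - f ((c i).M ∪ (c i).S)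
  step : ∀ (i : ℕ) (hi : i < σ.length), StrictStep w σ[i] (c i) (c (i + 1))

theorem Config.mem_S {c : Config n} {s : Sym2 (Fin n)} :
    s ∈ c.S ↔ ∃ g ∈ c.M, ∃ u ∈ g, c.shadow g u = some s := by
  simp [Config.S]

theorem Config.Valid.S_subset {c : Config n} {E : Finset (Sym2 (Fin n))} (hc : c.Valid E) :
    c.S ⊆ E := by
  intro s hs
  obtain ⟨g, hg, u, hu, h⟩ := Config.mem_S.1 hs
  exact (hc.shadow g hg u hu s h).2.2.2

theorem Config.vicinity_subset_union (c : Config n) (e : Sym2 (Fin n)) :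
    c.vicinity e ⊆ insert e (c.M ∪ c.S) := by
  intro x hx
  simp only [Config.vicinity, Finset.mem_filter, Finset.mem_univ, true_and] at hx
  rw [Finset.mem_insert, Finset.mem_union]
  rcases hx with h | ⟨y, -, g, hg, -, rfl | ⟨z, hz, -, s, hs, rfl | ⟨h, -⟩⟩⟩
  · exact Or.inl h
  · exact Or.inr (Or.inl hg)
  · exact Or.inr (Or.inr (Config.mem_S.2 ⟨g, hg, z, hz, hs⟩))
  · exact Or.inr (Or.inl h)

theorem Config.augment_M_subset {c : Config n} {e : Sym2 (Fin n)} {A : Finset (Sym2 (Fin n))}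
    (hA : A ⊆ c.vicinity e) : (c.augment A).M ⊆ insert e (c.M ∪ c.S) := by
  apply Finset.union_subset
  · exact Finset.sdiff_subset.trans (Finset.subset_union_left.trans (Finset.subset_insert _ _))
  · exact hA.trans (c.vicinity_subset_union e)

/-- New shadow edges are removed matching edges. Consequently only the arriving edge can enter `M ∪
S`, on which both comparisons of `f` with `w` rest. -/
theorem Config.augment_S_subset (c : Config n) (A : Finset (Sym2 (Fin n))) :
    (c.augment A).S ⊆ c.M ∪ c.S := by
  intro s hs
  obtain ⟨g, hg, u, hu, h⟩ := Config.mem_S.1 hs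
  simp only [Config.augment] at hg h
  split_ifs at h with hh
  · exact Finset.mem_union_left _ (hit_subset (edgeAt_mem h).1)
  · apply Finset.mem_union_right
    refine Config.mem_S.2 ⟨g, ?_, u, hu, h⟩
    rcases Finset.mem_union.1 hg with hg | hg
    · exact Finset.sdiff_subset hg
    · exact absurd ⟨hg, hu⟩ hh

theorem toFinset_take_succ {α : Type*} [DecidableEq α] (σ : List α) {i : ℕ} (hi : i < σ.length) :
    (σ.take (i + 1)).toFinset = insert σ[i] (σ.take i).toFinset := by
  rw [← List.take_concat_get' σ i hi, List.toFinset_append]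
  ext x
  simp [or_comm]

theorem getElem_notMem_take {α : Type*} [DecidableEq α] {σ : List α} (h : σ.Nodup) {i : ℕ}
    (hi : i < σ.length) : σ[i] ∉ (σ.take i).toFinset := by
  rw [List.mem_toFinset]
  have h2 := h.sublist (List.take_sublist (i + 1) σ)
  rw [← List.take_concat_get' σ i hi, List.nodup_append] at h2
  intro hm
  exact h2.2.2 _ hm _ (List.mem_singleton_self _) rfl

theorem toFinset_take_subset {α : Type*} [DecidableEq α] (σ : List α) (i : ℕ) :
    (σ.take i).toFinset ⊆ σ.toFinset := by
  intro x hx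
  rw [List.mem_toFinset] at hx ⊢
  exact List.mem_of_mem_take hx

variable {f : Finset (Sym2 (Fin n)) → ℝ} {σ : List (Sym2 (Fin n))} {c : ℕ → Config n}
  {w : Sym2 (Fin n) → ℝ}

theorem IsStrictRun.valid (h : IsStrictRun f σ c w) (hσ : IsGraphStream σ) {i : ℕ}
    (hi : i ≤ σ.length) : (c i).Valid (σ.take i).toFinset := by
  induction i with
  | zero =>
    rw [h.start]
    constructor
    · intro e he; exact absurd he (Finset.notMem_empty e)
    · intro e he; exact absurd he (Finset.notMem_empty e)
    · exact Finset.empty_subset _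
    · intro e he; exact absurd he (Finset.notMem_empty e)
  | succ i ih =>
    obtain ⟨A, hA, hAM, -, e⟩ := h.step i hi
    rw [e, toFinset_take_succ σ hi]
    exact (ih (Nat.le_of_succ_le hi)).augment (hσ.2 _ (List.getElem_mem hi)) hA.1 hA.2.1 hAM

theorem IsStrictRun.union_subset (h : IsStrictRun f σ c w) (hσ : IsGraphStream σ) {i : ℕ}
    (hi : i ≤ σ.length) : (c i).M ∪ (c i).S ⊆ (σ.take i).toFinset :=
  Finset.union_subset (h.valid hσ hi).subset (h.valid hσ hi).S_subset

theorem IsStrictRun.weight_nonneg (h : IsStrictRun f σ c w) (hσ : IsGraphStream σ)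
    (hf : IsMonotoneSubmodular σ.toFinset f) : ∀ e ∈ σ.toFinset, 0 ≤ w e := by
  intro e he
  obtain ⟨i, hi, rfl⟩ := List.getElem_of_mem (List.mem_toFinset.1 he)
  rw [h.weight i hi, sub_nonneg]
  apply hf.mono _ _ (Finset.subset_insert _ _)
  rw [Finset.insert_subset_iff]
  exact ⟨he, (h.union_subset hσ hi.le).trans (toFinset_take_subset σ i)⟩

theorem IsMonotoneSubmodular.insert_sub_le {α : Type*} [DecidableEq α] {E : Finset α}
    {f : Finset α → ℝ} (hf : IsMonotoneSubmodular E f) {X Y : Finset α} {e : α} (hXY : X ⊆ Y)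
    (hY : insert e Y ⊆ E) (he : e ∉ Y) : f (insert e Y) - f Y ≤ f (insert e X) - f X := by
  have hYE := (Finset.subset_insert e Y).trans hY
  have := hf.submodular (insert e X) Y ((Finset.insert_subset_insert e hXY).trans hY) hYE
  have e1 : insert e X ∪ Y = insert e Y := by
    rw [Finset.insert_union, Finset.union_eq_right.2 hXY]
  have e2 : insert e X ∩ Y = X := by
    rw [Finset.insert_inter_of_notMem he, Finset.inter_eq_left.2 hXY]
  rw [e1, e2] at this
  linarith

/-- Peel off the edges of `X` from the latest to the earliest. The others present when an edge
arrived all lay in `M ∪ S` at that time, and the marginal with respect to this larger set is the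
weight. -/
theorem IsStrictRun.sum_le (h : IsStrictRun f σ c w) (hσ : IsGraphStream σ)
    (hf : IsMonotoneSubmodular σ.toFinset f) {i : ℕ} (hi : i ≤ σ.length) :
    ∀ X, X ⊆ (c i).M ∪ (c i).S → ∑ e ∈ X, w e ≤ f X := by
  induction i with
  | zero =>
    intro X hX
    have hX' := h.union_subset hσ hi
    simp only [List.take_zero, List.toFinset_nil, Finset.subset_empty] at hX'
    rw [hX', Finset.subset_empty] at hX
    rw [hX, Finset.sum_empty, hf.proper]
  | succ i ih =>
    intro X hX
    have hi' := Nat.le_of_succ_le hi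
    have hsub : X ⊆ insert σ[i] ((c i).M ∪ (c i).S) := by
      obtain ⟨A, hA, hAM, -, e⟩ := h.step i hi
      rw [e] at hX
      exact hX.trans (Finset.union_subset (Config.augment_M_subset hA.1)
        ((Config.augment_S_subset _ _).trans (Finset.subset_insert _ _)))
    have he := getElem_notMem_take hσ.1 hi
    have hMS := h.union_subset hσ hi'
    by_cases hX' : σ[i] ∈ X
    · have h1 := Finset.subset_insert_iff.1 hsub
      have h2 := ih hi' _ h1
      have h3 := hf.insert_sub_le (e := σ[i]) h1 (by
        rw [Finset.insert_subset_iff]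
        exact ⟨List.mem_toFinset.2 (List.getElem_mem hi),
          hMS.trans (toFinset_take_subset σ i)⟩) (fun hh => he (hMS hh))
      rw [← h.weight i hi, Finset.insert_erase hX'] at h3
      rw [← Finset.sum_erase_add X _ hX']
      linarith
    · exact ih hi' X (fun x hx => (Finset.mem_insert.1 (hsub hx)).resolve_left
        (fun e => hX' (e ▸ hx)))

/-- The edges that have been in the matching up to time `i`. -/
def everMatched (c : ℕ → Config n) (i : ℕ) : Finset (Sym2 (Fin n)) :=
  (Finset.range (i + 1)).biUnion fun j => (c j).M

theorem everMatched_succ (c : ℕ → Config n) (i : ℕ) :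
    everMatched c (i + 1) = everMatched c i ∪ (c (i + 1)).M := by
  unfold everMatched
  rw [Finset.range_add_one, Finset.biUnion_insert, Finset.union_comm]

theorem subset_everMatched (c : ℕ → Config n) (i : ℕ) : (c i).M ⊆ everMatched c i :=
  Finset.subset_biUnion_of_mem (fun j => (c j).M) (Finset.mem_range.2 (Nat.lt_succ_self i))

theorem everMatched_mono (c : ℕ → Config n) {i j : ℕ} (h : i ≤ j) :
    everMatched c i ⊆ everMatched c j :=
  Finset.biUnion_subset_biUnion_of_subset_left _ (Finset.range_mono (Nat.succ_le_succ h))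

/-- Every shadow edge was a matching edge before it was replaced. -/
theorem IsStrictRun.union_subset_everMatched (h : IsStrictRun f σ c w) (hσ : IsGraphStream σ)
    {i : ℕ} (hi : i ≤ σ.length) : (c i).M ∪ (c i).S ⊆ everMatched c i := by
  induction i with
  | zero =>
    have := h.union_subset hσ hi
    simp only [List.take_zero, List.toFinset_nil, Finset.subset_empty] at this
    rw [this]
    exact Finset.empty_subset _
  | succ i ih =>
    obtain ⟨A, hA, hAM, -, e⟩ := h.step i hi
    apply Finset.union_subset (subset_everMatched c _)
    rw [everMatched_succ, e]
    exact ((Config.augment_S_subset _ _).trans (ih (Nat.le_of_succ_le hi))).trans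
      Finset.subset_union_left

theorem IsStrictRun.everMatched_subset (h : IsStrictRun f σ c w) (hσ : IsGraphStream σ)
    {i : ℕ} (hi : i ≤ σ.length) : everMatched c i ⊆ (σ.take i).toFinset := by
  induction i with
  | zero =>
    unfold everMatched
    simp [h.start, Config.start]
  | succ i ih =>
    rw [everMatched_succ]
    apply Finset.union_subset _ (h.valid hσ hi).subset
    rw [toFinset_take_succ σ hi]
    exact (ih (Nat.le_of_succ_le hi)).trans (Finset.subset_insert _ _)

/-- The reverse comparison: the earlier part of `X` contains all edges matched so far, hence `M ∪
S`, so the marginal of the latest edge is at most its weight. -/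
theorem IsStrictRun.le_sum (h : IsStrictRun f σ c w) (hσ : IsGraphStream σ)
    (hf : IsMonotoneSubmodular σ.toFinset f) {i : ℕ} (hi : i ≤ σ.length) :
    ∀ X, everMatched c i ⊆ X → X ⊆ (σ.take i).toFinset → f X ≤ ∑ e ∈ X, w e := by
  induction i with
  | zero =>
    intro X _ hX
    simp only [List.take_zero, List.toFinset_nil, Finset.subset_empty] at hX
    rw [hX, Finset.sum_empty, hf.proper]
  | succ i ih =>
    intro X hX hX'
    have hi' := Nat.le_of_succ_le hi
    have he := getElem_notMem_take hσ.1 hi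
    have hP := (everMatched_mono c (Nat.le_succ i)).trans hX
    rw [toFinset_take_succ σ hi] at hX'
    have h0 : σ[i] ∉ everMatched c i := fun hh => he (h.everMatched_subset hσ hi' hh)
    by_cases hXe : σ[i] ∈ X
    · have h1 := ih hi' (X.erase σ[i]) (Finset.subset_erase.2 ⟨hP, h0⟩)
        (Finset.subset_insert_iff.1 hX')
      have h3 := hf.insert_sub_le (e := σ[i]) (X := (c i).M ∪ (c i).S) (Y := X.erase σ[i])
        ((h.union_subset_everMatched hσ hi').trans (Finset.subset_erase.2 ⟨hP, h0⟩)) (by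
          rw [Finset.insert_erase hXe]
          refine hX'.trans ?_
          rw [Finset.insert_subset_iff]
          exact ⟨List.mem_toFinset.2 (List.getElem_mem hi), toFinset_take_subset σ i⟩)
        (Finset.notMem_erase _ _)
      rw [← h.weight i hi, Finset.insert_erase hXe] at h3
      rw [← Finset.sum_erase_add X _ hXe]
      linarith
    · exact ih hi' X hP (fun x hx => (Finset.mem_insert.1 (hX' hx)).resolve_left
        (fun e => hXe (e ▸ hx)))

/-- The left side grows by at most `w(A)`, and the right side by `2 (w(A) - w(J)) ≥ w(A)`, because a
gain `w(A) - 2 w(J)` that is not negative gives `2 w(J) ≤ w(A)`. Edges that re-enter the matching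
are counted once. -/
theorem IsStrictRun.sum_everMatched_le (h : IsStrictRun f σ c w) (hσ : IsGraphStream σ)
    (hf : IsMonotoneSubmodular σ.toFinset f) {i : ℕ} (hi : i ≤ σ.length) :
    ∑ e ∈ everMatched c i, w e ≤ 2 * ∑ e ∈ (c i).M, w e := by
  have hw := h.weight_nonneg hσ hf
  induction i with
  | zero =>
    unfold everMatched
    simp [h.start, Config.start]
  | succ i ih =>
    have ih := ih (Nat.le_of_succ_le hi)
    have hv := h.valid hσ (Nat.le_of_succ_le hi)
    have hE := (h.valid hσ hi).subset.trans (toFinset_take_subset σ (i + 1))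
    have hP := (h.everMatched_subset hσ (Nat.le_of_succ_le hi)).trans (toFinset_take_subset σ i)
    obtain ⟨A, hA, hAM, -, e⟩ := h.step i hi
    have hg := hA.nonneg
    have hAE : A ⊆ σ.toFinset := by
      rw [e] at hE
      exact Finset.subset_union_right.trans hE
    have h1 : ∑ x ∈ everMatched c (i + 1), w x ≤ ∑ x ∈ everMatched c i, w x + ∑ x ∈ A, w x := by
      have hsub : everMatched c (i + 1) ⊆ everMatched c i ∪ A := by
        rw [everMatched_succ, e]
        refine Finset.union_subset Finset.subset_union_left (Finset.union_subset ?_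
          Finset.subset_union_right)
        exact Finset.sdiff_subset.trans ((subset_everMatched c i).trans Finset.subset_union_left)
      have h2 := Finset.sum_union_inter (s₁ := everMatched c i) (s₂ := A) (f := w)
      have h3 : 0 ≤ ∑ x ∈ everMatched c i ∩ A, w x :=
        Finset.sum_nonneg fun x hx => hw x (hAE (Finset.mem_inter.1 hx).2)
      have h4 : ∑ x ∈ everMatched c (i + 1), w x ≤ ∑ x ∈ everMatched c i ∪ A, w x :=
        Finset.sum_le_sum_of_subset_of_nonneg hsub fun x hx _ =>
          (Finset.mem_union.1 hx).elim (fun hx => hw x (hP hx)) (fun hx => hw x (hAE hx))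
      linarith
    have h5 : ∑ x ∈ (c (i + 1)).M, w x =
        ∑ g ∈ (c i).M, w g - ∑ g ∈ hit (c i).M A, w g + ∑ g ∈ A, w g := by
      rw [e, Config.augment, Finset.sum_union, Finset.sum_sdiff_eq_sub hit_subset]
      exact Finset.disjoint_of_subset_left Finset.sdiff_subset hAM.symm
    unfold gain at hg
    have h6 : 0 ≤ ∑ g ∈ A, w g := Finset.sum_nonneg fun x hx => hw x (hAE hx)
    rw [h5]
    linarith

theorem Config.start_isCharged (w : Sym2 (Fin n) → ℝ) : (Config.start n).IsCharged w ∅ 0 := by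
  have hm : ∀ v, mate (Config.start n).M v = v := fun v => mate_eq_self fun g hg =>
    absurd hg (Finset.notMem_empty g)
  have hW : ∀ v, wAt w (Config.start n).M v = 0 := fun v => by rw [wAt, if_pos (hm v)]
  refine ⟨0, 0, 0, ∅, ∅, ?_⟩
  constructor <;> simp [hW, hm]

/-- Each arrival first transforms the scheme by the augmentation and then, if the edge is in `N`,
closes its two ends. They are still open since `N` is a matching, and the edge is not taken since
`N` avoids all edges ever matched. -/
theorem IsStrictRun.isCharged (h : IsStrictRun f σ c w) (hσ : IsGraphStream σ)
    (hf : IsMonotoneSubmodular σ.toFinset f) {N : Finset (Sym2 (Fin n))}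
    (hN : IsMatching N) (hNP : Disjoint N (everMatched c σ.length)) {i : ℕ} (hi : i ≤ σ.length) :
    (c i).IsCharged w (verts (N ∩ (σ.take i).toFinset)) (∑ o ∈ N ∩ (σ.take i).toFinset, w o) := by
  have hw := h.weight_nonneg hσ hf
  induction i with
  | zero =>
    rw [h.start]
    simpa [verts] using Config.start_isCharged w
  | succ i ih =>
    have ih := ih (Nat.le_of_succ_le hi)
    have hv := h.valid hσ (Nat.le_of_succ_le hi)
    have he := hσ.2 _ (List.getElem_mem hi)
    have heE := getElem_notMem_take hσ.1 hi
    have hw' : ∀ x ∈ insert σ[i] (σ.take i).toFinset, 0 ≤ w x := by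
      rw [← toFinset_take_succ σ hi]
      exact fun x hx => hw x (toFinset_take_subset _ _ hx)
    obtain ⟨A, hA, hAM, -, e⟩ := h.step i hi
    have h1 := ih.augment hv he hw' hA hAM
    rw [toFinset_take_succ σ hi]
    by_cases hoN : σ[i] ∈ N
    · have heA : σ[i] ∉ (c (i + 1)).M := fun hh => Finset.disjoint_left.1 hNP hoN
        (everMatched_mono c hi (subset_everMatched c _ hh))
      rw [Finset.inter_insert_of_mem hoN, Finset.sum_insert (by simp [heE]), e,
        add_comm (w σ[i])]
      rw [e] at heA
      generalize σ[i] = o at *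
      induction o with
      | h y₁ y₂ =>
        have hne : y₁ ≠ y₂ := by rwa [Sym2.mk_isDiag_iff] at he
        have hcl : ∀ y ∈ s(y₁, y₂), y ∉ verts (N ∩ (σ.take i).toFinset) := by
          intro y hy hy'
          obtain ⟨g, hg, hyg⟩ := mem_verts.1 hy'
          rw [Finset.mem_inter] at hg
          have := hN _ hoN _ hg.1 y hy hyg
          exact heE (this ▸ hg.2)
        have h2 := Config.IsCharged.close hv hne hw' hA hAM heA
          (hcl _ (Sym2.mem_mk_left _ _)) (hcl _ (Sym2.mem_mk_right _ _)) h1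
        have h3 : verts (insert s(y₁, y₂) (N ∩ (σ.take i).toFinset)) =
            insert y₁ (insert y₂ (verts (N ∩ (σ.take i).toFinset))) := by
          ext v
          simp only [mem_verts, Finset.mem_insert, exists_eq_or_imp, Sym2.mem_iff, or_assoc]
        rw [h3]
        exact h2
    · rw [Finset.inter_insert_of_notMem hoN, e]
      exact h1

/-- The `f`-extension of Zelke's algorithm with `γ = 1` is a `7.75`-approximation. -/
theorem IsStrictRun.isApproxMSM (h : IsStrictRun f σ c w) (hσ : IsGraphStream σ)
    (hf : IsMonotoneSubmodular σ.toFinset f) :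
    IsApproxMSM σ.toFinset f 7.75 (c σ.length).M := by
  have hw := h.weight_nonneg hσ hf
  have hv := h.valid hσ le_rfl
  have hP := h.everMatched_subset hσ le_rfl
  have hwP := h.sum_everMatched_le hσ hf le_rfl
  have hle := h.le_sum hσ hf le_rfl
  have hge := h.sum_le hσ hf le_rfl _ Finset.subset_union_left
  rw [List.take_length] at hv hP hle
  refine ⟨hv.subset, hv.matching, ?_⟩
  intro N hN hNm
  set P := everMatched c σ.length with hPdef
  -- Only `N \ P` is charged; the part of `N` in `P` is covered by `w(P) ≤ 2 w(M)`.
  have hch := (h.isCharged hσ hf (hNm.mono (Finset.sdiff_subset (s := N) (t := P)))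
    Finset.sdiff_disjoint le_rfl)
  rw [List.take_length, Finset.inter_eq_left.2 (Finset.sdiff_subset.trans hN)] at hch
  have h1 := hch.le hv hw
  have h2 := hle (P ∪ N) Finset.subset_union_left (Finset.union_subset hP hN)
  have h3 := hf.mono (P ∪ N) N Finset.subset_union_right (Finset.union_subset hP hN)
  rw [← Finset.union_sdiff_self_eq_union, Finset.sum_union Finset.disjoint_sdiff,
    Finset.union_sdiff_self_eq_union] at h2
  rw [inv_mul_le_iff₀ (by norm_num)]
  linarith

end Run

/-! ### Semantics and resource use of programs -/

section Semantics

variable {k n : ℕ}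

/-- The effect of a program on the memory. -/
noncomputable def Cmd.sem (f : Finset (Sym2 (Fin n)) → ℝ) : Cmd k → Mem k n → Mem k n
  | .skip, m => m
  | .seq c d, m => d.sem f (c.sem f m)
  | .vclear r, m => { m with vreg := Function.update m.vreg r none }
  | .vmove r s, m => { m with vreg := Function.update m.vreg r (m.vreg s) }
  | .vload r a i, m =>
    { m with vreg := Function.update m.vreg r ((m.vreg i).bind (m.varr a)) }
  | .vstore a i s, m =>
    { m with
      varr := match m.vreg i with
        | some u => Function.update m.varr a (Function.update (m.varr a) u (m.vreg s))
        | none => m.varr }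
  | .ifEq r s c d, m => if m.vreg r = m.vreg s then c.sem f m else d.sem f m
  | .wclear x, m => { m with wreg := Function.update m.wreg x 0 }
  | .wmove x y, m => { m with wreg := Function.update m.wreg x (m.wreg y) }
  | .wload x a i, m =>
    { m with
      wreg := Function.update m.wreg x
        (match m.vreg i with
          | some u => m.warr a u
          | none => 0) }
  | .wstore a i x, m =>
    { m with
      warr := match m.vreg i with
        | some u => Function.update m.warr a (Function.update (m.warr a) u (m.wreg x))
        | none => m.warr }
  | .wadd x y z, m => { m with wreg := Function.update m.wreg x (m.wreg y + m.wreg z) }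
  | .wsub x y z, m => { m with wreg := Function.update m.wreg x (m.wreg y - m.wreg z) }
  | .ifLe x y c d, m => if m.wreg x ≤ m.wreg y then c.sem f m else d.sem f m
  | .insert q r s, m => { m with eset := Function.update m.eset q (m.eset q ∪ m.edgeOf r s) }
  | .erase q r s, m => { m with eset := Function.update m.eset q (m.eset q \ m.edgeOf r s) }
  | .query x q, m => { m with wreg := Function.update m.wreg x (f (m.eset q)) }

theorem Cmd.exec_mem (f : Finset (Sym2 (Fin n)) → ℝ) (c : Cmd k) (R : Machine k n) :
    (c.exec f R).mem = c.sem f R.mem := by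
  induction c generalizing R with
  | seq c d hc hd => rw [Cmd.exec, hd, hc, Cmd.sem]
  | ifEq r s c d hc hd =>
    rw [Cmd.exec, Cmd.sem]
    split_ifs
    · rw [hc]; rfl
    · rw [hd]; rfl
  | ifLe r s c d hc hd =>
    rw [Cmd.exec, Cmd.sem]
    split_ifs
    · rw [hc]; rfl
    · rw [hd]; rfl
  | _ => rfl

/-- An upper bound for the number of elementary steps of a program. -/
def Cmd.cost : Cmd k → ℕ
  | .skip => 0
  | .seq c d => c.cost + d.cost
  | .ifEq _ _ c d => 1 + (c.cost + d.cost)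
  | .ifLe _ _ c d => 1 + (c.cost + d.cost)
  | _ => 1

theorem Cmd.exec_time_le (f : Finset (Sym2 (Fin n)) → ℝ) (c : Cmd k) (R : Machine k n) :
    (c.exec f R).time ≤ R.time + c.cost := by
  induction c generalizing R with
  | skip => exact le_rfl
  | seq c d hc hd =>
    rw [Cmd.exec, Cmd.cost]
    have := hc R
    have := hd (c.exec f R)
    omega
  | ifEq r s c d hc hd =>
    have h1 := hc (R.tick R.mem)
    have h2 := hd (R.tick R.mem)
    have h3 : (R.tick R.mem).time = R.time + 1 := rfl
    rw [Cmd.exec, Cmd.cost]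
    split_ifs <;> omega
  | ifLe r s c d hc hd =>
    have h1 := hc (R.tick R.mem)
    have h2 := hd (R.tick R.mem)
    have h3 : (R.tick R.mem).time = R.time + 1 := rfl
    rw [Cmd.exec, Cmd.cost]
    split_ifs <;> omega
  | _ => exact le_rfl

theorem Mem.card_edgeOf_le (m : Mem k n) (r s : Fin k) : (m.edgeOf r s).card ≤ 1 := by
  unfold Mem.edgeOf
  split <;> simp

theorem Mem.edges_update_le (m : Mem k n) (q : Fin k) (X : Finset (Sym2 (Fin n))) {a : ℕ}
    (h : X.card ≤ (m.eset q).card + a) :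
    Mem.edges { m with eset := Function.update m.eset q X } ≤ m.edges + a := by
  unfold Mem.edges
  have key : ∀ g : Fin k → Finset (Sym2 (Fin n)),
      ∑ i, (g i).card = (g q).card + ∑ i ∈ Finset.univ.erase q, (g i).card := fun g =>
    (Finset.add_sum_erase _ _ (Finset.mem_univ q)).symm
  rw [key, key m.eset]
  simp only [Function.update_self]
  have : ∑ i ∈ Finset.univ.erase q, (Function.update m.eset q X i).card =
      ∑ i ∈ Finset.univ.erase q, (m.eset i).card := by
    apply Finset.sum_congr rfl
    intro i hi
    rw [Function.update_of_ne (Finset.ne_of_mem_erase hi)]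
  omega

theorem Machine.tick_peak_le (R : Machine k n) (m : Mem k n) {a : ℕ} (h : m.edges ≤ R.mem.edges + a) :
    m.edges ≤ R.mem.edges + a ∧
      (R.tick m).peakEdges ≤ max R.peakEdges (R.mem.edges + a) :=
  ⟨h, max_le_max le_rfl h⟩

/-- An elementary step adds at most one edge, so the bound for the number of steps also bounds the
growth of the edge sets. -/
theorem Cmd.exec_edges_le (f : Finset (Sym2 (Fin n)) → ℝ) (c : Cmd k) (R : Machine k n) :
    (c.exec f R).mem.edges ≤ R.mem.edges + c.cost ∧
      (c.exec f R).peakEdges ≤ max R.peakEdges (R.mem.edges + c.cost) := by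
  induction c generalizing R with
  | skip => exact ⟨le_rfl, le_max_left _ _⟩
  | seq c d hc hd =>
    rw [Cmd.exec, Cmd.cost]
    have h1 := hc R
    have h2 := hd (c.exec f R)
    omega
  | ifEq r s c d hc hd =>
    have h1 := hc (R.tick R.mem)
    have h2 := hd (R.tick R.mem)
    have h3 : (R.tick R.mem).mem = R.mem := rfl
    have h4 : (R.tick R.mem).peakEdges = max R.peakEdges R.mem.edges := rfl
    rw [h3, h4] at h1 h2
    rw [Cmd.exec, Cmd.cost]
    split_ifs <;> omega
  | ifLe r s c d hc hd =>
    have h1 := hc (R.tick R.mem)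
    have h2 := hd (R.tick R.mem)
    have h3 : (R.tick R.mem).mem = R.mem := rfl
    have h4 : (R.tick R.mem).peakEdges = max R.peakEdges R.mem.edges := rfl
    rw [h3, h4] at h1 h2
    rw [Cmd.exec, Cmd.cost]
    split_ifs <;> omega
  | insert q r s =>
    rw [Cmd.exec]
    refine R.tick_peak_le _ (R.mem.edges_update_le q _ ?_)
    exact (Finset.card_union_le _ _).trans (Nat.add_le_add_left (R.mem.card_edgeOf_le r s) _)
  | erase q r s =>
    rw [Cmd.exec]
    refine R.tick_peak_le _ (R.mem.edges_update_le q _ ?_)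
    exact (Finset.card_le_card Finset.sdiff_subset).trans (Nat.le_add_right _ _)
  | _ => exact R.tick_peak_le _ (Nat.le_add_right _ _)

/-- Programs that do not call the oracle. -/
def Cmd.QueryFree : Cmd k → Prop
  | .seq c d => c.QueryFree ∧ d.QueryFree
  | .ifEq _ _ c d => c.QueryFree ∧ d.QueryFree
  | .ifLe _ _ c d => c.QueryFree ∧ d.QueryFree
  | .query _ _ => False
  | _ => True

theorem Cmd.QueryFree.exec_queries {c : Cmd k} (h : c.QueryFree) (f : Finset (Sym2 (Fin n)) → ℝ)
    (R : Machine k n) : (c.exec f R).queries = R.queries := by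
  induction c generalizing R with
  | seq c d hc hd => rw [Cmd.exec, hd h.2, hc h.1]
  | ifEq r s c d hc hd =>
    rw [Cmd.exec]
    split_ifs
    · rw [hc h.1]; rfl
    · rw [hd h.2]; rfl
  | ifLe r s c d hc hd =>
    rw [Cmd.exec]
    split_ifs
    · rw [hc h.1]; rfl
    · rw [hd h.2]; rfl
  | query => exact h.elim
  | _ => rfl

/-- Sequential composition of a list of programs. -/
def Cmd.seqs : List (Cmd k) → Cmd k
  | [] => .skip
  | c :: l => .seq c (Cmd.seqs l)

theorem Cmd.QueryFree.seqs {l : List (Cmd k)} (h : ∀ c ∈ l, c.QueryFree) :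
    (Cmd.seqs l).QueryFree := by
  induction l with
  | nil => trivial
  | cons c l ih =>
    exact ⟨h c List.mem_cons_self, ih fun d hd => h d (List.mem_cons_of_mem _ hd)⟩

/-- Run `c` if the content of register `r` differs from those of the registers in `l`. -/
def Cmd.ifNotMem (r : Fin k) (l : List (Fin k)) (c : Cmd k) : Cmd k :=
  l.foldr (fun s d => .ifEq r s .skip d) c

/-- Run `c` if the contents of the registers in `l` are distinct. -/
def Cmd.ifNodup : List (Fin k) → Cmd k → Cmd k
  | [], c => c
  | r :: l, c => Cmd.ifNotMem r l (Cmd.ifNodup l c)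

theorem Cmd.sem_ifNotMem (f : Finset (Sym2 (Fin n)) → ℝ) (r : Fin k) (l : List (Fin k)) (c : Cmd k)
    (m : Mem k n) :
    (Cmd.ifNotMem r l c).sem f m = if m.vreg r ∈ l.map m.vreg then m else c.sem f m := by
  induction l with
  | nil => simp [Cmd.ifNotMem]
  | cons s l ih =>
    have e : Cmd.ifNotMem r (s :: l) c = .ifEq r s .skip (Cmd.ifNotMem r l c) := rfl
    rw [e, Cmd.sem, ih, Cmd.sem]
    simp only [List.map_cons, List.mem_cons]
    by_cases h1 : m.vreg r = m.vreg s <;> by_cases h2 : m.vreg r ∈ l.map m.vreg <;> simp [h1, h2]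

theorem Cmd.sem_ifNodup (f : Finset (Sym2 (Fin n)) → ℝ) (l : List (Fin k)) (c : Cmd k)
    (m : Mem k n) :
    (Cmd.ifNodup l c).sem f m = if (l.map m.vreg).Nodup then c.sem f m else m := by
  induction l with
  | nil => simp [Cmd.ifNodup]
  | cons r l ih =>
    rw [Cmd.ifNodup, Cmd.sem_ifNotMem, ih]
    simp only [List.map_cons, List.nodup_cons]
    by_cases h1 : m.vreg r ∈ l.map m.vreg <;> simp [h1]

theorem Cmd.QueryFree.ifNotMem {c : Cmd k} (h : c.QueryFree) (r : Fin k) (l : List (Fin k)) :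
    (Cmd.ifNotMem r l c).QueryFree := by
  induction l with
  | nil => exact h
  | cons s l ih => exact ⟨trivial, ih⟩

theorem Cmd.QueryFree.ifNodup {c : Cmd k} (h : c.QueryFree) (l : List (Fin k)) :
    (Cmd.ifNodup l c).QueryFree := by
  induction l with
  | nil => exact h
  | cons r l ih => exact ih.ifNotMem r l

end Semantics

/-! ### Choosing the augmentation -/

section Candidates

variable {n : ℕ}

/-- The arrays and edge sets agree, as do the vertex registers below `a` and the weight registers
below `b`. -/
structure Mem.Agree (a b : Fin 16) (m m' : Mem 16 n) : Prop where
  varr : m'.varr = m.varr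
  warr : m'.warr = m.warr
  eset : m'.eset = m.eset
  vreg : ∀ r, r < a → m'.vreg r = m.vreg r
  wreg : ∀ x, x < b → m'.wreg x = m.wreg x

theorem Mem.Agree.refl (a b : Fin 16) (m : Mem 16 n) : m.Agree a b m :=
  ⟨rfl, rfl, rfl, fun _ _ => rfl, fun _ _ => rfl⟩

theorem Mem.Agree.trans {a b : Fin 16} {m₁ m₂ m₃ : Mem 16 n} (h : m₁.Agree a b m₂)
    (h' : m₂.Agree a b m₃) : m₁.Agree a b m₃ :=
  ⟨h'.varr.trans h.varr, h'.warr.trans h.warr, h'.eset.trans h.eset,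
    fun r hr => (h'.vreg r hr).trans (h.vreg r hr), fun x hx => (h'.wreg x hx).trans (h.wreg x hx)⟩

theorem Mem.Agree.mono {a b a' b' : Fin 16} {m m' : Mem 16 n} (h : m.Agree a b m') (ha : a' ≤ a)
    (hb : b' ≤ b) : m.Agree a' b' m' :=
  ⟨h.varr, h.warr, h.eset, fun r hr => h.vreg r (lt_of_lt_of_le hr ha),
    fun x hx => h.wreg x (lt_of_lt_of_le hx hb)⟩

theorem Mem.Agree.map_vreg {a b : Fin 16} {m m' : Mem 16 n} (h : m.Agree a b m')
    {l : List (Fin 16)} (hl : ∀ r ∈ l, r < a) : l.map m'.vreg = l.map m.vreg :=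
  List.map_congr_left fun r hr => h.vreg r (hl r hr)

theorem Mem.agree_vreg {a b : Fin 16} (m : Mem 16 n) {r : Fin 16} (hr : a ≤ r)
    (x : Option (Fin n)) : m.Agree a b { m with vreg := Function.update m.vreg r x } :=
  ⟨rfl, rfl, rfl, fun _ hs => Function.update_of_ne (ne_of_lt (lt_of_lt_of_le hs hr)) _ _,
    fun _ _ => rfl⟩

theorem Mem.agree_wreg {a b : Fin 16} (m : Mem 16 n) {r : Fin 16} (hr : b ≤ r) (x : ℝ) :
    m.Agree a b { m with wreg := Function.update m.wreg r x } :=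
  ⟨rfl, rfl, rfl, fun _ _ => rfl,
    fun _ hs => Function.update_of_ne (ne_of_lt (lt_of_lt_of_le hs hr)) _ _⟩

/-- Two vertex registers for the ends of an edge and a register for its weight. -/
abbrev EdgeRegs : Type := Fin 16 × Fin 16 × Fin 16

/-- The vertex registers of a list of edges. -/
def endRegs (I : List EdgeRegs) : List (Fin 16) := I.flatMap fun t => [t.1, t.2.1]

/-- The contents of the registers of an edge. -/
def Mem.edgeVal (m : Mem 16 n) (t : EdgeRegs) : Option (Fin n) × Option (Fin n) × ℝ :=
  (m.vreg t.1, m.vreg t.2.1, m.wreg t.2.2)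

/-- The total weight of the edges at the given vertices, computed from the arrays of partners and
weights. -/
noncomputable def hitSum (mt : Fin n → Option (Fin n)) (wt : Fin n → ℝ) : List (Option (Fin n)) → ℝ
  | [] => 0
  | u :: l => hitSum mt wt l + if u.bind mt ∈ none :: l then 0 else u.elim 0 wt

/-- Compute `hitSum` into weight register `9`. -/
def hitCmd : List (Fin 16) → Cmd 16
  | [] => .wclear 9
  | u :: l => .seq (hitCmd l) (.seq (.vload 13 0 u)
      (.ifNotMem 13 (2 :: l) (.seq (.wload 10 0 u) (.wadd 9 9 10))))

theorem sem_hitCmd (f : Finset (Sym2 (Fin n)) → ℝ) (m : Mem 16 n) (hm : m.vreg 2 = none)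
    (l : List (Fin 16)) (hl : ∀ r ∈ l, r < 13) :
    m.Agree 13 9 ((hitCmd l).sem f m) ∧
      ((hitCmd l).sem f m).wreg 9 = hitSum (m.varr 0) (m.warr 0) (l.map m.vreg) := by
  induction l with
  | nil =>
    refine ⟨m.agree_wreg le_rfl _, ?_⟩
    simp [hitCmd, Cmd.sem, hitSum]
  | cons u l ih =>
    obtain ⟨h1, h2⟩ := ih fun r hr => hl r (List.mem_cons_of_mem _ hr)
    have hu := hl u List.mem_cons_self
    set m₁ := (hitCmd l).sem f m with hm₁
    set m₂ : Mem 16 n :=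
      { m₁ with vreg := Function.update m₁.vreg 13 ((m₁.vreg u).bind (m₁.varr 0)) } with hm₂
    have h3 : m.Agree 13 9 m₂ := h1.trans (m₁.agree_vreg le_rfl _)
    have e1 : m₂.vreg 13 = (m.vreg u).bind (m.varr 0) := by
      simp only [hm₂, Function.update_self, h1.varr, h1.vreg u hu]
    -- Vertex register `2` is always empty. Listing it makes the same test skip an unmatched vertex
    -- and an edge that is counted at a later vertex of the list.
    have e2 : (2 :: l).map m₂.vreg = none :: l.map m.vreg := by
      rw [List.map_cons, h3.vreg 2 (by decide), hm,
        h3.map_vreg fun r hr => hl r (List.mem_cons_of_mem _ hr)]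
    have e3 : m₂.wreg 9 = hitSum (m.varr 0) (m.warr 0) (l.map m.vreg) := h2
    have e4 : hitSum (m.varr 0) (m.warr 0) ((u :: l).map m.vreg) =
        hitSum (m.varr 0) (m.warr 0) (l.map m.vreg) +
          if (m.vreg u).bind (m.varr 0) ∈ none :: l.map m.vreg then 0
            else (m.vreg u).elim 0 (m.warr 0) := rfl
    have hs : (hitCmd (u :: l)).sem f m = if m₂.vreg 13 ∈ (2 :: l).map m₂.vreg then m₂ else
        (Cmd.seq (.wload 10 0 u) (.wadd 9 9 10)).sem f m₂ := Cmd.sem_ifNotMem f 13 (2 :: l) _ m₂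
    rw [hs, e4]
    by_cases hc : (m.vreg u).bind (m.varr 0) ∈ none :: l.map m.vreg
    · rw [if_pos (by rwa [e1, e2]), if_pos hc]
      exact ⟨h3, by rw [e3, add_zero]⟩
    · rw [if_neg (by rwa [e1, e2]), if_neg hc]
      simp only [Cmd.sem]
      refine ⟨h3.trans ((m₂.agree_wreg (by decide) _).trans (Mem.agree_wreg _ le_rfl _)), ?_⟩
      rw [Function.update_self, Function.update_self, Function.update_of_ne (by decide), e3,
        h3.vreg u hu, h3.warr]
      cases m.vreg u <;> rfl

/-- Add the weights of a list of edges to weight register `11`. -/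
def sumCmd : List EdgeRegs → Cmd 16
  | [] => .wclear 11
  | t :: I => .seq (sumCmd I) (.wadd 11 11 t.2.2)

theorem sem_sumCmd (f : Finset (Sym2 (Fin n)) → ℝ) (m : Mem 16 n)
    (I : List EdgeRegs) (hI : ∀ t ∈ I, t.2.2 < 5) :
    m.Agree 13 10 ((sumCmd I).sem f m) ∧
      ((sumCmd I).sem f m).wreg 11 = (I.map fun t => (m.edgeVal t).2.2).sum := by
  induction I with
  | nil =>
    refine ⟨m.agree_wreg (by decide) _, ?_⟩
    simp [sumCmd, Cmd.sem]
  | cons t I ih =>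
    obtain ⟨h1, h2⟩ := ih fun r hr => hI r (List.mem_cons_of_mem _ hr)
    have ht := hI t List.mem_cons_self
    simp only [sumCmd, Cmd.sem]
    refine ⟨h1.trans (Mem.agree_wreg _ (by decide) _), ?_⟩
    rw [Function.update_self, h2, h1.wreg _ (ht.trans (by decide)), List.map_cons, List.sum_cons,
      add_comm]
    rfl

/-- The registers that hold the best augmentation found so far. -/
def bestRegs : List EdgeRegs := [(7, 8, 6), (9, 10, 7), (11, 12, 8)]

/-- Copy the registers of a list of edges to others. -/
def copyCmds : List EdgeRegs → List EdgeRegs → List (Cmd 16)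
  | [], _ => []
  | t :: B, [] => .vclear t.1 :: .vclear t.2.1 :: .wclear t.2.2 :: copyCmds B []
  | t :: B, s :: I => .vmove t.1 s.1 :: .vmove t.2.1 s.2.1 :: .wmove t.2.2 s.2.2 :: copyCmds B I

/-- The candidates for an augmentation. The registers of the arriving edge are `0`, `1` and `2`, and
those of the two shadow edges are `3`, `4`, `3` and `5`, `6`, `4`. -/
def candidates : List (List EdgeRegs) :=
  [[(0, 1, 2)], [(3, 4, 3)], [(5, 6, 4)], [(0, 1, 2), (3, 4, 3)], [(0, 1, 2), (5, 6, 4)],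
    [(3, 4, 3), (5, 6, 4)], [(0, 1, 2), (3, 4, 3), (5, 6, 4)]]

theorem sem_copyCmds (f : Finset (Sym2 (Fin n)) → ℝ) (m : Mem 16 n) (I : List EdgeRegs)
    (hI : I ∈ [] :: candidates) :
    m.Agree 7 6 ((Cmd.seqs (copyCmds bestRegs I)).sem f m) ∧
      bestRegs.map ((Cmd.seqs (copyCmds bestRegs I)).sem f m).edgeVal =
        I.map m.edgeVal ++ List.replicate (3 - I.length) (none, none, 0) := by
  constructor
  · simp only [candidates, List.mem_cons, List.not_mem_nil, or_false] at hI
    rcases hI with rfl | rfl | rfl | rfl | rfl | rfl | rfl | rfl <;>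
    · simp only [bestRegs, copyCmds, Cmd.seqs, Cmd.sem]
      refine ⟨rfl, rfl, rfl, fun r hr => ?_, fun r hr => ?_⟩
      · have key : ∀ s, 7 ≤ s → r ≠ s := fun s hs => ne_of_lt (lt_of_lt_of_le hr hs)
        simp [key 7 (by decide), key 8 (by decide), key 9 (by decide),
          key 10 (by decide), key 11 (by decide), key 12 (by decide)]
      · have key : ∀ s, 6 ≤ s → r ≠ s := fun s hs => ne_of_lt (lt_of_lt_of_le hr hs)
        simp [key 6 (by decide), key 7 (by decide), key 8 (by decide)]
  · simp only [candidates, List.mem_cons, List.not_mem_nil, or_false] at hI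
    rcases hI with rfl | rfl | rfl | rfl | rfl | rfl | rfl | rfl <;>
    simp [bestRegs, copyCmds, Cmd.seqs, Cmd.sem, Mem.edgeVal, List.replicate]

/-- The computed gain of a list of edges. -/
noncomputable def Mem.gainVal (m : Mem 16 n) (I : List EdgeRegs) : ℝ :=
  (I.map fun t => (m.edgeVal t).2.2).sum -
    2 * hitSum (m.varr 0) (m.warr 0) ((endRegs I).map m.vreg)

/-- The registers of the list of edges name disjoint edges. -/
def Mem.Proper (m : Mem 16 n) (I : List EdgeRegs) : Prop :=
  (none :: (endRegs I).map m.vreg).Nodup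

/-- Replace the best augmentation by `I` if `I` is better. -/
def candCmd (I : List EdgeRegs) : Cmd 16 :=
  .ifNodup (2 :: endRegs I) (.seq (hitCmd (endRegs I)) (.seq (sumCmd I) (.seq (.wadd 9 9 9)
    (.seq (.wsub 12 11 9) (.ifLe 12 5 .skip
      (.seq (.wmove 5 12) (.seqs (copyCmds bestRegs I))))))))

theorem candidates_bound {I : List EdgeRegs} (hI : I ∈ [] :: candidates) :
    (∀ t ∈ I, t.2.2 < 5) ∧ ∀ r ∈ endRegs I, r < 7 := by
  simp only [candidates, List.mem_cons, List.not_mem_nil, or_false] at hI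
  rcases hI with rfl | rfl | rfl | rfl | rfl | rfl | rfl | rfl <;>
    simp [endRegs]

theorem Mem.Agree.edgeVal_eq {m m' : Mem 16 n} (h : m.Agree 7 5 m') {I : List EdgeRegs}
    (hI : I ∈ [] :: candidates) : I.map m'.edgeVal = I.map m.edgeVal := by
  obtain ⟨h1, h2⟩ := candidates_bound hI
  apply List.map_congr_left
  intro t ht
  have k1 : t.1 ∈ endRegs I := List.mem_flatMap.2 ⟨t, ht, by simp⟩
  have k2 : t.2.1 ∈ endRegs I := List.mem_flatMap.2 ⟨t, ht, by simp⟩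
  rw [Mem.edgeVal, Mem.edgeVal, h.vreg _ (h2 _ k1), h.vreg _ (h2 _ k2), h.wreg _ (h1 t ht)]

theorem Mem.Agree.gainVal_eq {m m' : Mem 16 n} (h : m.Agree 7 5 m') {I : List EdgeRegs}
    (hI : I ∈ [] :: candidates) : m'.gainVal I = m.gainVal I := by
  have h1 := h.map_vreg (candidates_bound hI).2
  have h2 := h.edgeVal_eq hI
  have h3 : (I.map fun t => (m'.edgeVal t).2.2) = I.map fun t => (m.edgeVal t).2.2 := by
    have := congrArg (List.map fun v => v.2.2) h2
    rwa [List.map_map, List.map_map] at this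
  rw [Mem.gainVal, Mem.gainVal, h1, h3, h.varr, h.warr]

theorem Mem.Agree.proper_iff {m m' : Mem 16 n} (h : m.Agree 7 5 m') {I : List EdgeRegs}
    (hI : I ∈ [] :: candidates) : m'.Proper I ↔ m.Proper I := by
  rw [Mem.Proper, Mem.Proper, h.map_vreg (candidates_bound hI).2]

theorem sem_candCmd (f : Finset (Sym2 (Fin n)) → ℝ) (m : Mem 16 n) (hm : m.vreg 2 = none)
    {I : List EdgeRegs} (hI : I ∈ candidates) :
    m.Agree 7 5 ((candCmd I).sem f m) ∧
      ((m.Proper I ∧ m.wreg 5 < m.gainVal I ∧ ((candCmd I).sem f m).wreg 5 = m.gainVal I ∧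
        bestRegs.map ((candCmd I).sem f m).edgeVal =
          I.map m.edgeVal ++ List.replicate (3 - I.length) (none, none, 0)) ∨
      (¬ (m.Proper I ∧ m.wreg 5 < m.gainVal I) ∧ ((candCmd I).sem f m).wreg 5 = m.wreg 5 ∧
        bestRegs.map ((candCmd I).sem f m).edgeVal = bestRegs.map m.edgeVal)) := by
  have hI' : I ∈ [] :: candidates := List.mem_cons_of_mem _ hI
  obtain ⟨hw, hv⟩ := candidates_bound hI'
  rw [candCmd, Cmd.sem_ifNodup]
  have e0 : (2 :: endRegs I).map m.vreg = none :: (endRegs I).map m.vreg := by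
    rw [List.map_cons, hm]
  -- With the empty register in the list, the test for distinctness says at once that all end
  -- registers are filled and that the edges named are disjoint.
  rw [e0]
  by_cases hp : (none :: (endRegs I).map m.vreg).Nodup
  swap
  · rw [if_neg hp]
    exact ⟨Mem.Agree.refl _ _ _, Or.inr ⟨fun h => hp h.1, rfl, rfl⟩⟩
  rw [if_pos hp]
  obtain ⟨h1, h2⟩ := sem_hitCmd f m hm (endRegs I) fun r hr => (hv r hr).trans (by decide)
  set m₁ := (hitCmd (endRegs I)).sem f m with hm₁
  obtain ⟨h3, h4⟩ := sem_sumCmd f m₁ I hw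
  set m₂ := (sumCmd I).sem f m₁ with hm₂
  have h5 : m.Agree 13 9 m₂ := h1.trans (h3.mono le_rfl (by decide))
  set m₃ : Mem 16 n := { m₂ with wreg := Function.update m₂.wreg 9 (m₂.wreg 9 + m₂.wreg 9) } with hm₃
  have h6 : m.Agree 13 9 m₃ := h5.trans (m₂.agree_wreg le_rfl _)
  set m₄ : Mem 16 n := { m₃ with wreg := Function.update m₃.wreg 12 (m₃.wreg 11 - m₃.wreg 9) } with hm₄
  have h7 : m.Agree 13 9 m₄ := h6.trans (m₃.agree_wreg (by decide) _)
  have hg : m₄.wreg 12 = m.gainVal I := by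
    have h8 : m₂.wreg 9 = hitSum (m.varr 0) (m.warr 0) ((endRegs I).map m.vreg) := by
      rw [h3.wreg 9 (by decide), h2]
    have h9 : (I.map fun t => (m₁.edgeVal t).2.2) = I.map fun t => (m.edgeVal t).2.2 := by
      apply List.map_congr_left
      intro t ht
      exact h1.wreg _ ((hw t ht).trans (by decide))
    rw [h9] at h4
    simp only [hm₄, hm₃, Function.update_self]
    rw [Function.update_of_ne (by decide), h4, h8, Mem.gainVal]
    ring
  have h5' : m₄.wreg 5 = m.wreg 5 := h7.wreg 5 (by decide)
  have hs : (Cmd.seq (hitCmd (endRegs I)) (.seq (sumCmd I) (.seq (.wadd 9 9 9)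
      (.seq (.wsub 12 11 9) (.ifLe 12 5 .skip
        (.seq (.wmove 5 12) (.seqs (copyCmds bestRegs I)))))))).sem f m =
      if m₄.wreg 12 ≤ m₄.wreg 5 then m₄ else (Cmd.seqs (copyCmds bestRegs I)).sem f
        { m₄ with wreg := Function.update m₄.wreg 5 (m₄.wreg 12) } := rfl
  rw [hs, hg, h5']
  have hb : bestRegs.map m₄.edgeVal = bestRegs.map m.edgeVal := by
    simp only [bestRegs, List.map_cons, List.map_nil, Mem.edgeVal]
    rw [h7.vreg 7 (by decide), h7.vreg 8 (by decide), h7.vreg 9 (by decide), h7.vreg 10 (by decide),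
      h7.vreg 11 (by decide), h7.vreg 12 (by decide), h7.wreg 6 (by decide), h7.wreg 7 (by decide),
      h7.wreg 8 (by decide)]
  split_ifs with hc
  · exact ⟨h7.mono (by decide) (by decide), Or.inr ⟨fun h => not_lt.2 hc h.2, h5', hb⟩⟩
  · set m₅ : Mem 16 n := { m₄ with wreg := Function.update m₄.wreg 5 (m.gainVal I) } with hm₅
    have h8 : m.Agree 7 5 m₅ := (h7.mono (by decide) (by decide)).trans (m₄.agree_wreg le_rfl _)
    obtain ⟨h9, h10⟩ := sem_copyCmds f m₅ I hI'
    refine ⟨h8.trans (h9.mono le_rfl (by decide)), Or.inl ⟨hp, not_le.1 hc, ?_, ?_⟩⟩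
    · exact (h9.wreg 5 (by decide)).trans (Function.update_self (5 : Fin 16) (m.gainVal I) m₄.wreg)
    · rw [h10, h8.edgeVal_eq hI']

/-- The state after the best among the empty augmentation and the candidates in `Is` was found,
where the inputs are those of `m₀`. -/
structure Mem.BestOf (m₀ : Mem 16 n) (Is : List (List EdgeRegs)) (m : Mem 16 n) : Prop where
  agree : m₀.Agree 7 5 m
  best : ∃ I ∈ [] :: candidates, m₀.Proper I ∧ m.wreg 5 = m₀.gainVal I ∧
    (I = [] ∨ 0 < m₀.gainVal I) ∧
    bestRegs.map m.edgeVal = I.map m₀.edgeVal ++ List.replicate (3 - I.length) (none, none, 0)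
  max : ∀ I ∈ [] :: Is, m₀.Proper I → m₀.gainVal I ≤ m.wreg 5

theorem Mem.gainVal_nil (m : Mem 16 n) : m.gainVal [] = 0 := by
  simp [Mem.gainVal, endRegs, hitSum]

theorem Mem.BestOf.candCmd {m₀ m : Mem 16 n} (f : Finset (Sym2 (Fin n)) → ℝ)
    (hm : m₀.vreg 2 = none) {I : List EdgeRegs} {Is : List (List EdgeRegs)} (hI : I ∈ candidates)
    (h : m₀.BestOf Is m) : m₀.BestOf (I :: Is) ((candCmd I).sem f m) := by
  have hI' : I ∈ [] :: candidates := List.mem_cons_of_mem _ hI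
  have hm' : m.vreg 2 = none := by rw [h.agree.vreg 2 (by decide), hm]
  obtain ⟨h1, h2⟩ := sem_candCmd f m hm' hI
  rw [h.agree.proper_iff hI', h.agree.gainVal_eq hI', h.agree.edgeVal_eq hI'] at h2
  obtain ⟨J, hJ, j1, j2, j3, j4⟩ := h.best
  -- The empty augmentation has gain `0`, so a candidate that replaces the current best has positive
  -- gain.
  have hnn : 0 ≤ m.wreg 5 := by
    have := h.max [] List.mem_cons_self (by simp [Mem.Proper, endRegs])
    rwa [Mem.gainVal_nil] at this
  refine ⟨h.agree.trans h1, ?_, ?_⟩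
  · rcases h2 with ⟨g1, g2, g3, g4⟩ | ⟨g1, g2, g3⟩
    · exact ⟨I, hI', g1, g3, Or.inr (lt_of_le_of_lt hnn g2), g4⟩
    · exact ⟨J, hJ, j1, g2.trans j2, j3, g3.trans j4⟩
  · intro K hK hKp
    have hK : K = I ∨ K ∈ [] :: Is := by
      simp only [List.mem_cons] at hK ⊢; tauto
    rcases h2 with ⟨g1, g2, g3, g4⟩ | ⟨g1, g2, g3⟩
    · rw [g3]
      rcases hK with rfl | hK
      · exact le_rfl
      · exact (h.max K hK hKp).trans g2.le
    · rw [g2]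
      rcases hK with rfl | hK
      · exact not_lt.1 fun hh => g1 ⟨hKp, hh⟩
      · exact h.max K hK hKp

/-- Find the best augmentation. -/
def bestCmd : Cmd 16 :=
  .seq (.wclear 5) (.seq (.seqs (copyCmds bestRegs [])) (.seqs (candidates.map candCmd)))

theorem Mem.BestOf.seqs {m₀ : Mem 16 n} (f : Finset (Sym2 (Fin n)) → ℝ)
    (hm : m₀.vreg 2 = none) (L : List (List EdgeRegs)) (hL : ∀ I ∈ L, I ∈ candidates) :
    ∀ (Is : List (List EdgeRegs)) (m : Mem 16 n), m₀.BestOf Is m →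
      m₀.BestOf (L.reverse ++ Is) ((Cmd.seqs (L.map MSM.candCmd)).sem f m) := by
  induction L with
  | nil => intro Is m h; exact h
  | cons I L ih =>
    intro Is m h
    have := ih (fun J hJ => hL J (List.mem_cons_of_mem _ hJ)) _ _
      (h.candCmd f hm (hL I List.mem_cons_self))
    simpa [Cmd.seqs, Cmd.sem] using this

theorem bestOf_bestCmd (f : Finset (Sym2 (Fin n)) → ℝ) (m : Mem 16 n) (hm : m.vreg 2 = none) :
    m.BestOf candidates (bestCmd.sem f m) := by
  have h0 : m.BestOf [] ((Cmd.seqs (copyCmds bestRegs [])).sem f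
      { m with wreg := Function.update m.wreg 5 0 }) := by
    obtain ⟨h1, h2⟩ := sem_copyCmds f { m with wreg := Function.update m.wreg 5 0 } []
      List.mem_cons_self
    have h3 : ((Cmd.seqs (copyCmds bestRegs [])).sem f
        { m with wreg := Function.update m.wreg 5 0 }).wreg 5 = 0 := by
      exact (h1.wreg 5 (by decide)).trans (Function.update_self (5 : Fin 16) (0 : ℝ) m.wreg)
    have h4 : m.Agree 7 5 ((Cmd.seqs (copyCmds bestRegs [])).sem f
        { m with wreg := Function.update m.wreg 5 0 }) :=
      (m.agree_wreg le_rfl _).trans (h1.mono le_rfl (by decide))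
    refine ⟨h4, ⟨[], List.mem_cons_self, by simp [Mem.Proper, endRegs], ?_, Or.inl rfl, ?_⟩, ?_⟩
    · rw [h3, Mem.gainVal_nil]
    · rw [h2]; rfl
    · intro I hI _
      rw [List.mem_singleton.1 hI, h3, Mem.gainVal_nil]
  have h1 := Mem.BestOf.seqs f hm candidates (fun _ h => h) [] _ h0
  refine ⟨h1.agree, h1.best, ?_⟩
  intro I hI
  apply h1.max
  simpa using hI

end Candidates

/-! ### Lists of disjoint edges -/

section EdgeLists

variable {V : Type*}

/-- The end vertices of a list of edges. -/
def ends (L : List (V × V)) : List V := L.flatMap fun p => [p.1, p.2]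

theorem ends_cons (p : V × V) (L : List (V × V)) : ends (p :: L) = p.1 :: p.2 :: ends L := rfl

variable [DecidableEq V]

/-- The set of the edges in a list. -/
def edgesOf (L : List (V × V)) : Finset (Sym2 V) := (L.map fun p => s(p.1, p.2)).toFinset

theorem edgesOf_cons (p : V × V) (L : List (V × V)) :
    edgesOf (p :: L) = insert s(p.1, p.2) (edgesOf L) := by
  simp [edgesOf]

theorem mem_verts_edgesOf {L : List (V × V)} {v : V} : v ∈ verts (edgesOf L) ↔ v ∈ ends L := by
  induction L with
  | nil => simp [edgesOf, ends, verts]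
  | cons p L ih =>
    rw [ends_cons, edgesOf_cons]
    simp only [mem_verts, Finset.mem_insert, exists_eq_or_imp, List.mem_cons] at ih ⊢
    rw [Sym2.mem_iff, ih, or_assoc]

theorem notMem_edgesOf {p : V × V} {L : List (V × V)} (h : p.1 ∉ ends L) :
    s(p.1, p.2) ∉ edgesOf L := fun hm =>
  h (mem_verts_edgesOf.1 (mem_verts.2 ⟨_, hm, Sym2.mem_mk_left _ _⟩))

theorem loopless_edgesOf {L : List (V × V)} (h : (ends L).Nodup) : Loopless (edgesOf L) := by
  induction L with
  | nil => intro g hg; simp [edgesOf] at hg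
  | cons p L ih =>
    rw [ends_cons, List.nodup_cons, List.nodup_cons] at h
    intro g hg
    rw [edgesOf_cons, Finset.mem_insert] at hg
    rcases hg with rfl | hg
    · rw [Sym2.mk_isDiag_iff]
      intro hh
      exact h.1 (by rw [hh]; exact List.mem_cons_self)
    · exact ih h.2.2 g hg

theorem isMatching_edgesOf {L : List (V × V)} (h : (ends L).Nodup) : IsMatching (edgesOf L) := by
  induction L with
  | nil => intro g hg; simp [edgesOf] at hg
  | cons p L ih =>
    rw [ends_cons, List.nodup_cons, List.nodup_cons] at h
    obtain ⟨h1, h2, h3⟩ := h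
    have key : ∀ g ∈ edgesOf L, ∀ v, v ∈ s(p.1, p.2) → v ∉ g := by
      intro g hg v hv hv'
      have hm : v ∈ ends L := mem_verts_edgesOf.1 (mem_verts.2 ⟨g, hg, hv'⟩)
      rcases Sym2.mem_iff.1 hv with rfl | rfl
      · exact h1 (List.mem_cons_of_mem _ hm)
      · exact h2 hm
    intro g hg g' hg' v hv hv'
    rw [edgesOf_cons, Finset.mem_insert] at hg hg'
    rcases hg with rfl | hg <;> rcases hg' with rfl | hg'
    · rfl
    · exact absurd hv' (key g' hg' v hv)
    · exact absurd hv (key g hg v hv')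
    · exact ih h3 g hg g' hg' v hv hv'

theorem sum_edgesOf (w : Sym2 V → ℝ) {L : List (V × V)} (h : (ends L).Nodup) :
    ∑ g ∈ edgesOf L, w g = (L.map fun p => w s(p.1, p.2)).sum := by
  induction L with
  | nil => simp [edgesOf]
  | cons p L ih =>
    rw [ends_cons, List.nodup_cons, List.nodup_cons] at h
    rw [edgesOf_cons, Finset.sum_insert (notMem_edgesOf fun hm => h.1 (List.mem_cons_of_mem _ hm)),
      ih h.2.2]
    rfl

end EdgeLists

/-! ### From registers to an augmentation of maximum gain -/

section Gain

variable {n : ℕ}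

/-- The array of partners in `M`. -/
noncomputable def partner (M : Finset (Sym2 (Fin n))) (v : Fin n) : Option (Fin n) :=
  if mate M v = v then none else some (mate M v)

/-- An edge of `M` with both ends in the list is counted only at the later one: at the earlier
vertex its partner is found in the rest of the list. -/
theorem hitSum_eq {M : Finset (Sym2 (Fin n))} (hM : IsMatching M) (hlM : Loopless M)
    (w : Sym2 (Fin n) → ℝ) {wt : Fin n → ℝ} (hwt : ∀ v, mate M v ≠ v → wt v = w s(v, mate M v))
    {l : List (Fin n)} (hl : l.Nodup) :
    hitSum (partner M) wt (l.map some) = ∑ g ∈ M with ∃ v ∈ l, v ∈ g, w g := by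
  induction l with
  | nil => simp [hitSum]
  | cons u l ih =>
    rw [List.nodup_cons] at hl
    rw [List.map_cons, hitSum, ih hl.2, Option.bind_some, Option.elim_some]
    by_cases h : mate M u = u
    · rw [partner, if_pos h, if_pos List.mem_cons_self, add_zero]
      apply Finset.sum_congr _ fun _ _ => rfl
      apply Finset.filter_congr
      intro g hg
      have : u ∉ g := fun hu => (mate_ne hM hlM hg hu).1 h
      simp [this]
    · have hmem : some (mate M u) ∈ none :: l.map some ↔ mate M u ∈ l := by simp
      rw [partner, if_neg h]
      by_cases hm : mate M u ∈ l
      · rw [if_pos (hmem.2 hm), add_zero]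
        apply Finset.sum_congr _ fun _ _ => rfl
        apply Finset.filter_congr
        intro g hg
        constructor
        · rintro ⟨v, hv, hvg⟩
          exact ⟨v, List.mem_cons_of_mem _ hv, hvg⟩
        · rintro ⟨v, hv, hvg⟩
          rcases List.mem_cons.1 hv with rfl | hv
          · refine ⟨_, hm, ?_⟩
            rw [(mate_ne hM hlM hg hvg).2]
            exact Sym2.mem_mk_right _ _
          · exact ⟨v, hv, hvg⟩
      · rw [if_neg fun hh => hm (hmem.1 hh), hwt u h]
        have e : (M.filter fun g => ∃ v ∈ u :: l, v ∈ g) =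
            insert s(u, mate M u) (M.filter fun g => ∃ v ∈ l, v ∈ g) := by
          ext g
          simp only [Finset.mem_filter, Finset.mem_insert, List.mem_cons, exists_eq_or_imp]
          constructor
          · rintro ⟨hg, hu | hv⟩
            · exact Or.inl (mate_ne hM hlM hg hu).2
            · exact Or.inr ⟨hg, hv⟩
          · rintro (rfl | ⟨hg, hv⟩)
            · exact ⟨mate_mem h, Or.inl (Sym2.mem_mk_left _ _)⟩
            · exact ⟨hg, Or.inr hv⟩
        rw [e, Finset.sum_insert, add_comm]
        rw [Finset.mem_filter]
        rintro ⟨-, v, hv, hvg⟩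
        rcases Sym2.mem_iff.1 hvg with rfl | rfl
        · exact hl.1 hv
        · exact hm hv

/-- The registers of the list of edges `I` hold the ends of the edges in `L`. -/
def Mem.Holds (m : Mem 16 n) (I : List EdgeRegs) (L : List (Fin n × Fin n)) : Prop :=
  List.Forall₂ (fun t p => m.vreg t.1 = some p.1 ∧ m.vreg t.2.1 = some p.2) I L

theorem Mem.Holds.map_endRegs {m : Mem 16 n} {I : List EdgeRegs} {L : List (Fin n × Fin n)}
    (h : m.Holds I L) : (endRegs I).map m.vreg = (ends L).map some := by
  induction h with
  | nil => rfl
  | @cons t p I L hp _ ih =>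
    have e : endRegs (t :: I) = t.1 :: t.2.1 :: endRegs I := rfl
    rw [e, ends_cons, List.map_cons, List.map_cons, List.map_cons, List.map_cons, hp.1, hp.2, ih]

theorem Mem.Holds.proper_iff {m : Mem 16 n} {I : List EdgeRegs} {L : List (Fin n × Fin n)}
    (h : m.Holds I L) : m.Proper I ↔ (ends L).Nodup := by
  rw [Mem.Proper, h.map_endRegs, List.nodup_cons, List.nodup_map_iff (Option.some_injective _)]
  simp

theorem Mem.Proper.exists_holds {m : Mem 16 n} {I : List EdgeRegs} (h : m.Proper I) :
    ∃ L, m.Holds I L := by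
  induction I with
  | nil => exact ⟨[], List.Forall₂.nil⟩
  | cons t I ih =>
    have e : endRegs (t :: I) = t.1 :: t.2.1 :: endRegs I := rfl
    rw [Mem.Proper, e, List.map_cons, List.map_cons] at h
    obtain ⟨L, hL⟩ := ih (h.sublist (by
      apply List.Sublist.cons_cons
      exact ((List.Sublist.refl _).cons _).cons _))
    simp only [List.nodup_cons, List.mem_cons, not_or] at h
    obtain ⟨u, hu⟩ := Option.ne_none_iff_exists'.1 (Ne.symm h.1.1)
    obtain ⟨v, hv⟩ := Option.ne_none_iff_exists'.1 (Ne.symm h.1.2.1)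
    exact ⟨(u, v) :: L, List.Forall₂.cons ⟨hu, hv⟩ hL⟩

/-- Any matching of edges held in registers is held by a sublist of these registers. -/
theorem Mem.exists_sublist_holds (m : Mem 16 n) (J : List EdgeRegs) :
    ∀ B : Finset (Sym2 (Fin n)), IsMatching B → Loopless B →
      (∀ g ∈ B, ∃ t ∈ J, ∃ u v, m.vreg t.1 = some u ∧ m.vreg t.2.1 = some v ∧ g = s(u, v)) →
      ∃ I L, I.Sublist J ∧ m.Holds I L ∧ (ends L).Nodup ∧ edgesOf L = B := by
  induction J with
  | nil =>
    intro B _ _ h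
    refine ⟨[], [], List.Sublist.refl _, List.Forall₂.nil, List.nodup_nil, ?_⟩
    symm
    refine Finset.eq_empty_iff_forall_notMem.2 ?_
    intro g hg
    obtain ⟨t, ht, _⟩ := h g hg
    exact absurd ht List.not_mem_nil
  | cons t J ih =>
    intro B hB hlB h
    by_cases ht : ∃ u v, m.vreg t.1 = some u ∧ m.vreg t.2.1 = some v ∧ s(u, v) ∈ B
    · obtain ⟨u, v, hu, hv, hm⟩ := ht
      -- Erasing the edge found ensures that it is not used again if two triples of registers hold
      -- the same edge, as happens when the two shadow edges coincide.
      have hsub : B.erase s(u, v) ⊆ B := Finset.erase_subset _ _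
      obtain ⟨I, L, h1, h2, h3, h4⟩ := ih (B.erase s(u, v)) (hB.mono hsub) (hlB.mono hsub) (by
        intro g hg
        obtain ⟨t', ht', u', v', hu', hv', rfl⟩ := h g (hsub hg)
        rcases List.mem_cons.1 ht' with rfl | ht'
        · rw [hu, Option.some_inj] at hu'
          rw [hv, Option.some_inj] at hv'
          rw [hu', hv'] at hg
          exact absurd rfl (Finset.ne_of_mem_erase hg)
        · exact ⟨t', ht', u', v', hu', hv', rfl⟩)
      refine ⟨t :: I, (u, v) :: L, h1.cons_cons _, List.Forall₂.cons ⟨hu, hv⟩ h2, ?_, ?_⟩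
      · have key : ∀ x ∈ s(u, v), x ∉ ends L := by
          intro x hx hxL
          obtain ⟨g, hg, hxg⟩ := mem_verts.1 (mem_verts_edgesOf.2 hxL)
          rw [h4] at hg
          exact Finset.ne_of_mem_erase hg (hB _ (hsub hg) _ hm x hxg hx)
        rw [ends_cons, List.nodup_cons, List.nodup_cons, List.mem_cons, not_or]
        exact ⟨⟨hlB.ne hm, key u (Sym2.mem_mk_left _ _)⟩, key v (Sym2.mem_mk_right _ _), h3⟩
      · rw [edgesOf_cons, h4, Finset.insert_erase hm]
    · obtain ⟨I, L, h1, h2, h3, h4⟩ := ih B hB hlB (by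
        intro g hg
        obtain ⟨t', ht', u', v', hu', hv', rfl⟩ := h g hg
        rcases List.mem_cons.1 ht' with rfl | ht'
        · exact absurd ⟨u', v', hu', hv', hg⟩ ht
        · exact ⟨t', ht', u', v', hu', hv', rfl⟩)
      exact ⟨I, L, h1.cons _, h2, h3, h4⟩

/-- The registers of the arriving edge and of the two shadow edges. -/
def vicinityRegs : List EdgeRegs := [(0, 1, 2), (3, 4, 3), (5, 6, 4)]

/-- The candidates are listed in the order of `vicinityRegs`, so this is a finite check of two
explicit lists. -/
theorem mem_candidates_iff {I : List EdgeRegs} :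
    I ∈ [] :: candidates ↔ I.Sublist vicinityRegs := by
  rw [← List.mem_sublists]
  have : vicinityRegs.sublists.Perm ([] :: candidates) := by decide
  exact this.mem_iff.symm

/-- The memory holds the matching of `c` with its weights, and the registers hold the arriving edge
and the shadow edges in its vicinity. -/
structure Mem.Loaded (m : Mem 16 n) (c : Config n) (w : Sym2 (Fin n) → ℝ) (e : Sym2 (Fin n)) :
    Prop where
  mate : m.varr 0 = partner c.M
  weight : ∀ v, MSM.mate c.M v ≠ v → m.warr 0 v = w s(v, MSM.mate c.M v)
  regs : ∀ t ∈ vicinityRegs, ∀ u v, m.vreg t.1 = some u → m.vreg t.2.1 = some v →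
    m.wreg t.2.2 = w s(u, v) ∧ s(u, v) ∈ c.vicinity e ∧ s(u, v) ∉ c.M
  exists_regs : ∀ g ∈ c.vicinity e, g ∉ c.M →
    ∃ t ∈ vicinityRegs, ∃ u v, m.vreg t.1 = some u ∧ m.vreg t.2.1 = some v ∧ g = s(u, v)

variable {c : Config n} {w : Sym2 (Fin n) → ℝ} {e : Sym2 (Fin n)} {E : Finset (Sym2 (Fin n))}

theorem Mem.Loaded.sum_eq {m : Mem 16 n} (h : m.Loaded c w e) {I : List EdgeRegs}
    (hI : ∀ t ∈ I, t ∈ vicinityRegs) {L : List (Fin n × Fin n)} (hL : m.Holds I L) :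
    I.map m.edgeVal = L.map (fun p => (some p.1, some p.2, w s(p.1, p.2))) ∧
      ∀ g ∈ edgesOf L, g ∈ c.vicinity e ∧ g ∉ c.M := by
  induction hL with
  | nil => simp [edgesOf]
  | @cons t p I L hp _ ih =>
    obtain ⟨h1, h2⟩ := ih fun t ht => hI t (List.mem_cons_of_mem _ ht)
    obtain ⟨g1, g2⟩ := h.regs t (hI t List.mem_cons_self) p.1 p.2 hp.1 hp.2
    refine ⟨?_, ?_⟩
    · rw [List.map_cons, List.map_cons, h1, Mem.edgeVal, hp.1, hp.2, g1]
    · intro g hg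
      rw [edgesOf_cons, Finset.mem_insert] at hg
      rcases hg with rfl | hg
      · exact g2
      · exact h2 g hg

theorem Mem.Loaded.gainVal_eq {m : Mem 16 n} (h : m.Loaded c w e) (hc : c.Valid E)
    {I : List EdgeRegs} (hI : I.Sublist vicinityRegs) {L : List (Fin n × Fin n)}
    (hL : m.Holds I L) (hn : (ends L).Nodup) : m.gainVal I = gain 1 w c.M (edgesOf L) := by
  have h1 := (h.sum_eq (fun t ht => hI.subset ht) hL).1
  have h2 : (I.map fun t => (m.edgeVal t).2.2) = L.map fun p => w s(p.1, p.2) := by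
    have := congrArg (List.map fun v => v.2.2) h1
    rwa [List.map_map, List.map_map] at this
  rw [Mem.gainVal, h2, hL.map_endRegs, h.mate, hitSum_eq hc.matching hc.loopless w h.weight hn, gain,
    sum_edgesOf w hn, one_add_one_eq_two]
  congr 2
  apply Finset.sum_congr _ fun _ _ => rfl
  ext g
  rw [mem_hit_iff_verts, Finset.mem_filter]
  simp only [mem_verts_edgesOf]

/-- An edge of `B ∩ M` hits itself, so it contributes `w - 2 w ≤ 0`, and no other edge of the
matching `B` hits it. This is why augmentations may be taken disjoint from `M`. -/
theorem gain_le_gain_sdiff {M B : Finset (Sym2 (Fin n))} (hB : IsMatching B)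
    (hw : ∀ g ∈ M, 0 ≤ w g) : gain 1 w M B ≤ gain 1 w M (B \ M) := by
  have h1 : ∑ b ∈ B ∩ M, w b + ∑ b ∈ B \ M, w b = ∑ b ∈ B, w b :=
    Finset.sum_inter_add_sum_sdiff _ _ _
  have hd : Disjoint (hit M (B \ M)) (B ∩ M) := by
    rw [Finset.disjoint_left]
    intro g hg hg'
    obtain ⟨-, b, hb, v, hv, hvg⟩ := mem_hit.1 hg
    rw [Finset.mem_sdiff] at hb
    rw [Finset.mem_inter] at hg'
    exact hb.2 (hB _ hb.1 _ hg'.1 v hv hvg ▸ hg'.2)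
  have hsub : hit M (B \ M) ∪ B ∩ M ⊆ hit M B := by
    intro g hg
    rw [mem_hit]
    rcases Finset.mem_union.1 hg with hg | hg
    · obtain ⟨h, b, hb, hh⟩ := mem_hit.1 hg
      exact ⟨h, b, Finset.sdiff_subset hb, hh⟩
    · rw [Finset.mem_inter] at hg
      induction g with
      | _ x y => exact ⟨hg.2, _, hg.1, x, Sym2.mem_mk_left _ _, Sym2.mem_mk_left _ _⟩
  have h2 : ∑ g ∈ hit M (B \ M) ∪ B ∩ M, w g ≤ ∑ g ∈ hit M B, w g :=
    Finset.sum_le_sum_of_subset_of_nonneg hsub fun g hg _ => hw g (hit_subset hg)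
  rw [Finset.sum_union hd] at h2
  have h3 : 0 ≤ ∑ g ∈ B ∩ M, w g :=
    Finset.sum_nonneg fun g hg => hw g (Finset.mem_of_mem_inter_right hg)
  rw [gain, gain]
  linarith

/-- The best list of candidates describes an augmentation of maximum gain. -/
theorem Mem.Loaded.isMaxGain {m₀ m : Mem 16 n} (h : m₀.Loaded c w e) (hc : c.Valid E)
    (he : ¬ e.IsDiag) (hw : ∀ g ∈ c.M, 0 ≤ w g) (hm : m₀.BestOf candidates m) :
    ∃ L : List (Fin n × Fin n), (ends L).Nodup ∧
      IsMaxGain w c.M (c.vicinity e) (edgesOf L) ∧ Disjoint (edgesOf L) c.M ∧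
      (edgesOf L = ∅ ∨ 0 < gain 1 w c.M (edgesOf L)) ∧
      bestRegs.map m.edgeVal = L.map (fun p => (some p.1, some p.2, w s(p.1, p.2))) ++
        List.replicate (3 - L.length) (none, none, 0) := by
  obtain ⟨I, hI, h1, h2, h3, h4⟩ := hm.best
  have hI' := mem_candidates_iff.1 hI
  obtain ⟨L, hL⟩ := h1.exists_holds
  have hn := hL.proper_iff.1 h1
  obtain ⟨e1, e2⟩ := h.sum_eq (fun t ht => hI'.subset ht) hL
  have hlen : I.length = L.length := hL.length_eq
  refine ⟨L, hn, ⟨fun g hg => (e2 g hg).1, isMatching_edgesOf hn, ?_⟩, ?_, ?_, ?_⟩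
  · intro B hBT hB
    -- After the edges of `M` are discarded, what remains of `B` consists of edges held in the three
    -- triples of registers.
    refine (gain_le_gain_sdiff hB hw).trans ?_
    have hsub : B \ c.M ⊆ B := Finset.sdiff_subset
    obtain ⟨J, K, g1, g2, g3, g4⟩ := m₀.exists_sublist_holds vicinityRegs (B \ c.M) (hB.mono hsub)
      (((c.vicinity_loopless hc he).mono hBT).mono hsub) (by
        intro g hg
        rw [Finset.mem_sdiff] at hg
        exact h.exists_regs g (hBT hg.1) hg.2)
    rw [← g4, ← h.gainVal_eq hc g1 g2 g3, ← h.gainVal_eq hc hI' hL hn, ← h2]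
    exact hm.max J (mem_candidates_iff.2 g1) (g2.proper_iff.2 g3)
  · rw [Finset.disjoint_left]
    exact fun g hg => (e2 g hg).2
  · rw [← h.gainVal_eq hc hI' hL hn]
    refine h3.imp_left ?_
    rintro rfl
    cases hL
    rfl
  · rw [h4, e1, hlen]

end Gain

/-! ### Carrying out the augmentation -/

section Apply

variable {n : ℕ}

/-- The vertex registers below `a`, the weight registers below `b` and the edge sets other than `0`
and `1` agree. -/
structure Mem.Frame (a b : Fin 16) (m m' : Mem 16 n) : Prop where
  vreg : ∀ r, r < a → m'.vreg r = m.vreg r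
  wreg : ∀ x, x < b → m'.wreg x = m.wreg x
  eset : ∀ q, q ≠ 0 → q ≠ 1 → m'.eset q = m.eset q

theorem Mem.Frame.refl (a b : Fin 16) (m : Mem 16 n) : m.Frame a b m :=
  ⟨fun _ _ => rfl, fun _ _ => rfl, fun _ _ _ => rfl⟩

theorem Mem.Frame.trans {a b : Fin 16} {m₁ m₂ m₃ : Mem 16 n} (h : m₁.Frame a b m₂)
    (h' : m₂.Frame a b m₃) : m₁.Frame a b m₃ :=
  ⟨fun r hr => (h'.vreg r hr).trans (h.vreg r hr), fun x hx => (h'.wreg x hx).trans (h.wreg x hx),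
    fun q h0 h1 => (h'.eset q h0 h1).trans (h.eset q h0 h1)⟩

theorem Mem.Frame.mono {a b a' b' : Fin 16} {m m' : Mem 16 n} (h : m.Frame a b m') (ha : a' ≤ a)
    (hb : b' ≤ b) : m.Frame a' b' m' :=
  ⟨fun r hr => h.vreg r (lt_of_lt_of_le hr ha), fun x hx => h.wreg x (lt_of_lt_of_le hx hb), h.eset⟩

theorem Mem.Agree.frame {a b : Fin 16} {m m' : Mem 16 n} (h : m.Agree a b m') : m.Frame a b m' :=
  ⟨h.vreg, h.wreg, fun q _ _ => by rw [h.eset]⟩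

open Classical in
/-- The edges at the vertices `v` with other end `sh v`. -/
noncomputable def arrayEdges (sh : Fin n → Option (Fin n)) : Finset (Sym2 (Fin n)) :=
  Finset.univ.filter fun s => ∃ v a, sh v = some a ∧ s = s(v, a)

theorem mem_arrayEdges {sh : Fin n → Option (Fin n)} {s : Sym2 (Fin n)} :
    s ∈ arrayEdges sh ↔ ∃ v a, sh v = some a ∧ s = s(v, a) := by
  simp [arrayEdges]

/-- Forget the shadow edge at the vertex in register `r`. -/
def dropCmd (r : Fin 16) : Cmd 16 :=
  .seq (.vload 14 1 r) (.seq (.vload 15 1 14) (.seq (.ifEq 15 r .skip (.erase 1 r 14))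
    (.vstore 1 r 2)))

/-- Edge set `1` consists of the edges in edge set `0` and the shadow edges, and these two are
disjoint. -/
structure Mem.Shadowed (m : Mem 16 n) : Prop where
  nul : m.vreg 2 = none
  ne : ∀ v a, m.varr 1 v = some a → v ≠ a
  notMem : ∀ v a, m.varr 1 v = some a → s(v, a) ∉ m.eset 0
  eset : m.eset 1 = m.eset 0 ∪ arrayEdges (m.varr 1)

theorem arrayEdges_update_of_eq {sh : Fin n → Option (Fin n)} {x a : Fin n} (hxa : x ≠ a)
    (hx : sh x = some a) (ha : sh a = some x) :
    arrayEdges (Function.update sh x none) = arrayEdges sh := by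
  ext s
  rw [mem_arrayEdges, mem_arrayEdges]
  constructor
  · rintro ⟨v, b, hv, rfl⟩
    by_cases hvx : v = x
    · rw [hvx, Function.update_self] at hv
      cases hv
    · rw [Function.update_of_ne hvx] at hv
      exact ⟨v, b, hv, rfl⟩
  · rintro ⟨v, b, hv, rfl⟩
    by_cases hvx : v = x
    · rw [hvx, hx, Option.some_inj] at hv
      refine ⟨a, x, ?_, ?_⟩
      · rwa [Function.update_of_ne hxa.symm]
      · rw [hvx, ← hv, Sym2.eq_swap]
    · exact ⟨v, b, by rwa [Function.update_of_ne hvx], rfl⟩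

/-- An edge may be the shadow edge at both of its ends. It disappears only if the entry at the other
end does not point back; this decides whether `dropCmd` erases it. -/
theorem arrayEdges_update_of_ne {sh : Fin n → Option (Fin n)} {x a : Fin n}
    (hx : sh x = some a) (ha : sh a ≠ some x) :
    arrayEdges (Function.update sh x none) = arrayEdges sh \ {s(x, a)} := by
  ext s
  rw [Finset.mem_sdiff, Finset.mem_singleton, mem_arrayEdges, mem_arrayEdges]
  constructor
  · rintro ⟨v, b, hv, rfl⟩
    by_cases hvx : v = x
    · rw [hvx, Function.update_self] at hv
      cases hv
    · rw [Function.update_of_ne hvx] at hv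
      refine ⟨⟨v, b, hv, rfl⟩, fun h => ?_⟩
      rcases Sym2.eq_iff.1 h with ⟨h1, -⟩ | ⟨rfl, rfl⟩
      · exact hvx h1
      · exact ha hv
  · rintro ⟨⟨v, b, hv, rfl⟩, h⟩
    by_cases hvx : v = x
    · rw [hvx, hx, Option.some_inj] at hv
      rw [hvx, hv] at h
      exact absurd rfl h
    · exact ⟨v, b, by rwa [Function.update_of_ne hvx], rfl⟩

theorem Mem.Shadowed.update {m m' : Mem 16 n} (hm : m.Shadowed) {x : Fin n}
    (h0 : m'.vreg 2 = none) (h1 : m'.varr 1 = Function.update (m.varr 1) x none)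
    (h2 : m'.eset 0 = m.eset 0)
    (h3 : m'.eset 1 = m'.eset 0 ∪ arrayEdges (m'.varr 1)) : m'.Shadowed := by
  have key : ∀ v a, m'.varr 1 v = some a → m.varr 1 v = some a := by
    intro v a h
    rw [h1] at h
    by_cases hvx : v = x
    · rw [hvx, Function.update_self] at h
      cases h
    · rwa [Function.update_of_ne hvx] at h
  exact ⟨h0, fun v a h => hm.ne v a (key v a h), fun v a h => h2 ▸ hm.notMem v a (key v a h), h3⟩

/-- Erasing a shadow edge from edge set `1` does no harm to the matching stored there, since shadow
edges are not in edge set `0`. -/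
theorem sem_dropCmd (f : Finset (Sym2 (Fin n)) → ℝ) {m : Mem 16 n} (hm : m.Shadowed) {r : Fin 16}
    (hr : r < 14) :
    m.Frame 14 9 ((dropCmd r).sem f m) ∧ ((dropCmd r).sem f m).varr 0 = m.varr 0 ∧
      ((dropCmd r).sem f m).warr = m.warr ∧ ((dropCmd r).sem f m).eset 0 = m.eset 0 ∧
      (∀ v, ((dropCmd r).sem f m).varr 1 v = if m.vreg r = some v then none else m.varr 1 v) ∧
      ((dropCmd r).sem f m).Shadowed := by
  have r14 : r ≠ 14 := ne_of_lt hr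
  have r15 : r ≠ 15 := ne_of_lt (hr.trans (by decide))
  have hn := hm.nul
  have hF : ∀ y z, ∀ s, s < (14 : Fin 16) → Function.update (Function.update m.vreg 14 y) 15 z s =
      m.vreg s := by
    intro y z s hs
    rw [Function.update_of_ne (ne_of_lt (hs.trans (by decide))), Function.update_of_ne (ne_of_lt hs)]
  cases hx : m.vreg r with
  | none =>
    have e : (dropCmd r).sem f m =
        { m with vreg := Function.update (Function.update m.vreg 14 none) 15 none } := by
      simp [dropCmd, Cmd.sem, hx, r14, r15]
    rw [e]
    refine ⟨⟨hF _ _, fun _ _ => rfl, fun _ _ _ => rfl⟩, rfl, rfl, rfl, by simp, ?_⟩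
    exact ⟨by simpa using hn, hm.ne, hm.notMem, hm.eset⟩
  | some x =>
    cases ha : m.varr 1 x with
    | none =>
      have hu : Function.update (m.varr 1) x none = m.varr 1 := by
        rw [← ha, Function.update_eq_self]
      have e : (dropCmd r).sem f m =
          { m with vreg := Function.update (Function.update m.vreg 14 none) 15 none } := by
        simp [dropCmd, Cmd.sem, hx, r14, r15, ha, Mem.edgeOf, hn, hu]
      rw [e]
      refine ⟨⟨hF _ _, fun _ _ => rfl, fun _ _ _ => rfl⟩, rfl, rfl, rfl, ?_, ?_⟩
      · intro v
        split_ifs with h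
        · rw [Option.some_inj] at h
          rw [← h, ha]
        · rfl
      · exact ⟨by simpa using hn, hm.ne, hm.notMem, hm.eset⟩
    | some a =>
      have hup : ∀ v, Function.update (m.varr 1) x none v =
          if some x = some v then none else m.varr 1 v := by
        intro v
        rw [Function.update_apply]
        simp only [Option.some_inj, eq_comm]
      by_cases hb : m.varr 1 a = some x
      · have e : (dropCmd r).sem f m =
            { m with
              vreg := Function.update (Function.update m.vreg 14 (some a)) 15 (some x)
              varr := Function.update m.varr 1 (Function.update (m.varr 1) x none) } := by
          simp [dropCmd, Cmd.sem, hx, r14, r15, ha, hb, hn]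
        rw [e]
        refine ⟨⟨hF _ _, fun _ _ => rfl, fun _ _ _ => rfl⟩, by simp,
          rfl, rfl, ?_, ?_⟩
        · intro v
          rw [← hup v]
          simp only [Function.update_self]
        · refine hm.update (x := x) (by simpa using hn) (by simp)
            rfl ?_
          simp only [Function.update_self]
          rw [arrayEdges_update_of_eq (hm.ne x a ha) ha hb]
          exact hm.eset
      · have e : (dropCmd r).sem f m =
            { m with
              vreg := Function.update (Function.update m.vreg 14 (some a)) 15 (m.varr 1 a)
              varr := Function.update m.varr 1 (Function.update (m.varr 1) x none)
              eset := Function.update m.eset 1 (m.eset 1 \ {s(x, a)}) } := by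
          simp [dropCmd, Cmd.sem, hx, r14, r15, ha, hb, hn, Mem.edgeOf]
        rw [e]
        refine ⟨⟨hF _ _, fun _ _ => rfl, fun q _ hq => Function.update_of_ne hq _ _⟩,
          by simp,
          rfl, by simp, ?_, ?_⟩
        · intro v
          rw [← hup v]
          simp only [Function.update_self]
        · refine hm.update (x := x) (by simpa using hn) (by simp)
            (by simp) ?_
          simp only [Function.update_self]
          rw [Function.update_of_ne (by decide), arrayEdges_update_of_ne ha hb, hm.eset,
            Finset.union_sdiff_distrib, Finset.sdiff_singleton_eq_erase,
            Finset.erase_eq_of_notMem (hm.notMem x a ha)]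

/-- Forget the shadow edges at the vertices in the registers `R` and at their partners. -/
def dropCmds (R : List (Fin 16)) : Cmd 16 :=
  .seqs (R.map fun r => .seq (dropCmd r) (.seq (.vload 13 0 r) (dropCmd 13)))

theorem sem_dropCmds (f : Finset (Sym2 (Fin n)) → ℝ) (R : List (Fin 16)) (hR : ∀ r ∈ R, r < 13) :
    ∀ {m : Mem 16 n}, m.Shadowed →
    m.Frame 13 9 ((dropCmds R).sem f m) ∧ ((dropCmds R).sem f m).varr 0 = m.varr 0 ∧
      ((dropCmds R).sem f m).warr = m.warr ∧ ((dropCmds R).sem f m).eset 0 = m.eset 0 ∧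
      (∀ v, ((dropCmds R).sem f m).varr 1 v =
        if ∃ r ∈ R, m.vreg r = some v ∨ (m.vreg r).bind (m.varr 0) = some v then none
        else m.varr 1 v) ∧ ((dropCmds R).sem f m).Shadowed := by
  induction R with
  | nil =>
    intro m hm
    refine ⟨Mem.Frame.refl _ _ _, rfl, rfl, rfl, ?_, hm⟩
    simp [dropCmds, Cmd.seqs, Cmd.sem]
  | cons r R ih =>
    intro m hm
    have hr := hR r List.mem_cons_self
    obtain ⟨a1, a2, a3, a4, a5, a6⟩ := sem_dropCmd f hm (hr.trans (by decide : (13 : Fin 16) < 14))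
    set m₁ := (dropCmd r).sem f m
    set m₂ : Mem 16 n :=
      { m₁ with vreg := Function.update m₁.vreg 13 ((m₁.vreg r).bind (m₁.varr 0)) } with hm₂
    have h2 : m₁.Agree 13 9 m₂ := m₁.agree_vreg le_rfl _
    have hm2 : m₂.Shadowed := ⟨(h2.vreg 2 (by decide)).trans a6.nul, a6.ne, a6.notMem, a6.eset⟩
    have e13 : m₂.vreg 13 = (m.vreg r).bind (m.varr 0) := by
      have : m₂.vreg 13 = (m₁.vreg r).bind (m₁.varr 0) := by simp [hm₂]
      rw [this, a1.vreg r (hr.trans (by decide)), a2]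
    obtain ⟨b1, b2, b3, b4, b5, b6⟩ := sem_dropCmd f hm2 (by decide : (13 : Fin 16) < 14)
    set m₃ := (dropCmd 13).sem f m₂
    have hF : m.Frame 13 9 m₃ :=
      (a1.mono (by decide) le_rfl).trans (h2.frame.trans (b1.mono (by decide) le_rfl))
    obtain ⟨c1, c2, c3, c4, c5, c6⟩ := ih (fun s hs => hR s (List.mem_cons_of_mem _ hs)) b6
    have e : (dropCmds (r :: R)).sem f m = (dropCmds R).sem f m₃ := rfl
    have b2' : m₃.varr 0 = m.varr 0 := b2.trans a2
    rw [e]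
    refine ⟨hF.trans c1, c2.trans b2', c3.trans (b3.trans a3), c4.trans (b4.trans a4), ?_, c6⟩
    intro v
    rw [c5 v, b5 v, e13, b2']
    have h3 : m₂.varr 1 v = if m.vreg r = some v then none else m.varr 1 v := a5 v
    have h4 : (∃ s ∈ R, m₃.vreg s = some v ∨ (m₃.vreg s).bind (m.varr 0) = some v) ↔
        ∃ s ∈ R, m.vreg s = some v ∨ (m.vreg s).bind (m.varr 0) = some v := by
      apply exists_congr
      intro s
      apply and_congr_right
      intro hs
      rw [hF.vreg s (hR s (List.mem_cons_of_mem _ hs))]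
    rw [h3]
    simp only [h4, List.mem_cons, exists_eq_or_imp]
    by_cases p1 : ∃ s ∈ R, m.vreg s = some v ∨ (m.vreg s).bind (m.varr 0) = some v <;>
    by_cases p2 : m.vreg r = some v <;> by_cases p3 : (m.vreg r).bind (m.varr 0) = some v <;>
    simp [p1, p2, p3]

/-- Let the edge at the vertex in register `r` become the shadow edge at this vertex. -/
def saveCmd (r : Fin 16) : Cmd 16 :=
  .seq (.vload 13 0 r) (.seq (.vstore 1 r 13) (.seq (.wload 10 0 r) (.wstore 1 r 10)))

theorem sem_saveCmd (f : Finset (Sym2 (Fin n)) → ℝ) (m : Mem 16 n) {r : Fin 16} (hr : r < 13) :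
    m.Frame 13 9 ((saveCmd r).sem f m) ∧ ((saveCmd r).sem f m).varr 0 = m.varr 0 ∧
      ((saveCmd r).sem f m).warr 0 = m.warr 0 ∧ ((saveCmd r).sem f m).eset = m.eset ∧
      (∀ v, ((saveCmd r).sem f m).varr 1 v = if m.vreg r = some v then m.varr 0 v else m.varr 1 v) ∧
      ∀ v, ((saveCmd r).sem f m).warr 1 v = if m.vreg r = some v then m.warr 0 v else m.warr 1 v := by
  have r13 : r ≠ 13 := ne_of_lt hr
  have hF : ∀ y, ∀ s, s < (13 : Fin 16) → Function.update m.vreg 13 y s = m.vreg s :=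
    fun y s hs => Function.update_of_ne (ne_of_lt hs) _ _
  have hG : ∀ y, ∀ s, s < (9 : Fin 16) → Function.update m.wreg 10 y s = m.wreg s :=
    fun y s hs => Function.update_of_ne (ne_of_lt (hs.trans (by decide))) _ _
  cases hx : m.vreg r with
  | none =>
    have e : (saveCmd r).sem f m =
        { m with vreg := Function.update m.vreg 13 none, wreg := Function.update m.wreg 10 0 } := by
      simp [saveCmd, Cmd.sem, hx, r13]
    rw [e]
    exact ⟨⟨hF _, hG _, fun _ _ _ => rfl⟩, rfl, rfl, rfl, by simp, by simp⟩
  | some x =>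
    have e : (saveCmd r).sem f m =
        { m with
          vreg := Function.update m.vreg 13 (m.varr 0 x)
          wreg := Function.update m.wreg 10 (m.warr 0 x)
          varr := Function.update m.varr 1 (Function.update (m.varr 1) x (m.varr 0 x))
          warr := Function.update m.warr 1 (Function.update (m.warr 1) x (m.warr 0 x)) } := by
      simp [saveCmd, Cmd.sem, hx, r13]
    rw [e]
    refine ⟨⟨hF _, hG _, fun _ _ _ => rfl⟩, by simp,
      by simp, rfl, fun v => ?_, fun v => ?_⟩
    · simp only [Function.update_self, Option.some_inj]
      by_cases h : x = v
      · rw [if_pos h, h, Function.update_self]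
      · rw [if_neg h, Function.update_of_ne (Ne.symm h)]
    · simp only [Function.update_self, Option.some_inj]
      by_cases h : x = v
      · rw [if_pos h, h, Function.update_self]
      · rw [if_neg h, Function.update_of_ne (Ne.symm h)]

theorem sem_saveCmds (f : Finset (Sym2 (Fin n)) → ℝ) (R : List (Fin 16)) (hR : ∀ r ∈ R, r < 13) :
    ∀ m : Mem 16 n,
    m.Frame 13 9 ((Cmd.seqs (R.map saveCmd)).sem f m) ∧
      ((Cmd.seqs (R.map saveCmd)).sem f m).varr 0 = m.varr 0 ∧
      ((Cmd.seqs (R.map saveCmd)).sem f m).warr 0 = m.warr 0 ∧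
      ((Cmd.seqs (R.map saveCmd)).sem f m).eset = m.eset ∧
      (∀ v, ((Cmd.seqs (R.map saveCmd)).sem f m).varr 1 v =
        if some v ∈ R.map m.vreg then m.varr 0 v else m.varr 1 v) ∧
      ∀ v, ((Cmd.seqs (R.map saveCmd)).sem f m).warr 1 v =
        if some v ∈ R.map m.vreg then m.warr 0 v else m.warr 1 v := by
  induction R with
  | nil =>
    intro m
    exact ⟨Mem.Frame.refl _ _ _, rfl, rfl, rfl, by simp [Cmd.seqs, Cmd.sem],
      by simp [Cmd.seqs, Cmd.sem]⟩
  | cons r R ih =>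
    intro m
    obtain ⟨a1, a2, a3, a4, a5, a6⟩ := sem_saveCmd f m (hR r List.mem_cons_self)
    set m₁ := (saveCmd r).sem f m
    obtain ⟨c1, c2, c3, c4, c5, c6⟩ := ih (fun s hs => hR s (List.mem_cons_of_mem _ hs)) m₁
    have e : (Cmd.seqs ((r :: R).map saveCmd)).sem f m = (Cmd.seqs (R.map saveCmd)).sem f m₁ := rfl
    have h4 : R.map m₁.vreg = R.map m.vreg :=
      List.map_congr_left fun s hs => a1.vreg s (hR s (List.mem_cons_of_mem _ hs))
    rw [e]
    refine ⟨a1.trans c1, c2.trans a2, c3.trans a3, c4.trans a4, fun v => ?_, fun v => ?_⟩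
    · have hcomm : some v = m.vreg r ↔ m.vreg r = some v := eq_comm
      rw [c5 v, a5 v, h4, a2]
      simp only [List.map_cons, List.mem_cons, hcomm]
      by_cases p1 : some v ∈ R.map m.vreg <;> by_cases p2 : m.vreg r = some v <;>
      simp [p1, p2]
    · have hcomm : some v = m.vreg r ↔ m.vreg r = some v := eq_comm
      rw [c6 v, a6 v, h4, a3]
      simp only [List.map_cons, List.mem_cons, hcomm]
      by_cases p1 : some v ∈ R.map m.vreg <;> by_cases p2 : m.vreg r = some v <;>
      simp [p1, p2]

end Apply

/-! ### Updating the matching -/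

section Apply

variable {n : ℕ}

theorem partner_eq_some {M : Finset (Sym2 (Fin n))} {v a : Fin n} :
    partner M v = some a ↔ mate M v ≠ v ∧ mate M v = a := by
  unfold partner
  split_ifs with h <;> simp [h]

theorem partner_eq_none {M : Finset (Sym2 (Fin n))} {v : Fin n} :
    partner M v = none ↔ mate M v = v := by
  unfold partner
  split_ifs with h <;> simp [h]

/-- Edge set `0` is the matching `M`, whose partners and weights are recorded in the arrays. -/
structure Mem.HoldsMatching (m : Mem 16 n) (M : Finset (Sym2 (Fin n))) (w : Sym2 (Fin n) → ℝ) :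
    Prop where
  matching : IsMatching M
  loopless : Loopless M
  eset : m.eset 0 = M
  mate : m.varr 0 = partner M
  weight : ∀ v, MSM.mate M v ≠ v → m.warr 0 v = w s(v, MSM.mate M v)

theorem mate_filter {M : Finset (Sym2 (Fin n))} (hM : IsMatching M) (hl : Loopless M) (x v : Fin n) :
    mate (M.filter fun g => x ∉ g) v = if v = x ∨ v = mate M x then v else mate M v := by
  split_ifs with h
  · apply mate_eq_self
    intro g hg hv
    rw [Finset.mem_filter] at hg
    rcases h with rfl | rfl
    · exact hg.2 hv
    · apply hg.2
      rw [(mate_ne hM hl hg.1 hv).2, mate_mate hM]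
      exact Sym2.mem_mk_right _ _
  · rw [not_or] at h
    by_cases hv : mate M v = v
    · rw [hv]
      exact mate_eq_self fun g hg hvg => (mate_ne hM hl (Finset.mem_filter.1 hg).1 hvg).1 hv
    · apply mate_eq (hM.mono (Finset.filter_subset _ _))
      rw [Finset.mem_filter]
      refine ⟨mate_mem hv, fun hx => ?_⟩
      rcases Sym2.mem_iff.1 hx with rfl | rfl
      · exact h.1 rfl
      · exact h.2 (mate_mate hM v).symm

/-- Remove the edge at the vertex in register `r` from the matching. -/
def unmatchCmd (r : Fin 16) : Cmd 16 :=
  .seq (.vload 13 0 r) (.seq (.erase 0 r 13) (.seq (.vstore 0 13 2) (.vstore 0 r 2)))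

theorem sem_unmatchCmd (f : Finset (Sym2 (Fin n)) → ℝ) {m : Mem 16 n} {M : Finset (Sym2 (Fin n))}
    {w : Sym2 (Fin n) → ℝ} (hm : m.HoldsMatching M w) (hn : m.vreg 2 = none) {r : Fin 16}
    (hr : r < 13) :
    m.Frame 13 9 ((unmatchCmd r).sem f m) ∧ ((unmatchCmd r).sem f m).varr 1 = m.varr 1 ∧
      ((unmatchCmd r).sem f m).warr = m.warr ∧ ((unmatchCmd r).sem f m).eset 1 = m.eset 1 ∧
      ((unmatchCmd r).sem f m).HoldsMatching
        (M.filter fun g => ∀ v, m.vreg r = some v → v ∉ g) w := by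
  have r13 : r ≠ 13 := ne_of_lt hr
  have hF : ∀ y, ∀ s, s < (13 : Fin 16) → Function.update m.vreg 13 y s = m.vreg s :=
    fun y s hs => Function.update_of_ne (ne_of_lt hs) _ _
  have hM := hm.matching
  have hl := hm.loopless
  have hp := hm.mate
  cases hx : m.vreg r with
  | none =>
    have e : (unmatchCmd r).sem f m = { m with vreg := Function.update m.vreg 13 none } := by
      simp [unmatchCmd, Cmd.sem, hx, r13, Mem.edgeOf]
    have e' : (M.filter fun g => ∀ v, (none : Option (Fin n)) = some v → v ∉ g) = M := by simp
    rw [e, e']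
    exact ⟨⟨hF _, fun _ _ => rfl, fun _ _ _ => rfl⟩, rfl, rfl, rfl,
      ⟨hM, hl, hm.eset, hm.mate, hm.weight⟩⟩
  | some x =>
    have e' : (M.filter fun g => ∀ v, some x = some v → v ∉ g) = M.filter fun g => x ∉ g := by
      simp
    rw [e']
    have hsub : (M.filter fun g => x ∉ g) ⊆ M := Finset.filter_subset _ _
    have hw : ∀ v, mate (M.filter fun g => x ∉ g) v ≠ v →
        m.warr 0 v = w s(v, mate (M.filter fun g => x ∉ g) v) := by
      intro v hv
      rw [mate_filter hM hl] at hv ⊢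
      split_ifs at hv ⊢ with h
      · exact absurd rfl hv
      · exact hm.weight v hv
    by_cases hxx : mate M x = x
    · have hpx : partner M x = none := partner_eq_none.2 hxx
      have e : (unmatchCmd r).sem f m = { m with vreg := Function.update m.vreg 13 none } := by
        have : Function.update (partner M) x none = partner M := by
          rw [← hpx, Function.update_eq_self]
        have h2 : Function.update m.varr 0 (partner M) = m.varr := by
          rw [← hp, Function.update_eq_self]
        simp [unmatchCmd, Cmd.sem, hx, r13, Mem.edgeOf, hp, hpx, hn, this, h2]
      have hf : (M.filter fun g => x ∉ g) = M :=
        Finset.filter_true_of_mem fun g hg hxg => (mate_ne hM hl hg hxg).1 hxx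
      rw [e, hf]
      exact ⟨⟨hF _, fun _ _ => rfl, fun _ _ _ => rfl⟩, rfl, rfl, rfl,
        ⟨hM, hl, hm.eset, hm.mate, hm.weight⟩⟩
    · have hpx : partner M x = some (mate M x) := partner_eq_some.2 ⟨hxx, rfl⟩
      have e : (unmatchCmd r).sem f m =
          { m with
            vreg := Function.update m.vreg 13 (some (mate M x))
            varr := Function.update m.varr 0
              (Function.update (Function.update (partner M) (mate M x) none) x none)
            eset := Function.update m.eset 0 (M \ {s(x, mate M x)}) } := by
        simp [unmatchCmd, Cmd.sem, hx, r13, Mem.edgeOf, hp, hpx, hn, hm.eset]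
      rw [e]
      refine ⟨⟨hF _, fun _ _ => rfl, fun q hq _ => by simp [hq]⟩, by simp, rfl, by simp,
        ⟨hM.mono hsub, hl.mono hsub, ?_, ?_, hw⟩⟩
      · simp only [Function.update_self]
        ext g
        rw [Finset.mem_sdiff, Finset.mem_filter, Finset.mem_singleton]
        apply and_congr_right
        intro hg
        apply not_congr
        constructor
        · rintro rfl
          exact Sym2.mem_mk_left _ _
        · exact fun hxg => (mate_ne hM hl hg hxg).2
      · simp only [Function.update_self]
        funext v
        rw [partner, mate_filter hM hl]
        by_cases h1 : v = x
        · subst h1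
          simp
        · by_cases h2 : v = mate M x
          · rw [Function.update_of_ne h1, h2]
            simp
          · rw [Function.update_of_ne h1, Function.update_of_ne h2]
            simp [partner, h1, h2]

theorem sem_unmatchCmds (f : Finset (Sym2 (Fin n)) → ℝ) {w : Sym2 (Fin n) → ℝ} (R : List (Fin 16))
    (hR : ∀ r ∈ R, r < 13) :
    ∀ {m : Mem 16 n} {M : Finset (Sym2 (Fin n))}, m.HoldsMatching M w → m.vreg 2 = none →
    m.Frame 13 9 ((Cmd.seqs (R.map unmatchCmd)).sem f m) ∧
      ((Cmd.seqs (R.map unmatchCmd)).sem f m).varr 1 = m.varr 1 ∧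
      ((Cmd.seqs (R.map unmatchCmd)).sem f m).warr = m.warr ∧
      ((Cmd.seqs (R.map unmatchCmd)).sem f m).eset 1 = m.eset 1 ∧
      ((Cmd.seqs (R.map unmatchCmd)).sem f m).HoldsMatching
        (M.filter fun g => ∀ v, some v ∈ R.map m.vreg → v ∉ g) w := by
  induction R with
  | nil =>
    intro m M hm hn
    have e' : (M.filter fun g => ∀ v, some v ∈ ([] : List (Fin 16)).map m.vreg → v ∉ g) = M := by
      simp
    rw [e']
    exact ⟨Mem.Frame.refl _ _ _, rfl, rfl, rfl, hm⟩
  | cons r R ih =>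
    intro m M hm hn
    obtain ⟨a1, a2, a3, a4, a5⟩ := sem_unmatchCmd f hm hn (hR r List.mem_cons_self)
    set m₁ := (unmatchCmd r).sem f m
    obtain ⟨c1, c2, c3, c4, c5⟩ := ih (fun s hs => hR s (List.mem_cons_of_mem _ hs)) a5
      ((a1.vreg 2 (by decide)).trans hn)
    have e : (Cmd.seqs ((r :: R).map unmatchCmd)).sem f m =
      (Cmd.seqs (R.map unmatchCmd)).sem f m₁ := rfl
    have h4 : R.map m₁.vreg = R.map m.vreg :=
      List.map_congr_left fun s hs => a1.vreg s (hR s (List.mem_cons_of_mem _ hs))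
    have h5 : (M.filter fun g => ∀ v, some v ∈ (r :: R).map m.vreg → v ∉ g) =
        (M.filter fun g => ∀ v, m.vreg r = some v → v ∉ g).filter
          fun g => ∀ v, some v ∈ R.map m₁.vreg → v ∉ g := by
      rw [Finset.filter_filter, h4]
      apply Finset.filter_congr
      intro g _
      have hcomm : ∀ v, some v = m.vreg r ↔ m.vreg r = some v := fun v => eq_comm
      simp only [List.map_cons, List.mem_cons, hcomm, or_imp, forall_and]
    rw [e, h5]
    exact ⟨a1.trans c1, c2.trans a2, c3.trans a3, c4.trans a4, c5⟩

/-- Add the edge in the registers `t` to the matching. -/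
def addCmd (t : EdgeRegs) : Cmd 16 :=
  .seq (.vstore 0 t.1 t.2.1) (.seq (.vstore 0 t.2.1 t.1) (.seq (.wstore 0 t.1 t.2.2)
    (.seq (.wstore 0 t.2.1 t.2.2) (.seq (.insert 0 t.1 t.2.1) (.insert 1 t.1 t.2.1)))))

theorem sem_addCmd_none (f : Finset (Sym2 (Fin n)) → ℝ) (m : Mem 16 n) {t : EdgeRegs}
    (ht : m.edgeVal t = (none, none, 0)) : (addCmd t).sem f m = m := by
  simp only [Mem.edgeVal, Prod.mk.injEq] at ht
  simp [addCmd, Cmd.sem, ht.1, ht.2.1, Mem.edgeOf]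

theorem isMatching_insert {M : Finset (Sym2 (Fin n))} (hM : IsMatching M) (hl : Loopless M)
    {p q : Fin n} (hp : mate M p = p) (hq : mate M q = q) : IsMatching (insert s(p, q) M) := by
  have key : ∀ g ∈ M, ∀ v, v ∈ s(p, q) → v ∉ g := by
    intro g hg v hv hvg
    rcases Sym2.mem_iff.1 hv with rfl | rfl
    · exact (mate_ne hM hl hg hvg).1 hp
    · exact (mate_ne hM hl hg hvg).1 hq
  intro g hg g' hg' v hv hv'
  rw [Finset.mem_insert] at hg hg'
  rcases hg with rfl | hg <;> rcases hg' with rfl | hg'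
  · rfl
  · exact absurd hv' (key g' hg' v hv)
  · exact absurd hv (key g hg v hv')
  · exact hM g hg g' hg' v hv hv'

theorem mate_insert {M : Finset (Sym2 (Fin n))} (hM : IsMatching M) (hl : Loopless M)
    {p q : Fin n} (hp : mate M p = p) (hq : mate M q = q) (v : Fin n) :
    mate (insert s(p, q) M) v = if v = q then p else if v = p then q else mate M v := by
  have hI := isMatching_insert hM hl hp hq
  split_ifs with h1 h2
  · apply mate_eq hI
    rw [h1, Sym2.eq_swap]
    exact Finset.mem_insert_self _ _
  · apply mate_eq hI
    rw [h2]
    exact Finset.mem_insert_self _ _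
  · by_cases hv : mate M v = v
    · rw [hv]
      apply mate_eq_self
      intro g hg hvg
      rcases Finset.mem_insert.1 hg with rfl | hg
      · rcases Sym2.mem_iff.1 hvg with h | h
        · exact h2 h
        · exact h1 h
      · exact (mate_ne hM hl hg hvg).1 hv
    · exact mate_eq hI (Finset.mem_insert_of_mem (mate_mem hv))

theorem sem_addCmd (f : Finset (Sym2 (Fin n)) → ℝ) {m : Mem 16 n} {M : Finset (Sym2 (Fin n))}
    {w : Sym2 (Fin n) → ℝ} (hm : m.HoldsMatching M w) {t : EdgeRegs} {p q : Fin n}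
    (ht : m.edgeVal t = (some p, some q, w s(p, q))) (hpq : p ≠ q) (hp : mate M p = p)
    (hq : mate M q = q) :
    ((addCmd t).sem f m).vreg = m.vreg ∧ ((addCmd t).sem f m).wreg = m.wreg ∧
      (∀ i, i ≠ 0 → i ≠ 1 → ((addCmd t).sem f m).eset i = m.eset i) ∧
      ((addCmd t).sem f m).varr 1 = m.varr 1 ∧
      ((addCmd t).sem f m).warr 1 = m.warr 1 ∧
      ((addCmd t).sem f m).eset 1 = m.eset 1 ∪ {s(p, q)} ∧
      ((addCmd t).sem f m).HoldsMatching (insert s(p, q) M) w := by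
  simp only [Mem.edgeVal, Prod.mk.injEq] at ht
  obtain ⟨h1, h2, h3⟩ := ht
  have e : (addCmd t).sem f m =
      { m with
        varr := Function.update m.varr 0
          (Function.update (Function.update (partner M) p (some q)) q (some p))
        warr := Function.update m.warr 0
          (Function.update (Function.update (m.warr 0) p (w s(p, q))) q (w s(p, q)))
        eset := Function.update (Function.update m.eset 0 (M ∪ {s(p, q)})) 1
          (m.eset 1 ∪ {s(p, q)}) } := by
    simp [addCmd, Cmd.sem, h1, h2, h3, Mem.edgeOf, hm.mate, hm.eset]
  rw [e]
  refine ⟨rfl, rfl, fun i h0 h1 => by simp [h0, h1], by simp, by simp, by simp,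
    ⟨isMatching_insert hm.matching hm.loopless hp hq, ?_, ?_, ?_, ?_⟩⟩
  · intro g hg
    rcases Finset.mem_insert.1 hg with rfl | hg
    · rwa [Sym2.mk_isDiag_iff]
    · exact hm.loopless g hg
  · simp
  · simp only [Function.update_self]
    funext v
    rw [partner, mate_insert hm.matching hm.loopless hp hq]
    by_cases hvq : v = q
    · simp [hvq, hpq]
    · by_cases hvp : v = p
      · simp [hvp, hpq, hpq.symm]
      · simp [hvq, hvp, partner]
  · intro v hv
    rw [mate_insert hm.matching hm.loopless hp hq] at hv ⊢
    simp only [Function.update_self]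
    by_cases hvq : v = q
    · simp [hvq, Sym2.eq_swap]
    · by_cases hvp : v = p
      · simp [hvp, hpq]
      · simp only [hvq, hvp, if_false] at hv ⊢
        rw [Function.update_of_ne hvq, Function.update_of_ne hvp]
        exact hm.weight v hv

theorem sem_addCmds (f : Finset (Sym2 (Fin n)) → ℝ) {w : Sym2 (Fin n) → ℝ} (I : List EdgeRegs) :
    ∀ {m : Mem 16 n} {M : Finset (Sym2 (Fin n))} {L : List (Fin n × Fin n)} {j : ℕ},
    m.HoldsMatching M w → (ends L).Nodup → (∀ v ∈ ends L, mate M v = v) →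
    I.map m.edgeVal = L.map (fun p => (some p.1, some p.2, w s(p.1, p.2))) ++
      List.replicate j (none, none, 0) →
    ((Cmd.seqs (I.map addCmd)).sem f m).vreg = m.vreg ∧
      (∀ i, i ≠ 0 → i ≠ 1 → ((Cmd.seqs (I.map addCmd)).sem f m).eset i = m.eset i) ∧
      ((Cmd.seqs (I.map addCmd)).sem f m).varr 1 = m.varr 1 ∧
      ((Cmd.seqs (I.map addCmd)).sem f m).warr 1 = m.warr 1 ∧
      ((Cmd.seqs (I.map addCmd)).sem f m).eset 1 = m.eset 1 ∪ edgesOf L ∧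
      ((Cmd.seqs (I.map addCmd)).sem f m).HoldsMatching (M ∪ edgesOf L) w := by
  induction I with
  | nil =>
    intro m M L j hm _ _ he
    have hL : L = [] := by
      cases L with
      | nil => rfl
      | cons p L => simp at he
    subst hL
    simpa [edgesOf, Cmd.seqs, Cmd.sem] using hm
  | cons t I ih =>
    intro m M L j hm hnd hfree he
    have e : (Cmd.seqs ((t :: I).map addCmd)).sem f m =
      (Cmd.seqs (I.map addCmd)).sem f ((addCmd t).sem f m) := rfl
    rw [e]
    cases L with
    | nil =>
      cases j with
      | zero => simp at he
      | succ j =>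
        rw [List.replicate_succ, List.map_nil, List.nil_append, List.map_cons,
          List.cons.injEq] at he
        rw [sem_addCmd_none f m he.1]
        exact ih hm hnd hfree he.2
    | cons p L =>
      rw [List.map_cons, List.map_cons, List.cons_append, List.cons.injEq] at he
      rw [ends_cons] at hnd hfree
      have hp := hfree p.1 List.mem_cons_self
      have hq := hfree p.2 (List.mem_cons_of_mem _ List.mem_cons_self)
      rw [List.nodup_cons, List.nodup_cons, List.mem_cons, not_or] at hnd
      obtain ⟨⟨d1, d2⟩, d3, d4⟩ := hnd
      obtain ⟨a1, a2, a3, a4, a5, a6, a7⟩ := sem_addCmd f hm he.1 d1 hp hq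
      have hev : ((addCmd t).sem f m).edgeVal = m.edgeVal := by
        funext s
        rw [Mem.edgeVal, Mem.edgeVal, a1, a2]
      -- The ends of the remaining edges stay free, as all ends in the list are distinct.
      obtain ⟨c1, c2, c3, c4, c5, c6⟩ := ih a7 d4 (by
        intro v hv
        rw [mate_insert hm.matching hm.loopless hp hq, if_neg, if_neg]
        · exact hfree v (List.mem_cons_of_mem _ (List.mem_cons_of_mem _ hv))
        · rintro rfl
          exact d2 hv
        · rintro rfl
          exact d3 hv) (by rw [hev]; exact he.2)
      refine ⟨c1.trans a1, fun i h0 h1 => (c2 i h0 h1).trans (a3 i h0 h1), c3.trans a4,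
        c4.trans a5, ?_, ?_⟩
      · rw [c5, a6, edgesOf_cons, Finset.insert_eq, Finset.union_assoc]
      · rw [edgesOf_cons, Finset.union_insert, ← Finset.insert_union]
        exact c6

/-- The three cases match the program: saving writes the first, dropping clears the second, and the
third is left alone. -/
theorem shadowEnd_augment {c : Config n} {E A : Finset (Sym2 (Fin n))} (hc : c.Valid E)
    (hA : IsMatching A) (hl : Loopless A) (v : Fin n) :
    (c.augment A).shadowEnd v = if v ∈ verts A then partner c.M v
      else if mate c.M v ∈ verts A then none else c.shadowEnd v := by
  rw [Config.shadowEnd]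
  split_ifs with h1 h2
  · rw [shadowAt_new hc hA hl h1, partner]
    split_ifs
    · rfl
    · rw [Option.bind_some, otherEnd_mk]
  · rw [Config.shadowAt, if_pos (mate_exchange_of_hit hc h1 h2), Option.bind_none]
  · rw [shadowAt_keep hc hA h1 h2, Config.shadowEnd]

theorem Config.Valid.shadowEnd {c : Config n} {E : Finset (Sym2 (Fin n))} (hc : c.Valid E)
    {v a : Fin n} (h : c.shadowEnd v = some a) :
    v ≠ a ∧ s(v, a) ∉ c.M ∧ mate c.M v ≠ v ∧ s(v, a) ∈ c.S := by
  obtain ⟨h1, h2⟩ := Config.shadow_of_shadowAt (Config.shadowAt_of_shadowEnd h)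
  have hg := mate_mem h1
  obtain ⟨-, h3, h4, -⟩ := hc.shadow _ hg v (Sym2.mem_mk_left _ _) _ h2
  refine ⟨fun hva => h3 (Sym2.mk_isDiag_iff.2 hva), fun hm => h4 ?_, h1,
    Config.mem_S.2 ⟨_, hg, v, Sym2.mem_mk_left _ _, h2⟩⟩
  exact hc.matching _ hm _ hg v (Sym2.mem_mk_left _ _) (Sym2.mem_mk_left _ _)

theorem Config.Valid.S_eq {c : Config n} {E : Finset (Sym2 (Fin n))} (hc : c.Valid E) :
    c.S = arrayEdges c.shadowEnd := by
  ext s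
  rw [mem_arrayEdges]
  constructor
  · intro hs
    obtain ⟨g, hg, v, hv, h⟩ := Config.mem_S.1 hs
    obtain ⟨hvs, -, -, -⟩ := hc.shadow g hg v hv s h
    obtain ⟨a, rfl⟩ := Sym2.mem_iff_exists.1 hvs
    obtain ⟨h1, h2⟩ := mate_ne hc.matching hc.loopless hg hv
    refine ⟨v, a, ?_, rfl⟩
    rw [Config.shadowEnd, Config.shadowAt, if_neg h1, ← h2, h, Option.bind_some, otherEnd_mk]
  · rintro ⟨v, a, h, rfl⟩
    exact (hc.shadowEnd h).2.2.2

/-- The memory represents the configuration `c` and the weights `w` of its edges. -/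
structure Mem.Rep (m : Mem 16 n) (c : Config n) (w : Sym2 (Fin n) → ℝ) : Prop where
  nul : m.vreg 2 = none
  holds : m.HoldsMatching c.M w
  shadow : m.varr 1 = c.shadowEnd
  shadowWeight : ∀ v a, c.shadowEnd v = some a → m.warr 1 v = w s(v, a)
  eset_one : m.eset 1 = c.M ∪ c.S
  eset : ∀ q, q ≠ 0 → q ≠ 1 → m.eset q = ∅

theorem Mem.Rep.shadowed {m : Mem 16 n} {c : Config n} {w : Sym2 (Fin n) → ℝ}
    {E : Finset (Sym2 (Fin n))} (h : m.Rep c w) (hc : c.Valid E) : m.Shadowed where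
  nul := h.nul
  ne v a hv := (hc.shadowEnd (by rwa [← h.shadow])).1
  notMem v a hv := by
    rw [h.holds.eset]
    exact (hc.shadowEnd (by rwa [← h.shadow])).2.1
  eset := by rw [h.eset_one, h.holds.eset, h.shadow, hc.S_eq]

/-- Carry out the augmentation in the registers `bestRegs`. -/
def applyCmd : Cmd 16 :=
  .seq (dropCmds (endRegs bestRegs)) (.seq (.seqs ((endRegs bestRegs).map saveCmd))
    (.seq (.seqs ((endRegs bestRegs).map unmatchCmd)) (.seqs (bestRegs.map addCmd))))

theorem map_endRegs_of_edgeVal {m : Mem 16 n} {w : Sym2 (Fin n) → ℝ} (I : List EdgeRegs) :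
    ∀ {L : List (Fin n × Fin n)} {j : ℕ},
    I.map m.edgeVal = L.map (fun p => (some p.1, some p.2, w s(p.1, p.2))) ++
      List.replicate j (none, none, 0) → ∀ v, some v ∈ (endRegs I).map m.vreg ↔ v ∈ ends L := by
  induction I with
  | nil =>
    intro L j h v
    have hL : L = [] := by
      cases L with
      | nil => rfl
      | cons p L => simp at h
    subst hL
    simp [endRegs, ends]
  | cons t I ih =>
    intro L j h v
    have e : endRegs (t :: I) = t.1 :: t.2.1 :: endRegs I := rfl
    rw [e, List.map_cons, List.map_cons, List.mem_cons, List.mem_cons]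
    cases L with
    | nil =>
      cases j with
      | zero => simp at h
      | succ j =>
        rw [List.replicate_succ, List.map_nil, List.nil_append, List.map_cons,
          List.cons.injEq] at h
        have h1 := h.1
        simp only [Mem.edgeVal, Prod.mk.injEq] at h1
        rw [h1.1, h1.2.1, ih (L := []) h.2]
        simp
    | cons p L =>
      rw [List.map_cons, List.map_cons, List.cons_append, List.cons.injEq] at h
      have h1 := h.1
      simp only [Mem.edgeVal, Prod.mk.injEq] at h1
      rw [h1.1, h1.2.1, ih h.2, ends_cons, List.mem_cons, List.mem_cons, Option.some_inj,
        Option.some_inj]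

/-- The order of the four phases matters: shadow edges on affected matching edges are dropped while
partners are still known, then the doomed edges are saved as shadow edges, and only then is the
matching changed. -/
theorem sem_applyCmd (f : Finset (Sym2 (Fin n)) → ℝ) {m : Mem 16 n} {c : Config n}
    {w : Sym2 (Fin n) → ℝ} {E E' : Finset (Sym2 (Fin n))} (h : m.Rep c w) (hc : c.Valid E)
    {L : List (Fin n × Fin n)} {j : ℕ} (hL : (ends L).Nodup)
    (hv : bestRegs.map m.edgeVal = L.map (fun p => (some p.1, some p.2, w s(p.1, p.2))) ++
      List.replicate j (none, none, 0)) (hc' : (c.augment (edgesOf L)).Valid E') :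
    (applyCmd.sem f m).Rep (c.augment (edgesOf L)) w := by
  have hR : ∀ r ∈ endRegs bestRegs, r < 13 := by decide
  have hU := map_endRegs_of_edgeVal bestRegs hv
  have hM := hc.matching
  obtain ⟨a1, a2, a3, a4, a5, a6⟩ := sem_dropCmds f (endRegs bestRegs) hR (h.shadowed hc)
  set m₁ := (dropCmds (endRegs bestRegs)).sem f m
  obtain ⟨b1, b2, b3, b4, b5, b6⟩ := sem_saveCmds f (endRegs bestRegs) hR m₁
  set m₂ := (Cmd.seqs ((endRegs bestRegs).map saveCmd)).sem f m₁
  have hF2 : m.Frame 13 9 m₂ := a1.trans b1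
  have hm2 : m₂.HoldsMatching c.M w :=
    ⟨hM, hc.loopless, by rw [b4, a4, h.holds.eset], by rw [b2, a2, h.holds.mate],
      fun v hv => by rw [b3, a3]; exact h.holds.weight v hv⟩
  obtain ⟨c1, c2, c3, c4, c5⟩ := sem_unmatchCmds f (endRegs bestRegs) hR hm2
    ((hF2.vreg 2 (by decide)).trans h.nul)
  set m₃ := (Cmd.seqs ((endRegs bestRegs).map unmatchCmd)).sem f m₂
  have hF3 : m.Frame 13 9 m₃ := hF2.trans c1
  have g1 : (endRegs bestRegs).map m₁.vreg = (endRegs bestRegs).map m.vreg :=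
    List.map_congr_left fun r hr => a1.vreg r (hR r hr)
  have g2 : (endRegs bestRegs).map m₂.vreg = (endRegs bestRegs).map m.vreg :=
    List.map_congr_left fun r hr => hF2.vreg r (hR r hr)
  have g3 : bestRegs.map m₃.edgeVal = bestRegs.map m.edgeVal := by
    have : ∀ t ∈ bestRegs, t.1 < 13 ∧ t.2.1 < 13 ∧ t.2.2 < 9 := by
      simp [bestRegs]
    apply List.map_congr_left
    intro t ht
    obtain ⟨t1, t2, t3⟩ := this t ht
    rw [Mem.edgeVal, Mem.edgeVal, hF3.vreg _ t1, hF3.vreg _ t2, hF3.wreg _ t3]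
  have e0 : (c.M.filter fun g => ∀ v, some v ∈ (endRegs bestRegs).map m₂.vreg → v ∉ g) =
      c.M \ hit c.M (edgesOf L) := by
    ext g
    rw [Finset.mem_filter, Finset.mem_sdiff, mem_hit_iff_verts]
    simp only [g2, hU, mem_verts_edgesOf]
    constructor
    · rintro ⟨k1, k2⟩
      exact ⟨k1, fun ⟨_, v, hv, hvg⟩ => k2 v hv hvg⟩
    · rintro ⟨k1, k2⟩
      exact ⟨k1, fun v hv hvg => k2 ⟨k1, v, hv, hvg⟩⟩
  rw [e0] at c5
  obtain ⟨d1, d2, d3, d4, d5, d6⟩ := sem_addCmds f bestRegs c5 hL (by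
    intro v hv
    apply mate_eq_self
    intro g hg hvg
    rw [Finset.mem_sdiff] at hg
    exact hg.2 (mem_hit_iff_verts.2 ⟨hg.1, v, mem_verts_edgesOf.2 hv, hvg⟩)) (g3.trans hv)
  have e : applyCmd.sem f m = (Cmd.seqs (bestRegs.map addCmd)).sem f m₃ := rfl
  rw [e]
  set m₄ := (Cmd.seqs (bestRegs.map addCmd)).sem f m₃
  have hA := isMatching_edgesOf hL
  have hl := loopless_edgesOf hL
  have hdrop : ∀ v, m₁.varr 1 v = if v ∈ ends L ∨ mate c.M v ∈ ends L then none
      else c.shadowEnd v := by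
    intro v
    have hiff : (∃ r ∈ endRegs bestRegs, m.vreg r = some v ∨ (m.vreg r).bind (m.varr 0) = some v) ↔
        v ∈ ends L ∨ mate c.M v ∈ ends L := by
      have hU' : ∀ u, u ∈ ends L ↔ ∃ r ∈ endRegs bestRegs, m.vreg r = some u := fun u => by
        rw [← hU, List.mem_map]
      rw [hU', hU', h.holds.mate]
      constructor
      · rintro ⟨r, hr, k | k⟩
        · exact Or.inl ⟨r, hr, k⟩
        · obtain ⟨u, hu, k⟩ := Option.bind_eq_some_iff.1 k
          obtain ⟨-, rfl⟩ := partner_eq_some.1 k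
          exact Or.inr ⟨r, hr, by rw [hu, mate_mate hM]⟩
      · rintro (⟨r, hr, k⟩ | ⟨r, hr, k⟩)
        · exact ⟨r, hr, Or.inl k⟩
        · refine ⟨r, hr, ?_⟩
          -- A free vertex is its own `mate` but has no `partner`; it is then itself in a register.
          by_cases hvv : mate c.M v = v
          · exact Or.inl (by rw [k, hvv])
          · right
            rw [k, Option.bind_some, partner_eq_some, mate_mate hM]
            exact ⟨Ne.symm hvv, rfl⟩
    rw [a5 v, h.shadow]
    by_cases k : v ∈ ends L ∨ mate c.M v ∈ ends L
    · rw [if_pos (hiff.2 k), if_pos k]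
    · rw [if_neg (fun hh => k (hiff.1 hh)), if_neg k]
  have hsh : m₂.varr 1 = (c.augment (edgesOf L)).shadowEnd := by
    funext v
    rw [shadowEnd_augment hc hA hl, b5 v, hdrop v, g1, a2, h.holds.mate]
    simp only [hU, mem_verts_edgesOf]
    by_cases k1 : v ∈ ends L <;> by_cases k2 : mate c.M v ∈ ends L <;> simp [k1, k2]
  refine ⟨?_, d6, ?_, ?_, ?_, ?_⟩
  · rw [d1, hF3.vreg 2 (by decide), h.nul]
  · rw [d3, c2, hsh]
  · intro v a hva
    rw [d4, c3, b6 v, g1]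
    rw [shadowEnd_augment hc hA hl] at hva
    simp only [hU, mem_verts_edgesOf] at hva ⊢
    split_ifs at hva ⊢ with k1 k2
    · rw [a3]
      obtain ⟨k3, rfl⟩ := partner_eq_some.1 hva
      exact h.holds.weight v k3
    · rw [a3]
      exact h.shadowWeight v a hva
  · rw [d5, c4, b4, a6.eset, hc'.S_eq, ← hsh, a4, h.holds.eset]
    have hsave : ∀ v, m₂.varr 1 v = if v ∈ ends L then partner c.M v else m₁.varr 1 v := by
      intro v
      rw [b5 v, g1, a2, h.holds.mate]
      simp only [hU]
    -- Each removed edge has an end covered by the new ones and reappears as the shadow edge there.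
    -- Hence edge set `1` needs no change while edges are saved and unmatched.
    have key : c.M ∪ arrayEdges (m₁.varr 1) = c.M \ hit c.M (edgesOf L) ∪ arrayEdges (m₂.varr 1) := by
      ext g
      rw [Finset.mem_union, Finset.mem_union, mem_arrayEdges, mem_arrayEdges, Finset.mem_sdiff,
        mem_hit_iff_verts]
      constructor
      · rintro (hg | ⟨v, a, hva, rfl⟩)
        · by_cases hh : ∃ v ∈ verts (edgesOf L), v ∈ g
          · obtain ⟨v, hv, hvg⟩ := hh
            obtain ⟨k1, k2⟩ := mate_ne hM hc.loopless hg hvg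
            refine Or.inr ⟨v, _, ?_, k2⟩
            rw [hsave, if_pos (mem_verts_edgesOf.1 hv)]
            exact partner_eq_some.2 ⟨k1, rfl⟩
          · exact Or.inl ⟨hg, fun k => hh k.2⟩
        · refine Or.inr ⟨v, a, ?_, rfl⟩
          rw [hsave, if_neg, hva]
          intro k
          rw [hdrop, if_pos (Or.inl k)] at hva
          cases hva
      · rintro (⟨hg, -⟩ | ⟨v, a, hva, rfl⟩)
        · exact Or.inl hg
        · rw [hsave] at hva
          split_ifs at hva
          · obtain ⟨k1, rfl⟩ := partner_eq_some.1 hva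
            exact Or.inl (mate_mem k1)
          · exact Or.inr ⟨v, a, hva, rfl⟩
    rw [key, Finset.union_right_comm]
    rfl
  · intro q h0 h1
    rw [d2 q h0 h1, hF3.eset q h0 h1, h.eset q h0 h1]

end Apply

/-! ### The program -/

section Program

variable {n : ℕ}

/-- Load the ends and the weights of the shadow edges in the vicinity of the arriving edge. -/
def loadShadowCmd : Cmd 16 :=
  .seq (.vload 3 0 0) (.seq (.vload 4 1 3) (.seq (.wload 3 1 3)
    (.seq (.vload 5 0 1) (.seq (.vload 6 1 5) (.wload 4 1 5)))))

/-- Compute the weight of the arriving edge, and load its ends and the shadow edges in its vicinity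
into registers. -/
def loadCmd : Cmd 16 :=
  .seq (.query 0 1) (.seq (.insert 1 0 1) (.seq (.query 1 1) (.seq (.erase 1 0 1)
    (.seq (.wsub 2 1 0) loadShadowCmd))))

theorem vicinity_of_shadowEnd {c : Config n} {E : Finset (Sym2 (Fin n))} (hc : c.Valid E)
    {e : Sym2 (Fin n)} {y z a : Fin n} (hy : y ∈ e) (hz : partner c.M y = some z)
    (ha : c.shadowEnd z = some a) : s(z, a) ∈ c.vicinity e := by
  obtain ⟨h1, rfl⟩ := partner_eq_some.1 hz
  have h2 := (Config.shadow_of_shadowAt (Config.shadowAt_of_shadowEnd ha)).2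
  rw [mate_mate hc.matching, Sym2.eq_swap] at h2
  simp only [Config.vicinity, Finset.mem_filter, Finset.mem_univ, true_and]
  exact Or.inr ⟨y, hy, _, mate_mem h1, Sym2.mem_mk_left _ _, Or.inr ⟨_, Sym2.mem_mk_right _ _, h1,
    _, h2, Or.inl rfl⟩⟩

theorem shadowEnd_of_vicinity {c : Config n} {E : Finset (Sym2 (Fin n))} (hc : c.Valid E)
    {e x : Sym2 (Fin n)} (hx : x ∈ c.vicinity e) (hxe : x ≠ e) (hxM : x ∉ c.M) :
    ∃ y ∈ e, ∃ z a, partner c.M y = some z ∧ c.shadowEnd z = some a ∧ x = s(z, a) := by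
  simp only [Config.vicinity, Finset.mem_filter, Finset.mem_univ, true_and] at hx
  rcases hx with h | ⟨y, hy, g, hg, hyg, rfl | ⟨z, hz, hzy, s, hs, rfl | ⟨h, -⟩⟩⟩
  · exact absurd h hxe
  · exact absurd hg hxM
  · obtain ⟨h1, h2⟩ := mate_ne hc.matching hc.loopless hg hyg
    obtain ⟨h3, h4⟩ := mate_ne hc.matching hc.loopless hg hz
    have hzm : z = mate c.M y := by
      rw [h2] at hz
      exact (Sym2.mem_iff.1 hz).resolve_left hzy
    obtain ⟨a, rfl⟩ := Sym2.mem_iff_exists.1 (hc.shadow g hg z hz x hs).1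
    refine ⟨y, hy, z, a, partner_eq_some.2 ⟨h1, hzm.symm⟩, ?_, rfl⟩
    rw [Config.shadowEnd, Config.shadowAt, if_neg h3, ← h4, hs, Option.bind_some, otherEnd_mk]
  · exact absurd h hxM

theorem Mem.Rep.congr {m m' : Mem 16 n} {c : Config n} {w w' : Sym2 (Fin n) → ℝ} (h : m.Rep c w)
    (h1 : m'.varr = m.varr) (h2 : m'.warr = m.warr) (h3 : m'.eset = m.eset)
    (h4 : m'.vreg 2 = m.vreg 2) {E : Finset (Sym2 (Fin n))} (hc : c.Valid E)
    (hw : ∀ g ∈ E, w' g = w g) : m'.Rep c w' where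
  nul := h4.trans h.nul
  holds := ⟨hc.matching, hc.loopless, by rw [h3, h.holds.eset], by rw [h1, h.holds.mate],
    fun v hv => by rw [h2, h.holds.weight v hv, hw _ (hc.subset (mate_mem hv))]⟩
  shadow := by rw [h1, h.shadow]
  shadowWeight v a hv := by
    rw [h2, h.shadowWeight v a hv, hw _ (hc.S_subset (hc.shadowEnd hv).2.2.2)]
  eset_one := by rw [h3, h.eset_one]
  eset q h0 h1 := by rw [h3, h.eset q h0 h1]

/-- The arriving edge is put into edge set `1` only for the second oracle call. Being new, it is not
in `M ∪ S`, so erasing it restores the set. -/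
theorem sem_loadCmd (f : Finset (Sym2 (Fin n)) → ℝ) {m : Mem 16 n} {c : Config n}
    {w : Sym2 (Fin n) → ℝ} (h : m.Rep c w) {E : Finset (Sym2 (Fin n))} (hc : c.Valid E)
    {y₁ y₂ : Fin n} (he : s(y₁, y₂) ∉ E) (h₁ : m.vreg 0 = some y₁) (h₂ : m.vreg 1 = some y₂)
    (hw : w s(y₁, y₂) = f (insert s(y₁, y₂) (c.M ∪ c.S)) - f (c.M ∪ c.S)) :
    (loadCmd.sem f m).Rep c w ∧ (loadCmd.sem f m).Loaded c w s(y₁, y₂) := by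
  have heX : s(y₁, y₂) ∉ c.M ∪ c.S := fun hh =>
    he (Finset.union_subset hc.subset hc.S_subset hh)
  have k1 : (loadCmd.sem f m).varr = m.varr := by simp [loadCmd, loadShadowCmd, Cmd.sem]
  have k2 : (loadCmd.sem f m).warr = m.warr := by simp [loadCmd, loadShadowCmd, Cmd.sem]
  have k3 : (loadCmd.sem f m).eset = m.eset := by
    simp [loadCmd, loadShadowCmd, Cmd.sem, Mem.edgeOf, h₁, h₂, h.eset_one]
    rw [Finset.sdiff_singleton_eq_erase, Finset.erase_insert heX]
  have k4 : (loadCmd.sem f m).vreg 2 = m.vreg 2 := by simp [loadCmd, loadShadowCmd, Cmd.sem]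
  have v0 : (loadCmd.sem f m).vreg 0 = some y₁ := by simp [loadCmd, loadShadowCmd, Cmd.sem, h₁]
  have v1 : (loadCmd.sem f m).vreg 1 = some y₂ := by simp [loadCmd, loadShadowCmd, Cmd.sem, h₂]
  have v3 : (loadCmd.sem f m).vreg 3 = partner c.M y₁ := by
    simp [loadCmd, loadShadowCmd, Cmd.sem, h₁, h.holds.mate]
  have v4 : (loadCmd.sem f m).vreg 4 = (partner c.M y₁).bind c.shadowEnd := by
    simp [loadCmd, loadShadowCmd, Cmd.sem, h₁, h.holds.mate, h.shadow]
  have v5 : (loadCmd.sem f m).vreg 5 = partner c.M y₂ := by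
    simp [loadCmd, loadShadowCmd, Cmd.sem, h₂, h.holds.mate]
  have v6 : (loadCmd.sem f m).vreg 6 = (partner c.M y₂).bind c.shadowEnd := by
    simp [loadCmd, loadShadowCmd, Cmd.sem, h₂, h.holds.mate, h.shadow]
  have w2 : (loadCmd.sem f m).wreg 2 = w s(y₁, y₂) := by
    rw [hw]
    simp [loadCmd, loadShadowCmd, Cmd.sem, Mem.edgeOf, h₁, h₂, h.eset_one]
  have w3 : ∀ z, partner c.M y₁ = some z → (loadCmd.sem f m).wreg 3 = m.warr 1 z := by
    intro z hz
    simp [loadCmd, loadShadowCmd, Cmd.sem, h₁, h.holds.mate, hz]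
  have w4 : ∀ z, partner c.M y₂ = some z → (loadCmd.sem f m).wreg 4 = m.warr 1 z := by
    intro z hz
    simp [loadCmd, loadShadowCmd, Cmd.sem, h₂, h.holds.mate, hz]
  refine ⟨h.congr k1 k2 k3 k4 hc fun _ _ => rfl, ⟨by rw [k1, h.holds.mate],
    fun v hv => by rw [k2, h.holds.weight v hv], ?_, ?_⟩⟩
  · have key : ∀ y ∈ s(y₁, y₂), ∀ u v, partner c.M y = some u →
        (partner c.M y).bind c.shadowEnd = some v →
        m.warr 1 u = w s(u, v) ∧ s(u, v) ∈ c.vicinity s(y₁, y₂) ∧ s(u, v) ∉ c.M := by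
      intro y hy u v hu hv
      rw [hu, Option.bind_some] at hv
      exact ⟨h.shadowWeight u v hv, vicinity_of_shadowEnd hc hy hu hv, (hc.shadowEnd hv).2.1⟩
    intro t ht u v hu hv
    simp only [vicinityRegs, List.mem_cons, List.not_mem_nil, or_false] at ht
    rcases ht with rfl | rfl | rfl
    · simp only [v0, v1, Option.some_inj] at hu hv
      subst hu hv
      refine ⟨w2, ?_, fun hm => he (hc.subset hm)⟩
      simp [Config.vicinity]
    · simp only [v3, v4] at hu hv
      rw [w3 u hu]
      exact key y₁ (Sym2.mem_mk_left _ _) u v hu hv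
    · simp only [v5, v6] at hu hv
      rw [w4 u hu]
      exact key y₂ (Sym2.mem_mk_right _ _) u v hu hv
  · intro g hg hgM
    by_cases hge : g = s(y₁, y₂)
    · exact ⟨(0, 1, 2), by simp [vicinityRegs], y₁, y₂, v0, v1, hge⟩
    · obtain ⟨y, hy, z, a, hz, ha, rfl⟩ := shadowEnd_of_vicinity hc hg hge hgM
      rcases Sym2.mem_iff.1 hy with rfl | rfl
      · exact ⟨(3, 4, 3), by simp [vicinityRegs], z, a, v3.trans hz,
          by rw [v4, hz, Option.bind_some, ha], rfl⟩
      · exact ⟨(5, 6, 4), by simp [vicinityRegs], z, a, v5.trans hz,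
          by rw [v6, hz, Option.bind_some, ha], rfl⟩

/-- The program run on every arriving edge. -/
def zelkeCmd : Cmd 16 := .seq loadCmd (.seq bestCmd applyCmd)

theorem sem_zelkeCmd (f : Finset (Sym2 (Fin n)) → ℝ) {m : Mem 16 n} {c : Config n}
    {w : Sym2 (Fin n) → ℝ} (h : m.Rep c w) {E : Finset (Sym2 (Fin n))} (hc : c.Valid E)
    {y₁ y₂ : Fin n} (he : s(y₁, y₂) ∉ E) (hy : y₁ ≠ y₂) (h₁ : m.vreg 0 = some y₁)
    (h₂ : m.vreg 1 = some y₂) (hwM : ∀ g ∈ c.M, 0 ≤ w g)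
    (hw : w s(y₁, y₂) = f (insert s(y₁, y₂) (c.M ∪ c.S)) - f (c.M ∪ c.S)) :
    ∃ c', StrictStep w s(y₁, y₂) c c' ∧ (zelkeCmd.sem f m).Rep c' w ∧
      c'.Valid (insert s(y₁, y₂) E) := by
  have hd : ¬ (s(y₁, y₂)).IsDiag := fun hh => hy (Sym2.mk_isDiag_iff.1 hh)
  obtain ⟨a1, a2⟩ := sem_loadCmd f h hc he h₁ h₂ hw
  set m₁ := loadCmd.sem f m
  have hb := bestOf_bestCmd f m₁ a1.nul
  set m₂ := bestCmd.sem f m₁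
  obtain ⟨L, hL, g1, g2, g3, g4⟩ := a2.isMaxGain hc hd hwM hb
  have hR : m₂.Rep c w := a1.congr hb.agree.varr hb.agree.warr hb.agree.eset
    (hb.agree.vreg 2 (by decide)) hc fun _ _ => rfl
  have hc' := hc.augment hd g1.1 g1.2.1 g2
  have e : zelkeCmd.sem f m = applyCmd.sem f m₂ := by rw [zelkeCmd, Cmd.sem, Cmd.sem]
  rw [e]
  exact ⟨_, ⟨_, g1, g2, g3, rfl⟩, sem_applyCmd f hR hc hL g4 hc', hc'⟩

theorem queryFree_hitCmd (l : List (Fin 16)) : (hitCmd l).QueryFree := by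
  induction l with
  | nil => trivial
  | cons u l ih => exact ⟨ih, trivial, Cmd.QueryFree.ifNotMem (c := .seq (.wload 10 0 u) (.wadd 9 9 10))
    ⟨trivial, trivial⟩ _ _⟩

theorem queryFree_sumCmd (I : List EdgeRegs) : (sumCmd I).QueryFree := by
  induction I with
  | nil => trivial
  | cons t I ih => exact ⟨ih, trivial⟩

theorem queryFree_copyCmds (B I : List EdgeRegs) : (Cmd.seqs (copyCmds B I)).QueryFree := by
  induction B generalizing I with
  | nil => trivial
  | cons t B ih =>
    cases I with
    | nil => exact ⟨trivial, trivial, trivial, ih _⟩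
    | cons s I => exact ⟨trivial, trivial, trivial, ih _⟩

theorem queryFree_bestCmd : bestCmd.QueryFree := by
  refine ⟨trivial, queryFree_copyCmds _ _, Cmd.QueryFree.seqs ?_⟩
  intro c hc
  obtain ⟨I, -, rfl⟩ := List.mem_map.1 hc
  rw [candCmd]
  apply Cmd.QueryFree.ifNodup
  exact ⟨queryFree_hitCmd _, queryFree_sumCmd _, trivial, trivial, trivial, trivial,
    queryFree_copyCmds _ _⟩

theorem queryFree_applyCmd : applyCmd.QueryFree := by
  refine ⟨Cmd.QueryFree.seqs ?_, Cmd.QueryFree.seqs ?_, Cmd.QueryFree.seqs ?_,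
    Cmd.QueryFree.seqs ?_⟩ <;>
  · intro c hc
    obtain ⟨I, -, rfl⟩ := List.mem_map.1 hc
    simp [Cmd.QueryFree, dropCmd, saveCmd, unmatchCmd, addCmd]

theorem exec_queries_zelkeCmd (f : Finset (Sym2 (Fin n)) → ℝ) (R : Machine 16 n) :
    (zelkeCmd.exec f R).queries =
      (R.mem.eset 1 ∪ R.mem.edgeOf 0 1) :: R.mem.eset 1 :: R.queries := by
  have h : loadShadowCmd.QueryFree := ⟨trivial, trivial, trivial, trivial, trivial, trivial⟩
  rw [zelkeCmd, Cmd.exec, Cmd.exec, queryFree_applyCmd.exec_queries, queryFree_bestCmd.exec_queries,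
    loadCmd, Cmd.exec, Cmd.exec, Cmd.exec, Cmd.exec, Cmd.exec, h.exec_queries]
  simp [Cmd.exec, Machine.tick, Mem.edgeOf]

/-- The streaming program. -/
def zelkeProgram : StreamProgram where
  k := 16
  in₁ := 0
  in₂ := 1
  out := 0
  body := zelkeCmd

end Program

/-! ### Runs of the program -/

section Run

variable {n : ℕ} {f : Finset (Sym2 (Fin n)) → ℝ} {σ : List (Sym2 (Fin n))}

theorem run_take_succ (P : StreamProgram) (f : Finset (Sym2 (Fin n)) → ℝ) (σ : List (Sym2 (Fin n)))
    {i : ℕ} (hi : i < σ.length) : P.run f (σ.take (i + 1)) = P.feed f (P.run f (σ.take i)) σ[i] := by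
  rw [← List.take_concat_get' σ i hi, StreamProgram.run, List.foldl_append]
  rfl

theorem inf_sup_eq (e : Sym2 (Fin n)) : s(e.inf, e.sup) = e := by
  induction e with
  | _ x y =>
    rw [Sym2.inf_mk, Sym2.sup_mk]
    rcases le_total x y with h | h
    · rw [inf_eq_left.2 h, sup_eq_right.2 h]
    · rw [inf_eq_right.2 h, sup_eq_left.2 h, Sym2.eq_swap]

/-- The memory after the first `i` edges represents the configuration `c` and the weights `w`. -/
structure Represents (f : Finset (Sym2 (Fin n)) → ℝ) (σ : List (Sym2 (Fin n))) (i : ℕ)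
    (c : Config n) (w : Sym2 (Fin n) → ℝ) : Prop where
  rep : Mem.Rep (zelkeProgram.run f (σ.take i)).mem c w
  valid : c.Valid (σ.take i).toFinset
  nonneg : ∀ e ∈ (σ.take i).toFinset, 0 ≤ w e

theorem represents_zero : Represents f σ 0 (Config.start n) 0 := by
  have hm : ∀ v, mate (∅ : Finset (Sym2 (Fin n))) v = v := fun v => mate_eq_self fun g hg =>
    absurd hg (Finset.notMem_empty g)
  have hs : (Config.start n).shadowEnd = fun _ => none := by
    funext v
    have hm' : mate (Config.start n).M v = v := hm v
    rw [Config.shadowEnd, Config.shadowAt, if_pos hm']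
    rfl
  have hS : (Config.start n).S = ∅ := by
    simp [Config.S, Config.start]
  have hR : (zelkeProgram.run f (σ.take 0)).mem = Mem.init 16 n := rfl
  refine ⟨?_, ⟨?_, ?_, ?_, ?_⟩, ?_⟩
  · rw [hR]
    refine ⟨rfl, ⟨?_, ?_, rfl, ?_, ?_⟩, ?_, ?_, ?_, fun _ _ _ => rfl⟩
    · intro g hg; exact absurd hg (Finset.notMem_empty g)
    · intro g hg; exact absurd hg (Finset.notMem_empty g)
    · funext v
      exact (partner_eq_none.2 (hm v)).symm
    · intro v hv
      exact absurd (hm v) hv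
    · rw [hs]; rfl
    · intro v a hva
      rw [hs] at hva
      cases hva
    · rw [hS]; rfl
  · intro g hg; exact absurd hg (Finset.notMem_empty g)
  · intro g hg; exact absurd hg (Finset.notMem_empty g)
  · exact Finset.empty_subset _
  · intro g hg; exact absurd hg (Finset.notMem_empty g)
  · intro e he; simp at he

/-- Giving the new edge its weight does not disturb the representation, because the arriving edge
differs from all edges that are stored. -/
theorem Represents.step (hσ : IsGraphStream σ) (hf : IsMonotoneSubmodular σ.toFinset f) {i : ℕ}
    (hi : i < σ.length) {c : Config n} {w : Sym2 (Fin n) → ℝ} (h : Represents f σ i c w) :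
    ∃ c', StrictStep (Function.update w σ[i] (f (insert σ[i] (c.M ∪ c.S)) - f (c.M ∪ c.S)))
        σ[i] c c' ∧
      Represents f σ (i + 1) c'
        (Function.update w σ[i] (f (insert σ[i] (c.M ∪ c.S)) - f (c.M ∪ c.S))) := by
  set e := σ[i] with he
  set w' := Function.update w e (f (insert e (c.M ∪ c.S)) - f (c.M ∪ c.S)) with hw'
  have hnew : e ∉ (σ.take i).toFinset := getElem_notMem_take hσ.1 hi
  have heσ : e ∈ σ.toFinset := List.mem_toFinset.2 (List.getElem_mem hi)
  have hsub := toFinset_take_subset σ i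
  have hMS : c.M ∪ c.S ⊆ σ.toFinset :=
    (Finset.union_subset h.valid.subset h.valid.S_subset).trans hsub
  have hw : ∀ g ∈ (σ.take i).toFinset, w' g = w g := fun g hg =>
    Function.update_of_ne (ne_of_mem_of_not_mem hg hnew) _ _
  have hwe : w' e = f (insert e (c.M ∪ c.S)) - f (c.M ∪ c.S) := Function.update_self _ _ _
  have hie := inf_sup_eq e
  have hne : e.inf ≠ e.sup := by
    intro hh
    apply hσ.2 e (List.mem_toFinset.1 heσ)
    rw [← hie]
    exact Sym2.mk_isDiag_iff.2 hh
  obtain ⟨m₀, hm₀⟩ : ∃ m₀ : Mem 16 n, m₀ = (zelkeProgram.run f (σ.take i)).mem := ⟨_, rfl⟩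
  have hrep₀ := h.rep
  rw [← hm₀] at hrep₀
  set m : Mem 16 n := { m₀ with
    vreg := Function.update (Function.update m₀.vreg 0 (some e.inf)) 1 (some e.sup) } with hm
  have hrep : m.Rep c w' := hrep₀.congr rfl rfl rfl (by simp [hm]) h.valid hw
  have hmem : (zelkeProgram.run f (σ.take (i + 1))).mem = zelkeCmd.sem f m := by
    rw [run_take_succ _ _ _ hi, StreamProgram.feed, Cmd.exec_mem, hm, hm₀]
    rfl
  obtain ⟨c', h1, h2, h3⟩ := sem_zelkeCmd f hrep h.valid (by rwa [hie]) hne (by simp [hm])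
    (by simp [hm]) (fun g hg => by rw [hw g (h.valid.subset hg)]; exact h.nonneg g (h.valid.subset hg))
    (by rw [hie]; exact hwe)
  rw [hie] at h1 h3
  refine ⟨c', h1, ?_, ?_, ?_⟩
  · rwa [hmem]
  · rwa [toFinset_take_succ σ hi]
  · intro g hg
    rw [toFinset_take_succ σ hi, Finset.mem_insert] at hg
    by_cases hge : g = e
    · rw [hge, hwe, sub_nonneg]
      exact hf.mono _ _ (Finset.subset_insert _ _) (Finset.insert_subset heσ hMS)
    · rw [hw g (hg.resolve_left hge)]
      exact h.nonneg g (hg.resolve_left hge)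

theorem exists_run (hσ : IsGraphStream σ) (hf : IsMonotoneSubmodular σ.toFinset f) :
    ∃ (c : ℕ → Config n) (w : ℕ → Sym2 (Fin n) → ℝ), c 0 = Config.start n ∧ w 0 = 0 ∧
      (∀ (i : ℕ) (hi : i < σ.length),
        w (i + 1) = Function.update (w i) σ[i]
          (f (insert σ[i] ((c i).M ∪ (c i).S)) - f ((c i).M ∪ (c i).S)) ∧
        StrictStep (w (i + 1)) σ[i] (c i) (c (i + 1))) ∧
      ∀ i ≤ σ.length, Represents f σ i (c i) (w i) := by
  have key : ∀ (i : ℕ) (hi : i < σ.length) (x : Config n × (Sym2 (Fin n) → ℝ)),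
      Represents f σ i x.1 x.2 → ∃ y : Config n × (Sym2 (Fin n) → ℝ),
        (y.2 = Function.update x.2 σ[i]
          (f (insert σ[i] (x.1.M ∪ x.1.S)) - f (x.1.M ∪ x.1.S)) ∧
        StrictStep y.2 σ[i] x.1 y.1) ∧ Represents f σ (i + 1) y.1 y.2 := by
    intro i hi x hx
    obtain ⟨c', h1, h2⟩ := hx.step hσ hf hi
    exact ⟨(c', _), ⟨rfl, h1⟩, h2⟩
  have : Nonempty (Config n × (Sym2 (Fin n) → ℝ)) := ⟨(Config.start n, 0)⟩
  choose! g hg using key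
  set x : ℕ → Config n × (Sym2 (Fin n) → ℝ) := fun i =>
    Nat.rec (Config.start n, 0) (fun i y => g i y) i with hx
  have hrep : ∀ i ≤ σ.length, Represents f σ i (x i).1 (x i).2 := by
    intro i
    induction i with
    | zero => exact fun _ => represents_zero
    | succ i ih => exact fun hi => (hg i hi (x i) (ih (Nat.le_of_succ_le hi))).2
  exact ⟨fun i => (x i).1, fun i => (x i).2, rfl, rfl,
    fun i hi => (hg i hi (x i) (hrep i hi.le)).1, hrep⟩

theorem gain_congr {γ : ℝ} {w w' : Sym2 (Fin n) → ℝ} {M B : Finset (Sym2 (Fin n))}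
    (hM : ∀ g ∈ M, w g = w' g) (hB : ∀ g ∈ B, w g = w' g) : gain γ w M B = gain γ w' M B := by
  rw [gain, gain, Finset.sum_congr rfl hB,
    Finset.sum_congr rfl fun g hg => hM g (hit_subset hg)]

theorem StrictStep.congr {w w' : Sym2 (Fin n) → ℝ} {c c' : Config n} {E : Finset (Sym2 (Fin n))}
    {e : Sym2 (Fin n)} (hc : c.Valid E) (h : StrictStep w e c c')
    (hw : ∀ g ∈ insert e E, w g = w' g) : StrictStep w' e c c' := by
  have key : ∀ B, B ⊆ c.vicinity e → gain 1 w c.M B = gain 1 w' c.M B := fun B hB =>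
    gain_congr (fun g hg => hw g (Finset.mem_insert_of_mem (hc.subset hg)))
      fun g hg => hw g (Config.vicinity_subset hc e (hB hg))
  obtain ⟨A, ⟨h1, h2, h3⟩, h4, h5, h6⟩ := h
  refine ⟨A, ⟨h1, h2, fun B hB hB' => ?_⟩, h4, ?_, h6⟩
  · rw [← key B hB, ← key A h1]
    exact h3 B hB hB'
  · rwa [← key A h1]

/-- No edge occurs twice, so a weight never changes once assigned, and a step depends only on
weights of edges that have arrived. The final weight function therefore serves for the whole run, as
the charging argument requires. -/
theorem exists_strictRun (hσ : IsGraphStream σ) (hf : IsMonotoneSubmodular σ.toFinset f) :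
    ∃ (c : ℕ → Config n) (w : ℕ → Sym2 (Fin n) → ℝ), IsZelkeExtensionRun 1 f σ c w ∧
      IsStrictRun f σ c (w σ.length) ∧ ∀ i ≤ σ.length, Represents f σ i (c i) (w i) := by
  obtain ⟨c, w, h0, h1, h2, h3⟩ := exists_run hσ hf
  refine ⟨c, w, ⟨h0, h1, fun i hi => ⟨(h2 i hi).1, (h2 i hi).2.zelkeStep⟩⟩, ?_, h3⟩
  have key : ∀ i, ∀ j, i + j ≤ σ.length → ∀ e ∈ (σ.take i).toFinset, w (i + j) e = w i e := by
    intro i j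
    induction j with
    | zero => exact fun _ _ _ => rfl
    | succ j ih =>
      intro hj e he
      have hj' : i + j < σ.length := hj
      rw [← ih hj'.le e he]
      have := (h2 (i + j) hj').1
      rw [add_assoc] at this
      rw [this]
      apply Function.update_of_ne
      rintro rfl
      apply getElem_notMem_take hσ.1 hj'
      rw [List.mem_toFinset] at he ⊢
      exact List.take_subset_take_left σ (Nat.le_add_right i j) he
  have key' : ∀ i ≤ σ.length, ∀ e ∈ (σ.take i).toFinset, w σ.length e = w i e := by
    intro i hi e he
    obtain ⟨j, hj⟩ := Nat.exists_eq_add_of_le hi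
    have := key i j hj.ge e he
    rwa [← hj] at this
  refine ⟨h0, fun i hi => ?_, fun i hi => ?_⟩
  · rw [key' (i + 1) hi _ (by rw [toFinset_take_succ σ hi]; exact Finset.mem_insert_self _ _),
      (h2 i hi).1, Function.update_self]
  · apply (h2 i hi).2.congr (h3 i hi.le).valid
    intro g hg
    rw [← toFinset_take_succ σ hi] at hg
    exact (key' (i + 1) hi g hg).symm

end Run

/-! ### Memory, time and oracle calls -/

section Resources

variable {n : ℕ} {f : Finset (Sym2 (Fin n)) → ℝ} {σ : List (Sym2 (Fin n))}

theorem IsMatching.card_le {M : Finset (Sym2 (Fin n))} (hM : IsMatching M) (hl : Loopless M) :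
    M.card ≤ n := by
  have h := sum_verts_mul hM hl (fun _ => 1) (fun _ => 1) fun _ _ _ _ => rfl
  simp only [Finset.sum_const, nsmul_eq_mul, mul_one] at h
  have h1 : (verts M).card ≤ n := (Finset.card_le_univ _).trans (Fintype.card_fin n).le
  have h2 : (verts M).card = 2 * M.card := by exact_mod_cast h
  omega

theorem card_arrayEdges_le (sh : Fin n → Option (Fin n)) : (arrayEdges sh).card ≤ n := by
  have h : arrayEdges sh ⊆ Finset.univ.image fun v => s(v, (sh v).getD v) := by
    intro s hs
    obtain ⟨v, a, hv, rfl⟩ := mem_arrayEdges.1 hs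
    exact Finset.mem_image.2 ⟨v, Finset.mem_univ v, by rw [hv]; rfl⟩
  exact (Finset.card_le_card h).trans (Finset.card_image_le.trans (Finset.card_fin n).le)

/-- The matching is stored twice, once alone and once with the shadow edges, of which there is at
most one per vertex. -/
theorem Mem.Rep.edges_le {m : Mem 16 n} {c : Config n} {w : Sym2 (Fin n) → ℝ}
    {E : Finset (Sym2 (Fin n))} (h : m.Rep c w) (hc : c.Valid E) : m.edges ≤ 3 * n := by
  have h0 : m.edges = (m.eset 0).card + (m.eset 1).card := by
    rw [Mem.edges, Fintype.sum_eq_add 0 1 (by decide)]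
    intro q hq
    rw [h.eset q hq.1 hq.2, Finset.card_empty]
  have h1 := hc.matching.card_le hc.loopless
  have h2 : c.S.card ≤ n := by
    rw [hc.S_eq]
    exact card_arrayEdges_le _
  have h3 := Finset.card_union_le c.M c.S
  rw [h0, h.holds.eset, h.eset_one]
  omega

theorem feed_time_le (R : Machine 16 n) (e : Sym2 (Fin n)) :
    (zelkeProgram.feed f R e).time ≤ R.time + (zelkeCmd.cost + 1) := by
  have := Cmd.exec_time_le f zelkeCmd (R.tick { R.mem with
    vreg := Function.update (Function.update R.mem.vreg 0 (some e.inf)) 1 (some e.sup) })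
  refine this.trans (le_of_eq ?_)
  rw [Machine.tick, add_assoc, add_comm 1]

theorem feed_peakEdges_le (R : Machine 16 n) (e : Sym2 (Fin n)) :
    (zelkeProgram.feed f R e).peakEdges ≤ max R.peakEdges (R.mem.edges + zelkeCmd.cost) := by
  have := (Cmd.exec_edges_le f zelkeCmd (R.tick { R.mem with
    vreg := Function.update (Function.update R.mem.vreg 0 (some e.inf)) 1 (some e.sup) })).2
  refine this.trans (max_le ?_ (le_max_right _ _))
  exact max_le (le_max_left _ _) (le_max_of_le_right (Nat.le_add_right _ _))

theorem feed_queries (R : Machine 16 n) (e : Sym2 (Fin n)) :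
    (zelkeProgram.feed f R e).queries = insert e (R.mem.eset 1) :: R.mem.eset 1 :: R.queries := by
  have := exec_queries_zelkeCmd f (R.tick { R.mem with
    vreg := Function.update (Function.update R.mem.vreg 0 (some e.inf)) 1 (some e.sup) })
  refine this.trans ?_
  simp [Machine.tick, Mem.edgeOf, inf_sup_eq]

variable {c : ℕ → Config n} {w : ℕ → Sym2 (Fin n) → ℝ}

theorem queries_subset (h : ∀ i ≤ σ.length, Represents f σ i (c i) (w i)) {i : ℕ}
    (hi : i ≤ σ.length) : ∀ Q ∈ (zelkeProgram.run f (σ.take i)).queries, Q ⊆ σ.toFinset := by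
  induction i with
  | zero => intro Q hQ; exact absurd hQ List.not_mem_nil
  | succ i ih =>
    have hi' : i < σ.length := hi
    have hX : Mem.eset (zelkeProgram.run f (σ.take i)).mem (1 : Fin 16) ⊆ σ.toFinset := by
      have hr := h i hi'.le
      rw [hr.rep.eset_one]
      exact (Finset.union_subset hr.valid.subset hr.valid.S_subset).trans (toFinset_take_subset σ i)
    intro Q hQ
    rw [run_take_succ _ _ _ hi'] at hQ
    have hQ := Eq.mp (congrArg (fun l => Q ∈ l)
      (feed_queries (f := f) (zelkeProgram.run f (σ.take i)) σ[i])) hQ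
    rw [List.mem_cons, List.mem_cons] at hQ
    rcases hQ with rfl | rfl | hQ
    · exact Finset.insert_subset (List.mem_toFinset.2 (List.getElem_mem hi')) hX
    · exact hX
    · exact ih hi'.le Q hQ

theorem peakEdges_le (h : ∀ i ≤ σ.length, Represents f σ i (c i) (w i)) {i : ℕ}
    (hi : i ≤ σ.length) :
    (zelkeProgram.run f (σ.take i)).peakEdges ≤ (3 + zelkeCmd.cost) * n := by
  induction i with
  | zero => exact Nat.zero_le _
  | succ i ih =>
    have hi' : i < σ.length := hi
    -- An arriving edge has a vertex, so `n ≥ 1`, and the additive constant can be absorbed into a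
    -- multiple of `n`.
    have hn : 1 ≤ n := (σ[i].inf).pos
    have h1 := (h i hi'.le).rep.edges_le (h i hi'.le).valid
    rw [run_take_succ _ _ _ hi']
    refine (feed_peakEdges_le _ _).trans (max_le (ih hi'.le) ?_)
    have h2 : zelkeCmd.cost ≤ zelkeCmd.cost * n := Nat.le_mul_of_pos_right _ hn
    rw [add_mul]
    exact Nat.add_le_add h1 h2

/-- Because `n + 1 ≤ n ^ 2` for `n ≥ 2`. -/
theorem clog_succ_le {n : ℕ} (hn : 2 ≤ n) : Nat.clog 2 (n + 1) ≤ 2 * Nat.clog 2 n := by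
  apply Nat.clog_le_of_le_pow
  have h := Nat.le_pow_clog one_lt_two n
  rw [mul_comm, pow_mul]
  nlinarith

theorem bits_le {n : ℕ} (hn : 2 ≤ n) (b : ℕ) {s K : ℕ} (hs : s ≤ K * n) :
    zelkeProgram.bits n b s ≤ (64 + 4 * K) * (n * (Nat.clog 2 n + b)) := by
  have h1 := clog_succ_le hn
  have h2 : n + 1 ≤ 2 * n := by omega
  have e : zelkeProgram.bits n b s = 16 * (n + 1) * Nat.clog 2 (n + 1) + 16 * (n + 1) * b +
    s * (2 * Nat.clog 2 (n + 1)) := rfl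
  rw [e]
  calc 16 * (n + 1) * Nat.clog 2 (n + 1) + 16 * (n + 1) * b + s * (2 * Nat.clog 2 (n + 1))
      ≤ 16 * (2 * n) * (2 * Nat.clog 2 n) + 16 * (2 * n) * b +
        K * n * (2 * (2 * Nat.clog 2 n)) := by gcongr
    _ ≤ (64 + 4 * K) * (n * (Nat.clog 2 n + b)) := by
      have h3 : 0 ≤ n * b * (32 + 4 * K) := Nat.zero_le _
      nlinarith

end Resources
end MSM

theorem theorem1 :
    ∃ (P : MSM.StreamProgram) (C : ℕ),
      ∀ (n : ℕ) (σ : List (Sym2 (Fin n))) (f : Finset (Sym2 (Fin n)) → ℝ),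
        MSM.IsGraphStream σ → MSM.IsMonotoneSubmodular σ.toFinset f →
        -- only subsets of the edge set are ever sent to the oracle
        (∀ Q ∈ (P.run f σ).queries, Q ⊆ σ.toFinset) ∧
        -- `O(n)` edges are stored at all times
        (P.run f σ).peakEdges ≤ C * n ∧
        -- the whole memory takes `O(n log n)` bits at all times if a weight takes `b = O(1)` bits
        (2 ≤ n → ∀ b : ℕ,
          P.bits n b (P.run f σ).peakEdges ≤ C * (n * (Nat.clog 2 n + b))) ∧
        -- every edge is processed in `O(1)` elementary steps, oracle calls included
        (∀ i < σ.length,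
          (P.run f (σ.take (i + 1))).time ≤ (P.run f (σ.take i)).time + C) ∧
        -- the output is a `7.75`-approximate maximum submodular matching
        MSM.IsApproxMSM σ.toFinset f 7.75 (P.output f σ) ∧
        -- the current solution evolves as in the `f`-extension of Zelke's algorithm with `γ = 1`
        (∃ (c : ℕ → MSM.Config n) (w : ℕ → Sym2 (Fin n) → ℝ),
          MSM.IsZelkeExtensionRun 1 f σ c w ∧
          ∀ i ≤ σ.length, P.output f (σ.take i) = (c i).M) := by
  obtain ⟨K, hK⟩ : ∃ K, K = 3 + MSM.zelkeCmd.cost := ⟨_, rfl⟩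
  -- The memory bound dictates the constant: `16 (n + 1)` vertex cells cost at most `64 n ⌈log₂ n⌉`
  -- bits, and `K n` edges at most `4 K n ⌈log₂ n⌉`. It also exceeds the cost of a step.
  refine ⟨MSM.zelkeProgram, 64 + 4 * K, ?_⟩
  intro n σ f hσ hf
  obtain ⟨c, w, h1, h2, h3⟩ := MSM.exists_strictRun hσ hf
  have hout : ∀ i ≤ σ.length, MSM.zelkeProgram.output f (σ.take i) = (c i).M := fun i hi =>
    (h3 i hi).rep.holds.eset
  have hpeak := MSM.peakEdges_le h3 le_rfl
  have hq := MSM.queries_subset h3 le_rfl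
  have hM := hout _ le_rfl
  rw [List.take_length] at hpeak hq hM
  rw [← hK] at hpeak
  refine ⟨hq, hpeak.trans (Nat.mul_le_mul_right n (by omega)),
    fun hn b => MSM.bits_le hn b hpeak, fun i hi => ?_, ?_, c, w, h1, hout⟩
  · rw [MSM.run_take_succ _ _ _ hi]
    exact (MSM.feed_time_le _ _).trans (Nat.add_le_add_left (by omega) _)
  · rw [hM]
    exact h2.isApproxMSM hσ hf
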